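/- Let $\mathbb K=\mathbb R$ or $\mathbb C$ and let $N\ge 0$ be an integer. **Setting.** For a super vector space $V$ with a (countable) homogeneous basis of coordinates, let $\mathbb K[[V,\hbar]]$ be the completion of the supercommutative polynomial algebra in the coordinates and $\hbar$ with respect to the degree ($\deg x=\deg\theta=1$, $\deg\hbar=2$), and let $\widehat{\mathcal W}_\hbar(V)$ be the completed Weyl algebra: the closure, in the topology of pointwise convergence on $\mathbb K[[V,\hbar]]$, of the algebra generated by $\hbar$, the coordinates $x^a$ and the operators $\hbar\partial_a$. Put $\widetilde V=V\oplus\mathbb K^{0|1}$, i.e. $V$ with one extra odd coordinate. A *super quantum Airy structure* is a pair $(V,L)$ where $L:V^*\to\widehat{\mathcal W}_\hbar(\widetilde V)$ is an even linear map, continuous for the topologies of pointwise convergence, such that (1) the left ideal $\mathfrak L$ of $\widehat{\mathcal W}_\hbar(\widetilde V)$ generated by $L(V^*)$ satisfies $[\mathfrak L,\mathfrak L]\subseteq\hbar\,\mathfrak L$ (super-commutator), and (2) for every vector $y_i$ dual to a basis coordinate $x^i$ of $V$, the part of $L(y_i)$ of degree $\le 1$ is $\hbar\partial_i$. Let $\{x^1,x^2,\dots\}$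 (even) and $\{\theta^1,\theta^2,\dots\}$ (odd) be a basis of $V$, with dual sets $\{y_1,y_2,\dots\}$ and $\{\eta_1,\eta_2,\dots\}$. For $r\in\mathbb Z_{\ge0}+\tfrac12$ put $$b_r=\sqrt\hbar\,\frac{\partial}{\partial x^{r+1/2}},\quad b_{-r}=\frac{r}{\sqrt\hbar}\,x^{r+1/2},\quad \psi_r=\sqrt\hbar\,\frac{\partial}{\partial\theta^{r+1/2}},\quad \psi_{-r}=\frac1{\sqrt\hbar}\,\theta^{r+1/2}.$$ Write $:\!b_rb_s\!:$ for the product with negative modes to the left of positive modes, and $:\!\psi_r\psi_s\!:\,=\psi_r\psi_s$ if $r\le s$, $:\!\psi_r\psi_s\!:\,=-\psi_s\psi_r$ if $r>s$. For $i\ge1$ define $$H_i=\hbar\frac{\partial}{\partial x^i}+\frac\hbar2\sum_{r\in\mathbb Z+\frac12}:\!b_rb_{i+N-1-r}\!:+\frac\hbar2\sum_{r\in\mathbb Z+\frac12}\Big(r+\frac{i+N-1}2\Big):\!\psi_{-r}\psi_{i+N-1+r}\!:,$$ $$F_i=\hbar\frac{\partial}{\partial\theta^i}+\hbar\sum_{r\in\mathbb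 Z+\frac12}b_{i+N-1-r}\psi_r .$$ **Proposition.** The modes represent the super Heisenberg algebra: $[b_r,b_s]=r\,\delta_{r,-s}$, $\{\psi_r,\psi_s\}=\delta_{r,-s}$, $[b_r,\psi_s]=0$. The operators $H_i,F_i$ lie in $\widehat{\mathcal W}_\hbar(V)$ and satisfy, for $m,n\ge1$, the ($\hbar$-rescaled) relations of the subalgebra of the Ramond-sector super Virasoro algebra $$[H_m,H_n]=\hbar(m-n)H_{m+n+N-1},\quad [H_m,F_n]=\hbar\Big(\frac{m-N+1}2-n\Big)F_{m+n+N-1},\quad \{F_m,F_n\}=2\hbar H_{m+n+N-1}.\qquad(*)$$ 1. For arbitrary constants $D_1,\dots,D_N\in\mathbb K$ there is a unique continuous linear operator $L:V^*\to\widehat{\mathcal W}_\hbar(V)\subset\widehat{\mathcal W}_\hbar(\widetilde V)$ with $L(y_i)=H_i+\hbar D_i\delta_{i\le N}$ and $L(\eta_i)=F_i$ for all $i\ge1$. The pair $(V,L)$ is a super quantum Airy structure (without dependence on an extra fermionic coordinate), and the operators $L(y_i),L(\eta_i)$ satisfy the relations $(*)$ (with $L(y_i)$ in place of $H_i$). 2.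 Let $V_{red}\subset V$ be the span of $\{x^1,x^2,\dots\}$ and $\{\theta^2,\theta^3,\dots\}$, so that $V=\widetilde{V_{red}}$ with extra odd coordinate $\theta^1$. For arbitrary constants $D_1,\dots,D_{N+1}\in\mathbb K$ there is a unique continuous linear operator $L:V_{red}^*\to\widehat{\mathcal W}_\hbar(V)$ with $L(y_i)=H_i+\hbar D_i\delta_{i\le N+1}$ for all $i\ge1$ and $L(\eta_j)=F_j$ for all $j\ge2$. The pair $(V_{red},L)$ is a super quantum Airy structure with the extra fermionic coordinate $\theta^1$, and the operators $L(y_i)$ ($i\ge1$), $L(\eta_j)$ ($j\ge2$) satisfy the relations $(*)$ restricted to odd indices $\ge2$. -/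

import Mathlib

noncomputable section

namespace SuperAiry

/-! Formal super power series `𝕂[[V, ħ]]` and operators on it.  A super vector space is given by a
homogeneous basis: `E` indexes the even coordinates `x`, `Θ` the odd coordinates `θ`. The linear
order on `Θ` only fixes the sign conventions in the basis of ordered odd monomials. -/

/-- `(α, S, k)` stands for the monomial `x ^ α * θ_S * ħ ^ k`, where `θ_S` is the product of the
`θ_s`, `s ∈ S`, in increasing order. -/
abbrev Mon (E Θ : Type) : Type := (E →₀ ℕ) × Finset Θ × ℕ

/-- The degree of a monomial: `deg x = deg θ = 1` and `deg ħ = 2`. -/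
def deg {E Θ : Type} (M : Mon E Θ) : ℕ := M.1.degree + M.2.1.card + 2 * M.2.2

/-- `𝕂[[V, ħ]]`, the completion of the super polynomial ring `𝕂[V, ħ]` for the topology defined by
its elements of high degree: families of coefficients such that every homogeneous component is a
polynomial (has finitely many non-zero coefficients). -/
def seriesSubmodule (𝕂 : Type) [RCLike 𝕂] (E Θ : Type) : Submodule 𝕂 (Mon E Θ → 𝕂) where
  carrier := {f | ∀ d : ℕ, {M | deg M = d ∧ f M ≠ 0}.Finite}
  zero_mem' := fun d => by simp
  add_mem' := by
    intro f g hf hg d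
    refine ((hf d).union (hg d)).subset ?_
    rintro M ⟨hM, h⟩
    by_cases h0 : f M = 0
    · exact Or.inr ⟨hM, fun h1 => h (by simp [h0, h1])⟩
    · exact Or.inl ⟨hM, h0⟩
  smul_mem' := by
    intro c f hf d
    refine (hf d).subset ?_
    rintro M ⟨hM, h⟩
    exact ⟨hM, fun h1 => h (by simp [h1])⟩

/-- The space `𝕂[[V, ħ]]`. -/
abbrev Series (𝕂 : Type) [RCLike 𝕂] (E Θ : Type) : Type := seriesSubmodule 𝕂 E Θ

/-- The linear endomorphisms of `𝕂[[V, ħ]]`. -/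
abbrev Op (𝕂 : Type) [RCLike 𝕂] (E Θ : Type) : Type := Module.End 𝕂 (Series 𝕂 E Θ)

/-- `𝕂[[V, ħ]]^{≥ n}`: the series without terms of degree `< n`. These subspaces are the basis of
neighbourhoods of zero of the topology of `𝕂[[V, ħ]]`. -/
def degGE (𝕂 : Type) [RCLike 𝕂] (E Θ : Type) (n : ℕ) : Submodule 𝕂 (Series 𝕂 E Θ) where
  carrier := {f | ∀ M, deg M < n → f.1 M = 0}
  zero_mem' := fun M _ => rfl
  add_mem' := fun {f g} hf hg M hM => by simp [hf M hM, hg M hM]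
  smul_mem' := fun c f hf M hM => by simp [hf M hM]

section Operators

variable {𝕂 : Type} [RCLike 𝕂] {E Θ : Type}

/-- The operator `f ↦ (M ↦ c M * f (p M))` on coefficient families. -/
def shiftOp (c : Mon E Θ → 𝕂) (p : Mon E Θ → Mon E Θ) (e : ℕ → ℕ)
    (hp : Set.InjOn p {M | c M ≠ 0}) (he : ∀ M, c M ≠ 0 → deg (p M) = e (deg M)) :
    Op 𝕂 E Θ where
  toFun f := ⟨fun M => c M * f.1 (p M), by
    intro d
    refine Set.Finite.of_finite_image ((f.2 (e d)).subset ?_) (hp.mono ?_) (f := p)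
    · rintro _ ⟨M, ⟨hM, h⟩, rfl⟩
      exact ⟨by rw [he M (left_ne_zero_of_mul h), hM], right_ne_zero_of_mul h⟩
    · rintro M ⟨hM, h⟩
      exact left_ne_zero_of_mul h⟩
  map_add' f g := by
    ext M
    simp [mul_add]
  map_smul' c f := by
    ext M
    simp [mul_left_comm]

/-- Multiplication by `ħ`. -/
def hbar : Op 𝕂 E Θ :=
  shiftOp (fun M => if M.2.2 = 0 then 0 else 1) (fun M => (M.1, M.2.1, M.2.2 - 1)) (fun d => d - 2)
    (by
      rintro ⟨a, S, k⟩ hM ⟨a', S', k'⟩ hM' h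
      simp only [Set.mem_ofPred_eq, ne_eq, ite_eq_left_iff, one_ne_zero, imp_false, not_not,
        Prod.mk.injEq] at hM hM' h ⊢
      exact ⟨h.1, h.2.1, by omega⟩)
    (by
      rintro ⟨a, S, k⟩ hM
      simp only [ne_eq, ite_eq_left_iff, one_ne_zero, imp_false, not_not] at hM
      simp only [deg]
      omega)

/-- Multiplication by the even coordinate `x_a`. -/
def mulX (a : E) : Op 𝕂 E Θ :=
  shiftOp (fun M => if M.1 a = 0 then 0 else 1) (fun M => (M.1 - Finsupp.single a 1, M.2))
    (fun d => d - 1)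
    (by
      rintro ⟨m, S, k⟩ hM ⟨m', S', k'⟩ hM' h
      simp only [Set.mem_ofPred_eq, ne_eq, ite_eq_left_iff, one_ne_zero, imp_false, not_not,
        Prod.mk.injEq] at hM hM' h ⊢
      refine ⟨?_, h.2⟩
      have h1 : Finsupp.single a 1 ≤ m := by
        rw [Finsupp.single_le_iff]; omega
      have h2 : Finsupp.single a 1 ≤ m' := by
        rw [Finsupp.single_le_iff]; omega
      rw [← tsub_add_cancel_of_le h1, h.1, tsub_add_cancel_of_le h2])
    (by
      rintro ⟨m, S, k⟩ hM
      simp only [ne_eq, ite_eq_left_iff, one_ne_zero, imp_false, not_not] at hM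
      have h1 : Finsupp.single a 1 ≤ m := by
        rw [Finsupp.single_le_iff]; omega
      have h2 : (m - Finsupp.single a 1).degree + 1 = m.degree := by
        conv_rhs => rw [← tsub_add_cancel_of_le h1]
        rw [map_add, Finsupp.degree_single]
      simp only [deg]
      omega)

/-- The partial derivative `∂ / ∂x_a`. -/
def dX (a : E) : Op 𝕂 E Θ :=
  shiftOp (fun M => ((M.1 a : 𝕂) + 1)) (fun M => (M.1 + Finsupp.single a 1, M.2)) (fun d => d + 1)
    (by
      rintro ⟨m, S, k⟩ hM ⟨m', S', k'⟩ hM' h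
      simp only [Prod.mk.injEq, add_left_inj] at h ⊢
      exact h)
    (by
      rintro ⟨m, S, k⟩ hM
      simp only [deg, map_add, Finsupp.degree_single]
      omega)

lemma hbar_mem_degGE {n : ℕ} {f : Series 𝕂 E Θ} (hf : f ∈ degGE 𝕂 E Θ n) :
    (hbar : Op 𝕂 E Θ) f ∈ degGE 𝕂 E Θ (n + 2) := by
  rintro ⟨m, S, k⟩ hM
  simp only [deg] at hM
  change (if k = 0 then (0 : 𝕂) else 1) * f.1 (m, S, k - 1) = 0
  split_ifs with h
  · simp
  · rw [hf _ (by simp only [deg]; omega), mul_zero]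

lemma mulX_mem_degGE (a : E) {n : ℕ} {f : Series 𝕂 E Θ} (hf : f ∈ degGE 𝕂 E Θ n) :
    (mulX a : Op 𝕂 E Θ) f ∈ degGE 𝕂 E Θ n := by
  rintro ⟨m, S, k⟩ hM
  change (if m a = 0 then (0 : 𝕂) else 1) * f.1 (m - Finsupp.single a 1, S, k) = 0
  have h2 : (m - Finsupp.single a 1).degree ≤ m.degree := Finsupp.degree_mono tsub_le_self
  rw [hf _ (by simp only [deg] at hM ⊢; omega), mul_zero]

variable [LinearOrder Θ]

/-- The sign of moving `θ_a` to its place in the increasing product `θ_S`. -/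
def oddSign (𝕂 : Type) [RCLike 𝕂] (a : Θ) (S : Finset Θ) : 𝕂 := (-1) ^ (S.filter (· < a)).card

/-- Left multiplication by the odd coordinate `θ_a`. -/
def mulTheta (a : Θ) : Op 𝕂 E Θ :=
  shiftOp (fun M => if a ∈ M.2.1 then oddSign 𝕂 a M.2.1 else 0)
    (fun M => (M.1, M.2.1.erase a, M.2.2)) (fun d => d - 1)
    (by
      rintro ⟨m, S, k⟩ hM ⟨m', S', k'⟩ hM' h
      have h1 : a ∈ S := by by_contra h0; simp [h0] at hM
      have h2 : a ∈ S' := by by_contra h0; simp [h0] at hM'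
      simp only [Prod.mk.injEq] at h ⊢
      refine ⟨h.1, ?_, h.2.2⟩
      rw [← Finset.insert_erase h1, h.2.1, Finset.insert_erase h2])
    (by
      rintro ⟨m, S, k⟩ hM
      have h1 : a ∈ S := by by_contra h0; simp [h0] at hM
      have h2 := Finset.card_erase_add_one h1
      simp only [deg]
      omega)

/-- The left derivative `∂ / ∂θ_a`. -/
def dTheta (a : Θ) : Op 𝕂 E Θ :=
  shiftOp (fun M => if a ∈ M.2.1 then 0 else oddSign 𝕂 a M.2.1)
    (fun M => (M.1, insert a M.2.1, M.2.2)) (fun d => d + 1)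
    (by
      rintro ⟨m, S, k⟩ hM ⟨m', S', k'⟩ hM' h
      have h1 : a ∉ S := by intro h0; simp [h0] at hM
      have h2 : a ∉ S' := by intro h0; simp [h0] at hM'
      simp only [Prod.mk.injEq] at h ⊢
      refine ⟨h.1, ?_, h.2.2⟩
      rw [← Finset.erase_insert h1, h.2.1, Finset.erase_insert h2])
    (by
      rintro ⟨m, S, k⟩ hM
      have h1 : a ∉ S := by intro h0; simp [h0] at hM
      have h2 := Finset.card_insert_of_notMem h1
      simp only [deg]
      omega)

/-- Multiplication by the coordinate with index `a`. -/
def mulCoord : E ⊕ Θ → Op 𝕂 E Θ := Sum.elim mulX mulTheta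

/-- `ħ ∂_a`. -/
def hbarD (a : E ⊕ Θ) : Op 𝕂 E Θ := hbar * Sum.elim dX dTheta a

/-- The parity operator, `f ↦ (-1)^{|f|} f`. -/
def parity : Op 𝕂 E Θ :=
  shiftOp (fun M => (-1) ^ M.2.1.card) id id (Set.injOn_id _) (fun _ _ => rfl)

/-- Even operators: those that preserve the parity. -/
def IsEven (T : Op 𝕂 E Θ) : Prop := parity * T = T * parity

/-- Odd operators: those that reverse the parity. -/
def IsOdd (T : Op 𝕂 E Θ) : Prop := parity * T = -(T * parity)

/-- The even component of an operator. -/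
def evenPart (T : Op 𝕂 E Θ) : Op 𝕂 E Θ := (1 / 2 : 𝕂) • (T + parity * T * parity)

/-- The odd component of an operator. -/
def oddPart (T : Op 𝕂 E Θ) : Op 𝕂 E Θ := (1 / 2 : 𝕂) • (T - parity * T * parity)

/-- The super-commutator: the bilinear operation with `[S, T] = S T - (-1)^{|S| |T|} T S` for
homogeneous `S` and `T`. -/
def superComm (S T : Op 𝕂 E Θ) : Op 𝕂 E Θ :=
  S * T - (evenPart T * evenPart S + evenPart T * oddPart S + oddPart T * evenPart S
    - oddPart T * oddPart S)

/-! ### The completed Weyl algebra -/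

/-- The algebra generated by `ħ` and by `x_a`, `ħ ∂_a` for the coordinates `a ∈ U`. -/
def weylAlg (𝕂 : Type) [RCLike 𝕂] (U : Set (E ⊕ Θ)) : Subalgebra 𝕂 (Op 𝕂 E Θ) :=
  Algebra.adjoin 𝕂 ({hbar} ∪ mulCoord '' U ∪ hbarD '' U)

lemma mulTheta_mem_degGE (a : Θ) {n : ℕ} {f : Series 𝕂 E Θ} (hf : f ∈ degGE 𝕂 E Θ n) :
    (mulTheta a : Op 𝕂 E Θ) f ∈ degGE 𝕂 E Θ n := by
  rintro ⟨m, S, k⟩ hM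
  change (if a ∈ S then oddSign 𝕂 a S else 0) * f.1 (m, S.erase a, k) = 0
  have h2 : (S.erase a).card ≤ S.card := Finset.card_le_card (Finset.erase_subset a S)
  rw [hf _ (by simp only [deg] at hM ⊢; omega), mul_zero]

lemma mulCoord_mem_degGE (a : E ⊕ Θ) {n : ℕ} {f : Series 𝕂 E Θ} (hf : f ∈ degGE 𝕂 E Θ n) :
    (mulCoord a : Op 𝕂 E Θ) f ∈ degGE 𝕂 E Θ n := by
  rcases a with a | a
  · exact mulX_mem_degGE a hf
  · exact mulTheta_mem_degGE a hf

lemma hbarD_mem_degGE (a : E ⊕ Θ) {n : ℕ} {f : Series 𝕂 E Θ} (hf : f ∈ degGE 𝕂 E Θ n) :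
    (hbarD a : Op 𝕂 E Θ) f ∈ degGE 𝕂 E Θ n := by
  rintro ⟨m, S, k⟩ hM
  rcases a with a | a
  · change (if k = 0 then (0 : 𝕂) else 1) *
      (((m a : 𝕂) + 1) * f.1 (m + Finsupp.single a 1, S, k - 1)) = 0
    split_ifs with h
    · simp
    · rw [hf _ (by simp only [deg, map_add, Finsupp.degree_single] at hM ⊢; omega)]
      simp
  · change (if k = 0 then (0 : 𝕂) else 1) *
      ((if a ∈ S then 0 else oddSign 𝕂 a S) * f.1 (m, insert a S, k - 1)) = 0
    have h2 := Finset.card_insert_le a S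
    by_cases h : k = 0
    · simp [h]
    · have h3 : f.1 (m, insert a S, k - 1) = 0 := hf _ (by simp only [deg] at hM ⊢; omega)
      simp [h3]

lemma weylAlg_mem_degGE {U : Set (E ⊕ Θ)} {T : Op 𝕂 E Θ} (hT : T ∈ weylAlg 𝕂 U) :
    ∀ {n : ℕ} {f : Series 𝕂 E Θ}, f ∈ degGE 𝕂 E Θ n → T f ∈ degGE 𝕂 E Θ n := by
  induction hT using Algebra.adjoin_induction with
  | mem T hT =>
    intro n f hf
    rcases hT with (hT | ⟨a, _, rfl⟩) | ⟨a, _, rfl⟩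
    · rw [Set.mem_singleton_iff.1 hT]
      exact fun M hM => hbar_mem_degGE hf M (by omega)
    · exact mulCoord_mem_degGE a hf
    · exact hbarD_mem_degGE a hf
  | algebraMap r =>
    intro n f hf
    exact Submodule.smul_mem _ r hf
  | add S T _ _ hS hT => exact fun hf => add_mem (hS hf) (hT hf)
  | mul S T _ _ hS hT => exact fun hf => hS (hT hf)

/-- The completed Weyl algebra in the coordinates `a ∈ U`: the closure of the algebra generated by
`ħ`, `x_a`, `ħ ∂_a` in the topology of pointwise convergence on `𝕂[[V, ħ]]` (two operators are
close if they agree on finitely many series up to a high degree). The closure contains, and is also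
the closure of, the algebra of finite sums of operators
`∑ c_{i_1 … i_n}^{j_1 … j_m} ħ^{m+k} x_{i_1} … x_{i_n} ∂_{j_1} … ∂_{j_m}`
(infinite sums over the indices, with finitely many `i` for every `j`), as these are
pointwise limits of their finite partial sums. -/
def weylHat (𝕂 : Type) [RCLike 𝕂] (U : Set (E ⊕ Θ)) : Subalgebra 𝕂 (Op 𝕂 E Θ) where
  carrier := {T | ∀ (s : Finset (Series 𝕂 E Θ)) (n : ℕ), ∃ S ∈ weylAlg 𝕂 U,
    ∀ f ∈ s, T f - S f ∈ degGE 𝕂 E Θ n}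
  algebraMap_mem' := fun r s n => ⟨_, Subalgebra.algebraMap_mem _ r, fun f _ => by simp⟩
  add_mem' := by
    intro T T' hT hT' s n
    obtain ⟨S, hS, h⟩ := hT s n
    obtain ⟨S', hS', h'⟩ := hT' s n
    refine ⟨S + S', add_mem hS hS', fun f hf => ?_⟩
    have := add_mem (h f hf) (h' f hf)
    simp only [LinearMap.add_apply]
    convert this using 1
    abel
  mul_mem' := by
    classical
    intro T T' hT hT' s n
    obtain ⟨S', hS', h'⟩ := hT' s n
    obtain ⟨S, hS, h⟩ := hT (s.image S' ∪ s.image (fun f => T' f - S' f)) n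
    refine ⟨S * S', mul_mem hS hS', fun f hf => ?_⟩
    have h1 := h (S' f) (Finset.mem_union_left _ (Finset.mem_image_of_mem _ hf))
    have h2 := h (T' f - S' f)
      (Finset.mem_union_right _ (Finset.mem_image_of_mem (fun f => T' f - S' f) hf))
    have h3 := weylAlg_mem_degGE hS (h' f hf)
    have h4 := add_mem h1 (add_mem h2 h3)
    simp only [Module.End.mul_apply]
    convert h4 using 1
    simp only [map_sub]
    abel

/-- Membership in `Ŵ^{≥ d}` for an operator: it raises the degree by at least `d`. -/
def RaisesDegree (d : ℕ) (T : Op 𝕂 E Θ) : Prop :=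
  ∀ (n : ℕ) (f : Series 𝕂 E Θ), f ∈ degGE 𝕂 E Θ n → T f ∈ degGE 𝕂 E Θ (n + d)

end Operators

/-! ### Super quantum Airy structures

`Ṽ` has the coordinates `E` (even) and `Θ` (odd), and one of the odd coordinates, `o : Θ`, is the
extra one: `V` has the coordinates `E` and `Θ \ {o}`, and `Ṽ = V ⊕ 𝕂^{0|1}`. -/

/-- The super vector space `V`, with its basis. -/
abbrev VSpace (𝕂 : Type) [RCLike 𝕂] (E : Type) {Θ : Type} (o : Θ) : Type :=
  (E ⊕ {t : Θ // t ≠ o}) →₀ 𝕂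

/-- The elements of `V*` dual to the basis of `V`. -/
def dualVec {𝕂 : Type} [RCLike 𝕂] {E Θ : Type} {o : Θ} (i : E ⊕ {t : Θ // t ≠ o}) :
    Module.Dual 𝕂 (VSpace 𝕂 E o) := Finsupp.lapply i

/-- The coordinates of `V` among those of `Ṽ`. -/
def toTilde {E Θ : Type} {o : Θ} : E ⊕ {t : Θ // t ≠ o} → E ⊕ Θ := Sum.map id Subtype.val

section Airy

variable {𝕂 : Type} [RCLike 𝕂] {E Θ : Type} [LinearOrder Θ] {o : Θ}

/-- Continuity of a linear operator `L : V* → Ŵ(Ṽ)`, for the topologies of pointwise convergence: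
for every series `f`, `L φ f` has high degree if `φ` vanishes on a large finite part of the basis
of `V`. -/
def IsContinuous (L : Module.Dual 𝕂 (VSpace 𝕂 E o) →ₗ[𝕂] weylHat 𝕂 (Set.univ : Set (E ⊕ Θ))) :
    Prop :=
  ∀ (f : Series 𝕂 E Θ) (n : ℕ), ∃ J : Finset (E ⊕ {t : Θ // t ≠ o}),
    ∀ φ : Module.Dual 𝕂 (VSpace 𝕂 E o), (∀ j ∈ J, φ (Finsupp.single j 1) = 0) →
      (L φ : Op 𝕂 E Θ) f ∈ degGE 𝕂 E Θ n

/-- `(V, L)` is a super quantum Airy structure. -/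
structure IsSuperQuantumAiry
    (L : Module.Dual 𝕂 (VSpace 𝕂 E o) →ₗ[𝕂] weylHat 𝕂 (Set.univ : Set (E ⊕ Θ))) : Prop where
  continuous : IsContinuous L
  even_even : ∀ φ : Module.Dual 𝕂 (VSpace 𝕂 E o),
    (∀ t, φ (Finsupp.single (Sum.inr t) 1) = 0) → IsEven (L φ : Op 𝕂 E Θ)
  odd_odd : ∀ φ : Module.Dual 𝕂 (VSpace 𝕂 E o),
    (∀ e, φ (Finsupp.single (Sum.inl e) 1) = 0) → IsOdd (L φ : Op 𝕂 E Θ)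
  /-- The left ideal `I` generated by `L(V*)` satisfies `[I, I] ⊆ ħ I`. -/
  involutive : ∀ A ∈ Ideal.span (Set.range L), ∀ B ∈ Ideal.span (Set.range L),
    ∃ C ∈ Ideal.span (Set.range L),
      superComm (A : Op 𝕂 E Θ) (B : Op 𝕂 E Θ) = hbar * (C : Op 𝕂 E Θ)
  /-- The part of degree `≤ 1` of `L(y_i)` is `ħ ∂_i`. -/
  linear_part : ∀ i, RaisesDegree 2 ((L (dualVec i) : Op 𝕂 E Θ) - hbarD (toTilde i))

end Airy

/-! ### Pointwise convergent sums of operators -/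

section Sums

variable {𝕂 : Type} [RCLike 𝕂] {E Θ : Type}

/-- For every series `f`, only finitely many `T k f` have terms in low degree. -/
def PointwiseFinite (T : ℤ → Op 𝕂 E Θ) : Prop :=
  ∀ (f : Series 𝕂 E Θ) (n : ℕ), {k | T k f ∉ degGE 𝕂 E Θ n}.Finite

lemma PointwiseFinite.support {T : ℤ → Op 𝕂 E Θ} (hT : PointwiseFinite T) (f : Series 𝕂 E Θ)
    (M : Mon E Θ) : (Function.support fun k => (T k f).1 M).Finite :=
  (hT f (deg M + 1)).subset fun _ hk h => hk (h M (Nat.lt_succ_self _))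

/-- The pointwise convergent sum `∑_{k ∈ ℤ} T k`. -/
def opSum (T : ℤ → Op 𝕂 E Θ) (hT : PointwiseFinite T) : Op 𝕂 E Θ where
  toFun f := ⟨fun M => ∑ᶠ k, (T k f).1 M, by
    intro d
    refine ((hT f (d + 1)).biUnion (fun k _ => (T k f).2 d)).subset ?_
    rintro M ⟨hM, h⟩
    obtain ⟨k, hk⟩ : ∃ k, (T k f).1 M ≠ 0 := by
      by_contra! h0
      exact h (by simp [h0])
    simp only [Set.mem_iUnion]
    exact ⟨k, fun h0 => hk (h0 M (by omega)), hM, hk⟩⟩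
  map_add' f g := by
    ext M
    simp only [map_add, Submodule.coe_add, Pi.add_apply]
    exact finsum_add_distrib (hT.support f M) (hT.support g M)
  map_smul' c f := by
    ext M
    simp only [map_smul, Submodule.coe_smul, Pi.smul_apply, RingHom.id_apply, smul_eq_mul]
    exact (mul_finsum' _ _ (hT.support f M)).symm

end Sums

/-! ### The `σ`-twisted representation

The half-integer `r = k + 1/2` is represented by the integer `k`. The modes are rescaled by `√ħ`:
`bMode k = √ħ b_r` and `psiMode k = √ħ ψ_r`, so that `ħ b_r b_s = bMode k * bMode l`, and so on. The
even coordinates are `x^1, x^2, …`; the odd coordinates `θ^1, θ^2, …` are placed among the odd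
coordinates `Θ` by an embedding `ι`. -/

section Sigma

variable {𝕂 : Type} [RCLike 𝕂] {Θ : Type} [LinearOrder Θ]

/-- `√ħ b_r`, which is `ħ ∂ / ∂x^{r + 1/2}` for `r > 0` and `-r x^{-r + 1/2}` for `r < 0`. -/
def bMode : ℤ → Op 𝕂 ℕ+ Θ
  | Int.ofNat j => hbarD (Sum.inl j.succPNat)
  | Int.negSucc j => ((j : 𝕂) + 1 / 2) • mulCoord (Sum.inl j.succPNat)

/-- `√ħ ψ_r`, which is `ħ ∂ / ∂θ^{r + 1/2}` for `r > 0` and `θ^{-r + 1/2}` for `r < 0`. -/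
def psiMode (ι : ℕ+ ↪ Θ) : ℤ → Op 𝕂 ℕ+ Θ
  | Int.ofNat j => hbarD (Sum.inr (ι j.succPNat))
  | Int.negSucc j => mulCoord (Sum.inr (ι j.succPNat))

/-- `ħ :b_r b_s:`, negative modes to the left. -/
def normalB (k l : ℤ) : Op 𝕂 ℕ+ Θ :=
  if 0 ≤ k ∧ l < 0 then bMode l * bMode k else bMode k * bMode l

/-- `ħ :ψ_r ψ_s:`. -/
def normalPsi (ι : ℕ+ ↪ Θ) (k l : ℤ) : Op 𝕂 ℕ+ Θ :=
  if k ≤ l then psiMode ι k * psiMode ι l else -(psiMode ι l * psiMode ι k)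

lemma bMode_mem_degGE (k : ℤ) {n : ℕ} {f : Series 𝕂 ℕ+ Θ} (hf : f ∈ degGE 𝕂 ℕ+ Θ n) :
    (bMode k : Op 𝕂 ℕ+ Θ) f ∈ degGE 𝕂 ℕ+ Θ n := by
  rcases k with j | j
  · exact hbarD_mem_degGE _ hf
  · exact Submodule.smul_mem _ _ (mulCoord_mem_degGE _ hf)

lemma psiMode_mem_degGE (ι : ℕ+ ↪ Θ) (k : ℤ) {n : ℕ} {f : Series 𝕂 ℕ+ Θ}
    (hf : f ∈ degGE 𝕂 ℕ+ Θ n) : (psiMode ι k : Op 𝕂 ℕ+ Θ) f ∈ degGE 𝕂 ℕ+ Θ n := by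
  rcases k with j | j
  · exact hbarD_mem_degGE _ hf
  · exact mulCoord_mem_degGE _ hf

lemma bMode_psiMode_comm (ι : ℕ+ ↪ Θ) (i j : ℕ) :
    (bMode (Int.ofNat i) * psiMode ι (Int.negSucc j) : Op 𝕂 ℕ+ Θ) =
      psiMode ι (Int.negSucc j) * bMode (Int.ofNat i) := by
  refine LinearMap.ext fun f => Subtype.ext (funext ?_)
  rintro ⟨m, S, k⟩
  change (if k = 0 then (0 : 𝕂) else 1) * (((m i.succPNat : 𝕂) + 1) *
      ((if ι j.succPNat ∈ S then oddSign 𝕂 (ι j.succPNat) S else 0) *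
        f.1 (m + Finsupp.single i.succPNat 1, S.erase (ι j.succPNat), k - 1))) =
    (if ι j.succPNat ∈ S then oddSign 𝕂 (ι j.succPNat) S else 0) *
      ((if k = 0 then (0 : 𝕂) else 1) * (((m i.succPNat : 𝕂) + 1) *
        f.1 (m + Finsupp.single i.succPNat 1, S.erase (ι j.succPNat), k - 1)))
  ring

lemma finite_hbarD {E : Type} (f : Series 𝕂 E Θ) (n : ℕ) :
    {a : E ⊕ Θ | (hbarD a : Op 𝕂 E Θ) f ∉ degGE 𝕂 E Θ n}.Finite := by
  have hfin : (⋃ d ∈ Set.Iio n, ⋃ M ∈ {M | deg M = d ∧ f.1 M ≠ 0},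
      (Sum.inl '' (M.1.support : Set E) ∪ Sum.inr '' (M.2.1 : Set Θ) : Set (E ⊕ Θ))).Finite :=
    (Set.finite_Iio n).biUnion fun d _ => (f.2 d).biUnion fun M _ =>
      (M.1.support.finite_toSet.image _).union (M.2.1.finite_toSet.image _)
  refine hfin.subset fun a ha => ?_
  obtain ⟨⟨m, S, k⟩, hM, h⟩ : ∃ M, deg M < n ∧ ((hbarD a : Op 𝕂 E Θ) f).1 M ≠ 0 := by
    by_contra! h0
    exact ha h0
  simp only [deg] at hM
  simp only [Set.mem_iUnion]
  rcases a with a | a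
  · change (if k = 0 then (0 : 𝕂) else 1) *
      (((m a : 𝕂) + 1) * f.1 (m + Finsupp.single a 1, S, k - 1)) ≠ 0 at h
    have hk : k ≠ 0 := by rintro rfl; simp at h
    refine ⟨_, ?_, (m + Finsupp.single a 1, S, k - 1),
      ⟨rfl, right_ne_zero_of_mul (right_ne_zero_of_mul h)⟩, Or.inl ⟨a, ?_, rfl⟩⟩
    · simp only [deg, map_add, Finsupp.degree_single, Set.mem_Iio]; omega
    · simp
  · change (if k = 0 then (0 : 𝕂) else 1) *
      ((if a ∈ S then 0 else oddSign 𝕂 a S) * f.1 (m, insert a S, k - 1)) ≠ 0 at h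
    have hk : k ≠ 0 := by rintro rfl; simp at h
    have h2 := Finset.card_insert_le a S
    refine ⟨_, ?_, (m, insert a S, k - 1),
      ⟨rfl, right_ne_zero_of_mul (right_ne_zero_of_mul h)⟩, Or.inr ⟨a, ?_, rfl⟩⟩
    · simp only [deg, Set.mem_Iio]; omega
    · simp

lemma finite_bMode (f : Series 𝕂 ℕ+ Θ) (n : ℕ) :
    {k : ℤ | 0 ≤ k ∧ (bMode k : Op 𝕂 ℕ+ Θ) f ∉ degGE 𝕂 ℕ+ Θ n}.Finite := by
  have h1 : {j : ℕ | (hbarD (Sum.inl j.succPNat) : Op 𝕂 ℕ+ Θ) f ∉ degGE 𝕂 ℕ+ Θ n}.Finite :=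
    (finite_hbarD f n).preimage (f := fun j : ℕ => Sum.inl j.succPNat)
      (Sum.inl_injective.comp Nat.succPNat_injective).injOn
  refine (h1.image Int.ofNat).subset ?_
  rintro (j | j) ⟨hk, h⟩
  · exact ⟨j, h, rfl⟩
  · exact absurd hk (by simp)

lemma finite_psiMode (ι : ℕ+ ↪ Θ) (f : Series 𝕂 ℕ+ Θ) (n : ℕ) :
    {k : ℤ | 0 ≤ k ∧ (psiMode ι k : Op 𝕂 ℕ+ Θ) f ∉ degGE 𝕂 ℕ+ Θ n}.Finite := by
  have h1 : {j : ℕ | (hbarD (Sum.inr (ι j.succPNat)) : Op 𝕂 ℕ+ Θ) f ∉ degGE 𝕂 ℕ+ Θ n}.Finite :=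
    (finite_hbarD f n).preimage (f := fun j : ℕ => Sum.inr (ι j.succPNat))
      (Sum.inr_injective.comp (ι.injective.comp Nat.succPNat_injective)).injOn
  refine (h1.image Int.ofNat).subset ?_
  rintro (j | j) ⟨hk, h⟩
  · exact ⟨j, h, rfl⟩
  · exact absurd hk (by simp)

lemma pointwiseFinite_normalB (m : ℤ) :
    PointwiseFinite fun k => (normalB k (m - 1 - k) : Op 𝕂 ℕ+ Θ) := by
  intro f n
  have h1 := finite_bMode f n
  have h2 := h1.preimage (f := fun k : ℤ => m - 1 - k) (fun a _ b _ h => by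
    simp only at h; omega)
  refine ((h1.union h2).union (Set.finite_Ioo (m - 1) 0)).subset fun k hk => ?_
  simp only [Set.mem_ofPred_eq, normalB] at hk
  by_cases hk0 : 0 ≤ k ∧ m - 1 - k < 0
  · rw [if_pos hk0] at hk
    exact Or.inl (Or.inl ⟨hk0.1, fun h => hk (bMode_mem_degGE _ h)⟩)
  · rw [if_neg hk0] at hk
    by_cases hl : 0 ≤ m - 1 - k
    · exact Or.inl (Or.inr ⟨hl, fun h => hk (bMode_mem_degGE _ h)⟩)
    · exact Or.inr ⟨by omega, by omega⟩

lemma pointwiseFinite_normalPsi (ι : ℕ+ ↪ Θ) (m : ℤ) :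
    PointwiseFinite fun k =>
      ((k : 𝕂) + 1 / 2 + (m : 𝕂) / 2) • (normalPsi ι (-k - 1) (m + k) : Op 𝕂 ℕ+ Θ) := by
  intro f n
  have h1 := (finite_psiMode ι f n).preimage (f := fun k : ℤ => m + k) (fun a _ b _ h => by
    simp only at h; omega)
  have h2 := (finite_psiMode ι f n).preimage (f := fun k : ℤ => -k - 1) (fun a _ b _ h => by
    simp only at h; omega)
  refine ((h1.union h2).union (Set.finite_Ico 0 (-m))).subset fun k hk => ?_
  replace hk : (normalPsi ι (-k - 1) (m + k) : Op 𝕂 ℕ+ Θ) f ∉ degGE 𝕂 ℕ+ Θ n :=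
    fun h => hk (Submodule.smul_mem _ _ h)
  simp only [normalPsi] at hk
  by_cases hr : -k - 1 ≤ m + k
  · rw [if_pos hr] at hk
    by_cases hs : 0 ≤ m + k
    · exact Or.inl (Or.inl ⟨hs, fun h => hk (psiMode_mem_degGE ι _ h)⟩)
    · exact Or.inr ⟨by omega, by omega⟩
  · rw [if_neg hr] at hk
    by_cases hs : 0 ≤ -k - 1
    · exact Or.inl (Or.inr ⟨hs, fun h => hk (neg_mem (psiMode_mem_degGE ι _ h))⟩)
    · exact Or.inr ⟨by omega, by omega⟩

lemma pointwiseFinite_bMode_psiMode (ι : ℕ+ ↪ Θ) (m : ℤ) :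
    PointwiseFinite fun k => (bMode (m - 1 - k) * psiMode ι k : Op 𝕂 ℕ+ Θ) := by
  intro f n
  have h1 := finite_psiMode ι f n
  have h2 := (finite_bMode f n).preimage (f := fun k : ℤ => m - 1 - k) (fun a _ b _ h => by
    simp only at h; omega)
  refine ((h1.union h2).union (Set.finite_Ioo (m - 1) 0)).subset fun k hk => ?_
  by_cases hk0 : 0 ≤ k
  · exact Or.inl (Or.inl ⟨hk0, fun h => hk (bMode_mem_degGE _ h)⟩)
  · by_cases hl : 0 ≤ m - 1 - k
    · refine Or.inl (Or.inr ⟨hl, fun h => hk ?_⟩)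
      obtain ⟨i, hi⟩ := Int.eq_ofNat_of_zero_le hl
      obtain ⟨j, rfl⟩ := Int.eq_negSucc_of_lt_zero (not_le.1 hk0)
      have h3 := psiMode_mem_degGE ι (Int.negSucc j) h
      beta_reduce at h3 ⊢
      rw [hi] at h3 ⊢
      change (bMode (Int.ofNat i) * psiMode ι (Int.negSucc j) : Op 𝕂 ℕ+ Θ) f ∈ _
      rw [bMode_psiMode_comm]
      exact h3
    · exact Or.inr ⟨by omega, by omega⟩

/-- `H_i = ħ ∂/∂x^i + (ħ/2) ∑_r :b_r b_{m-r}: + (ħ/2) ∑_r (r + m/2) :ψ_{-r} ψ_{m+r}:` with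
`m = i + N - 1`. -/
def opH (N : ℕ) (ι : ℕ+ ↪ Θ) (i : ℕ+) : Op 𝕂 ℕ+ Θ :=
  hbarD (Sum.inl i)
    + (1 / 2 : 𝕂) • opSum _ (pointwiseFinite_normalB ((i : ℤ) + N - 1))
    + (1 / 2 : 𝕂) • opSum _ (pointwiseFinite_normalPsi ι ((i : ℤ) + N - 1))

/-- `F_i = ħ ∂/∂θ^i + ħ ∑_r b_{m-r} ψ_r` with `m = i + N - 1`. -/
def opF (N : ℕ) (ι : ℕ+ ↪ Θ) (i : ℕ+) : Op 𝕂 ℕ+ Θ :=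
  hbarD (Sum.inr (ι i)) + opSum _ (pointwiseFinite_bMode_psiMode ι ((i : ℤ) + N - 1))

/-- `H_i + ħ D_i δ_{i ≤ R}`. -/
def opHD (N : ℕ) (ι : ℕ+ ↪ Θ) (R : ℕ) (D : ℕ+ → 𝕂) (i : ℕ+) : Op 𝕂 ℕ+ Θ :=
  opH N ι i + if (i : ℕ) ≤ R then D i • hbar else 0

/-- The (anti)commutation relations of the subalgebra of the Ramond super Virasoro algebra spanned
by `L_{i+N-1}`, `i ≥ 1`, and `G_{j+N-1}`, `j ≥ j₀`, rescaled by `ħ`. -/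
structure RamondRelations (N : ℕ) (j₀ : ℕ+) (H F : ℕ+ → Op 𝕂 ℕ+ Θ) : Prop where
  even_even : ∀ m n l : ℕ+, (l : ℤ) = m + n + N - 1 →
    H m * H n - H n * H m = ((m : 𝕂) - n) • (hbar * H l)
  even_odd : ∀ m n l : ℕ+, j₀ ≤ n → (l : ℤ) = m + n + N - 1 →
    H m * F n - F n * H m = (((m : 𝕂) - N + 1) / 2 - n) • (hbar * F l)
  odd_odd : ∀ m n l : ℕ+, j₀ ≤ m → j₀ ≤ n → (l : ℤ) = m + n + N - 1 →
    F m * F n + F n * F m = (2 : 𝕂) • (hbar * H l)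

/-- The relations of the super Heisenberg algebra for the modes rescaled by `√ħ`:
`[b_r, b_s] = r δ_{r,-s}`, `{ψ_r, ψ_s} = δ_{r,-s}`, `[b_r, ψ_s] = 0`. -/
structure HeisenbergRelations (b ψ : ℤ → Op 𝕂 ℕ+ Θ) : Prop where
  b_b : ∀ k l : ℤ, b k * b l - b l * b k =
    if k + l + 1 = 0 then ((k : 𝕂) + 1 / 2) • hbar else 0
  psi_psi : ∀ k l : ℤ, ψ k * ψ l + ψ l * ψ k = if k + l + 1 = 0 then hbar else 0
  b_psi : ∀ k l : ℤ, b k * ψ l - ψ l * b k = 0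

end Sigma

/-- The odd coordinates `θ^1, θ^2, …` among `θ^0, θ^1, θ^2, …`. -/
def oddEmb : ℕ+ ↪ ℕ := ⟨PNat.val, PNat.coe_injective⟩

end SuperAiry
end

noncomputable section

namespace SuperAiry

/-! ### Canonical relations of the generators -/

/-! The Ramond relations are proved without manipulating double infinite sums. The bracket of `H_i`
or `F_i` with a single mode involves at most two summands of the defining series, so it is again a
multiple of ħ times one mode. The linear terms of `H_i` and `F_i` are absorbed by adding 1 to the
even mode with integer index `N - 1` (`shiftedBMode`). With this shift the brackets take a uniform
form (`opH_bracket_shiftedBMode`, `opF_bracket_psiMode`). The defect of a relation, such as `[H_m,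
H_n] - (m - n) ħ H_l` with `l = m + n + N - 1`, then super-commutes with every mode by the Jacobi
identity. It also annihilates the series 1, because normal ordering leaves an annihilating mode on
the right of every summand. Such an operator kills every monomial and, polynomials being dense,
vanishes (`op_eq_zero_of_comm`).

Involutivity of the left ideal rests on two facts. First, super-commutators in the completed Weyl
algebra are divisible by ħ (`superComm_mem_hbarWeyl`). This is checked on words in the generators
and passes to the closure, because division by ħ is continuous. Secondly, the Leibniz rule then
reduces `[I, I] ⊆ ħ I` to homogeneous generators of the ideal (`superComm_mem_hbarIdeal_span`).

The functionals in `V*` may have infinitely many non-zero coefficients. The map `L` exists because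
`H_i` and `F_i` tend to zero pointwise as `i` grows (`exists_opHD_opF_bound`), and it is unique
because a continuous map is determined on the dual basis. The relations on the dual basis extend to
all functionals because an index `l` is of the form `m + n + N - 1` for only finitely many pairs
(`superComm_airyOp`).

The constants `D_i` are multiples of the central ħ, so they matter only on the right hand sides.
Those with `i ≤ N` never occur there with a non-zero coefficient. The constant `D_{N+1}` occurs only
through `{F_1, F_1}`, which is absent from the second class (`ramondRelations_opHD`). -/

/-- The ring of operators. Instance search does not find this structure, since it does not unify
the additive group of `Series 𝕂 E Θ` with its additive monoid. -/
abbrev opRing {𝕂 : Type} [RCLike 𝕂] {E Θ : Type} : Ring (Op 𝕂 E Θ) where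
  __ := (inferInstance : Semiring (Op 𝕂 E Θ))
  __ := (inferInstance : AddCommGroup (Op 𝕂 E Θ))
  intCast := Int.castDef

attribute [local instance] opRing

section Generators

variable {𝕂 : Type} [RCLike 𝕂] {E Θ : Type}

lemma op_ext {S T : Op 𝕂 E Θ} (h : ∀ f M, (S f).1 M = (T f).1 M) : S = T :=
  LinearMap.ext fun f => Subtype.ext (funext (h f))

lemma hbar_apply (f : Series 𝕂 E Θ) (m : E →₀ ℕ) (S : Finset Θ) (k : ℕ) :
    ((hbar : Op 𝕂 E Θ) f).1 (m, S, k) = (if k = 0 then 0 else 1) * f.1 (m, S, k - 1) := rfl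

lemma mulX_apply (a : E) (f : Series 𝕂 E Θ) (m : E →₀ ℕ) (S : Finset Θ) (k : ℕ) :
    ((mulX a : Op 𝕂 E Θ) f).1 (m, S, k) =
      (if m a = 0 then 0 else 1) * f.1 (m - Finsupp.single a 1, S, k) := rfl

lemma dX_apply (a : E) (f : Series 𝕂 E Θ) (m : E →₀ ℕ) (S : Finset Θ) (k : ℕ) :
    ((dX a : Op 𝕂 E Θ) f).1 (m, S, k) =
      ((m a : 𝕂) + 1) * f.1 (m + Finsupp.single a 1, S, k) := rfl

lemma parity_apply (f : Series 𝕂 E Θ) (m : E →₀ ℕ) (S : Finset Θ) (k : ℕ) :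
    ((parity : Op 𝕂 E Θ) f).1 (m, S, k) = (-1) ^ S.card * f.1 (m, S, k) := rfl

lemma hbar_mulX (a : E) : (hbar * mulX a : Op 𝕂 E Θ) = mulX a * hbar := by
  refine op_ext fun f ⟨m, S, k⟩ => ?_
  simp only [Module.End.mul_apply, hbar_apply, mulX_apply]
  ring

lemma hbar_dX (a : E) : (hbar * dX a : Op 𝕂 E Θ) = dX a * hbar := by
  refine op_ext fun f ⟨m, S, k⟩ => ?_
  simp only [Module.End.mul_apply, hbar_apply, dX_apply]
  ring

lemma hbar_parity : (hbar * parity : Op 𝕂 E Θ) = parity * hbar := by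
  refine op_ext fun f ⟨m, S, k⟩ => ?_
  simp only [Module.End.mul_apply, hbar_apply, parity_apply]
  ring

lemma parity_mulX (a : E) : (parity * mulX a : Op 𝕂 E Θ) = mulX a * parity := by
  refine op_ext fun f ⟨m, S, k⟩ => ?_
  simp only [Module.End.mul_apply, parity_apply, mulX_apply]
  ring

lemma parity_dX (a : E) : (parity * dX a : Op 𝕂 E Θ) = dX a * parity := by
  refine op_ext fun f ⟨m, S, k⟩ => ?_
  simp only [Module.End.mul_apply, parity_apply, dX_apply]
  ring

lemma parity_mul_parity : (parity * parity : Op 𝕂 E Θ) = 1 := by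
  refine op_ext fun f ⟨m, S, k⟩ => ?_
  simp only [Module.End.mul_apply, parity_apply, Module.End.one_apply, ← mul_assoc, ← mul_pow]
  simp

lemma mulX_mulX (a b : E) : (mulX a * mulX b : Op 𝕂 E Θ) = mulX b * mulX a := by
  refine op_ext fun f ⟨m, S, k⟩ => ?_
  rcases eq_or_ne a b with rfl | h
  · rfl
  simp only [Module.End.mul_apply, mulX_apply, Finsupp.coe_tsub, Pi.sub_apply,
    Finsupp.single_eq_of_ne h, Finsupp.single_eq_of_ne h.symm, tsub_zero]
  rw [tsub_right_comm]
  ring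

lemma dX_dX (a b : E) : (dX a * dX b : Op 𝕂 E Θ) = dX b * dX a := by
  refine op_ext fun f ⟨m, S, k⟩ => ?_
  rcases eq_or_ne a b with rfl | h
  · rfl
  simp only [Module.End.mul_apply, dX_apply, Finsupp.coe_add, Pi.add_apply,
    Finsupp.single_eq_of_ne h, Finsupp.single_eq_of_ne h.symm, add_zero]
  rw [add_right_comm]
  ring

lemma dX_mulX (a b : E) [Decidable (a = b)] : (dX a * mulX b : Op 𝕂 E Θ) - mulX b * dX a =
    if a = b then 1 else 0 := by
  refine op_ext fun f ⟨m, S, k⟩ => ?_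
  simp only [LinearMap.sub_apply, Module.End.mul_apply, AddSubgroupClass.coe_sub, Pi.sub_apply,
    dX_apply, mulX_apply, Finsupp.coe_add, Pi.add_apply, Finsupp.coe_tsub]
  by_cases h : a = b
  · subst h
    rw [if_pos rfl, add_tsub_cancel_right]
    simp only [Finsupp.single_eq_same]
    by_cases h2 : m a = 0
    · simp [h2]
    · have h3 : Finsupp.single a 1 ≤ m := by
        rw [Finsupp.single_le_iff]; omega
      rw [tsub_add_cancel_of_le h3, if_neg h2, if_neg (by omega), Module.End.one_apply,
        Nat.cast_sub (by omega)]
      push_cast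
      ring
  · rw [if_neg h]
    simp only [Finsupp.single_eq_of_ne h, Finsupp.single_eq_of_ne (Ne.symm h)]
    by_cases h2 : m b = 0
    · simp [h2]
    · have h3 : Finsupp.single b 1 ≤ m := by
        rw [Finsupp.single_le_iff]; omega
      rw [tsub_add_eq_add_tsub h3]
      simp [h2]

variable [LinearOrder Θ]

lemma mulTheta_apply (a : Θ) (f : Series 𝕂 E Θ) (m : E →₀ ℕ) (S : Finset Θ) (k : ℕ) :
    ((mulTheta a : Op 𝕂 E Θ) f).1 (m, S, k) =
      (if a ∈ S then oddSign 𝕂 a S else 0) * f.1 (m, S.erase a, k) := rfl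

lemma dTheta_apply (a : Θ) (f : Series 𝕂 E Θ) (m : E →₀ ℕ) (S : Finset Θ) (k : ℕ) :
    ((dTheta a : Op 𝕂 E Θ) f).1 (m, S, k) =
      (if a ∈ S then 0 else oddSign 𝕂 a S) * f.1 (m, insert a S, k) := rfl

lemma hbar_mulTheta (a : Θ) : (hbar * mulTheta a : Op 𝕂 E Θ) = mulTheta a * hbar := by
  refine op_ext fun f ⟨m, S, k⟩ => ?_
  simp only [Module.End.mul_apply, hbar_apply, mulTheta_apply]
  ring

lemma hbar_dTheta (a : Θ) : (hbar * dTheta a : Op 𝕂 E Θ) = dTheta a * hbar := by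
  refine op_ext fun f ⟨m, S, k⟩ => ?_
  simp only [Module.End.mul_apply, hbar_apply, dTheta_apply]
  ring

lemma mulX_mulTheta (a : E) (b : Θ) : (mulX a * mulTheta b : Op 𝕂 E Θ) = mulTheta b * mulX a := by
  refine op_ext fun f ⟨m, S, k⟩ => ?_
  simp only [Module.End.mul_apply, mulX_apply, mulTheta_apply]
  ring

lemma mulX_dTheta (a : E) (b : Θ) : (mulX a * dTheta b : Op 𝕂 E Θ) = dTheta b * mulX a := by
  refine op_ext fun f ⟨m, S, k⟩ => ?_
  simp only [Module.End.mul_apply, mulX_apply, dTheta_apply]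
  ring

lemma dX_mulTheta (a : E) (b : Θ) : (dX a * mulTheta b : Op 𝕂 E Θ) = mulTheta b * dX a := by
  refine op_ext fun f ⟨m, S, k⟩ => ?_
  simp only [Module.End.mul_apply, dX_apply, mulTheta_apply]
  ring

lemma dX_dTheta (a : E) (b : Θ) : (dX a * dTheta b : Op 𝕂 E Θ) = dTheta b * dX a := by
  refine op_ext fun f ⟨m, S, k⟩ => ?_
  simp only [Module.End.mul_apply, dX_apply, dTheta_apply]
  ring

lemma parity_mulTheta (a : Θ) :
    (parity * mulTheta a : Op 𝕂 E Θ) = -(mulTheta a * parity) := by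
  refine op_ext fun f ⟨m, S, k⟩ => ?_
  simp only [Module.End.mul_apply, LinearMap.neg_apply, NegMemClass.coe_neg, Pi.neg_apply,
    parity_apply, mulTheta_apply]
  split_ifs with h
  · rw [← Finset.card_erase_add_one h]
    ring
  · simp

lemma parity_dTheta (a : Θ) :
    (parity * dTheta a : Op 𝕂 E Θ) = -(dTheta a * parity) := by
  refine op_ext fun f ⟨m, S, k⟩ => ?_
  simp only [Module.End.mul_apply, LinearMap.neg_apply, NegMemClass.coe_neg, Pi.neg_apply,
    parity_apply, dTheta_apply]
  split_ifs with h
  · simp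
  · rw [Finset.card_insert_of_notMem h]
    ring

lemma oddSign_mul_self (a : Θ) (S : Finset Θ) : oddSign 𝕂 a S * oddSign 𝕂 a S = 1 := by
  rw [oddSign, ← mul_pow]
  simp

lemma oddSign_insert_of_lt {a b : Θ} {S : Finset Θ} (h : b ∉ S) (hab : b < a) :
    oddSign 𝕂 a (insert b S) = -oddSign 𝕂 a S := by
  rw [oddSign, oddSign, Finset.filter_insert, if_pos hab,
    Finset.card_insert_of_notMem (by simp [h]), pow_succ]
  ring

lemma oddSign_insert_of_le {a b : Θ} {S : Finset Θ} (hab : a ≤ b) :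
    oddSign 𝕂 a (insert b S) = oddSign 𝕂 a S := by
  rw [oddSign, oddSign, Finset.filter_insert, if_neg hab.not_gt]

lemma oddSign_erase_of_lt {a b : Θ} {S : Finset Θ} (h : b ∈ S) (hab : b < a) :
    oddSign 𝕂 a (S.erase b) = -oddSign 𝕂 a S := by
  have := oddSign_insert_of_lt (𝕂 := 𝕂) (Finset.notMem_erase b S) hab
  rw [Finset.insert_erase h] at this
  rw [this, neg_neg]

lemma oddSign_erase_of_le {a b : Θ} {S : Finset Θ} (h : b ∈ S) (hab : a ≤ b) :
    oddSign 𝕂 a (S.erase b) = oddSign 𝕂 a S := by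
  have := oddSign_insert_of_le (𝕂 := 𝕂) (S := S.erase b) hab
  rwa [Finset.insert_erase h, eq_comm] at this

/-- Exactly one of the two orders changes a sign: erasing the smaller index lowers by one the count
behind `oddSign` of the larger, while erasing the larger leaves the sign of the smaller alone. -/
lemma mulTheta_mulTheta (a b : Θ) :
    (mulTheta a * mulTheta b : Op 𝕂 E Θ) + mulTheta b * mulTheta a = 0 := by
  wlog h : a ≤ b generalizing a b
  · rw [add_comm]
    exact this b a (le_of_not_ge h)
  refine op_ext fun f ⟨m, S, k⟩ => ?_
  simp only [Module.End.mul_apply, LinearMap.add_apply, Submodule.coe_add, Pi.add_apply,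
    mulTheta_apply, Finset.mem_erase]
  rcases h.eq_or_lt with rfl | h
  · simp
  · rw [Finset.erase_right_comm]
    by_cases ha : a ∈ S
    · by_cases hb : b ∈ S
      · simp only [ha, hb, h.ne, h.ne', ne_eq, not_false_eq_true, and_self, if_true,
          oddSign_erase_of_lt ha h, oddSign_erase_of_le hb h.le]
        simp
        ring
      · simp [hb]
    · simp [ha]

lemma dTheta_dTheta (a b : Θ) :
    (dTheta a * dTheta b : Op 𝕂 E Θ) + dTheta b * dTheta a = 0 := by
  wlog h : a ≤ b generalizing a b
  · rw [add_comm]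
    exact this b a (le_of_not_ge h)
  refine op_ext fun f ⟨m, S, k⟩ => ?_
  simp only [Module.End.mul_apply, LinearMap.add_apply, Submodule.coe_add, Pi.add_apply,
    dTheta_apply, Finset.mem_insert]
  rcases h.eq_or_lt with rfl | h
  · simp
  · rw [Finset.insert_comm]
    by_cases ha : a ∈ S
    · simp [ha]
    · by_cases hb : b ∈ S
      · simp [hb]
      · simp only [ha, hb, h.ne, h.ne', or_self, if_false,
          oddSign_insert_of_lt ha h, oddSign_insert_of_le h.le]
        simp
        ring

lemma dTheta_mulTheta (a b : Θ) :
    (dTheta a * mulTheta b : Op 𝕂 E Θ) + mulTheta b * dTheta a = if a = b then 1 else 0 := by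
  refine op_ext fun f ⟨m, S, k⟩ => ?_
  simp only [Module.End.mul_apply, LinearMap.add_apply, Submodule.coe_add, Pi.add_apply,
    dTheta_apply, mulTheta_apply, Finset.mem_insert, Finset.mem_erase]
  rcases eq_or_ne a b with rfl | h
  · by_cases ha : a ∈ S
    · simp only [ha, Finset.insert_erase, oddSign_erase_of_le ha le_rfl, ← mul_assoc]
      simp [oddSign_mul_self]
    · simp only [ha, oddSign_insert_of_le le_rfl, ← mul_assoc]
      simp [oddSign_mul_self, Finset.erase_eq_of_notMem ha]
  · by_cases ha : a ∈ S
    · simp [ha, h]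
    · by_cases hb : b ∈ S
      · rw [Finset.erase_insert_of_ne h]
        rcases lt_or_gt_of_ne h with h1 | h1
        · simp only [ha, hb, h, h.symm, or_true, if_true, if_false, oddSign_erase_of_le hb h1.le,
            oddSign_insert_of_lt ha h1]
          simp
          ring
        · simp only [ha, hb, h, h.symm, or_true, if_true, if_false, oddSign_erase_of_lt hb h1,
            oddSign_insert_of_le h1.le]
          simp
          ring
      · simp [hb, h, h.symm]

end Generators

section Operators

attribute [local instance] opRing

/-! ### The degree filtration and the closure -/

section Filtration

variable {𝕂 : Type} [RCLike 𝕂] {E Θ : Type}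

lemma degGE_antitone {m n : ℕ} (h : m ≤ n) : degGE 𝕂 E Θ n ≤ degGE 𝕂 E Θ m :=
  fun _ hf M hM => hf M (hM.trans_le h)

/-- The degree topology is Hausdorff; this turns agreement to every order into equality. -/
lemma eq_zero_of_forall_mem_degGE {f : Series 𝕂 E Θ} (h : ∀ n, f ∈ degGE 𝕂 E Θ n) : f = 0 :=
  Subtype.ext (funext fun M => h (deg M + 1) M (Nat.lt_succ_self _))

lemma op_eq_of_forall_sub_mem {S T : Op 𝕂 E Θ} (h : ∀ f n, S f - T f ∈ degGE 𝕂 E Θ n) : S = T :=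
  LinearMap.ext fun f => sub_eq_zero.1 (eq_zero_of_forall_mem_degGE (h f))

lemma op_eq_zero_of_forall_mem {T : Op 𝕂 E Θ} (h : ∀ f n, T f ∈ degGE 𝕂 E Θ n) : T = 0 :=
  LinearMap.ext fun f => eq_zero_of_forall_mem_degGE (h f)

namespace RaisesDegree

variable {S T : Op 𝕂 E Θ} {d d' : ℕ}

lemma apply (h : RaisesDegree 0 T) {n : ℕ} {f : Series 𝕂 E Θ} (hf : f ∈ degGE 𝕂 E Θ n) :
    T f ∈ degGE 𝕂 E Θ n := h n f hf

lemma mono (h : RaisesDegree d T) (hd : d' ≤ d) : RaisesDegree d' T :=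
  fun n f hf => degGE_antitone (by omega) (h n f hf)

lemma add (hS : RaisesDegree d S) (hT : RaisesDegree d T) : RaisesDegree d (S + T) :=
  fun n f hf => add_mem (hS n f hf) (hT n f hf)

lemma smul (c : 𝕂) (hT : RaisesDegree d T) : RaisesDegree d (c • T) :=
  fun n f hf => Submodule.smul_mem _ c (hT n f hf)

lemma neg (hT : RaisesDegree d T) : RaisesDegree d (-T) :=
  fun n f hf => neg_mem (hT n f hf)

lemma mul (hS : RaisesDegree d S) (hT : RaisesDegree d' T) : RaisesDegree (d' + d) (S * T) :=
  fun n f hf => by rw [← add_assoc]; exact hS _ _ (hT n f hf)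

lemma zero : RaisesDegree d (0 : Op 𝕂 E Θ) := fun _ _ _ => zero_mem _

end RaisesDegree

lemma raisesDegree_parity : RaisesDegree 0 (parity : Op 𝕂 E Θ) := by
  rintro n f hf ⟨m, S, k⟩ hM
  rw [parity_apply, hf _ hM, mul_zero]

lemma raisesDegree_hbar : RaisesDegree 2 (hbar : Op 𝕂 E Θ) := fun _ _ hf => hbar_mem_degGE hf

/-- Division by `ħ`, discarding the terms without `ħ`. -/
def divHbar : Op 𝕂 E Θ :=
  shiftOp (fun _ => 1) (fun M => (M.1, M.2.1, M.2.2 + 1)) (fun d => d + 2)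
    (by
      rintro ⟨a, S, k⟩ _ ⟨a', S', k'⟩ _ h
      simpa using h)
    (by
      rintro ⟨a, S, k⟩ _
      simp only [deg]
      ring)

lemma divHbar_apply (f : Series 𝕂 E Θ) (m : E →₀ ℕ) (S : Finset Θ) (k : ℕ) :
    ((divHbar : Op 𝕂 E Θ) f).1 (m, S, k) = f.1 (m, S, k + 1) := one_mul _

lemma divHbar_mul_hbar : (divHbar * hbar : Op 𝕂 E Θ) = 1 := by
  refine op_ext fun f ⟨m, S, k⟩ => ?_
  rw [Module.End.mul_apply, divHbar_apply, hbar_apply]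
  simp

lemma divHbar_mem_degGE {n : ℕ} {f : Series 𝕂 E Θ} (hf : f ∈ degGE 𝕂 E Θ (n + 2)) :
    (divHbar : Op 𝕂 E Θ) f ∈ degGE 𝕂 E Θ n := by
  rintro ⟨m, S, k⟩ hM
  rw [divHbar_apply]
  exact hf _ (by simp only [deg] at hM ⊢; omega)

end Filtration

section Closure

variable {𝕂 : Type} [RCLike 𝕂] {E Θ : Type} [LinearOrder Θ] {U : Set (E ⊕ Θ)}

lemma raisesDegree_of_mem_weylAlg {T : Op 𝕂 E Θ} (hT : T ∈ weylAlg 𝕂 U) : RaisesDegree 0 T :=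
  fun _ _ hf => weylAlg_mem_degGE hT hf

lemma raisesDegree_of_mem_weylHat {T : Op 𝕂 E Θ} (hT : T ∈ weylHat 𝕂 U) : RaisesDegree 0 T := by
  intro n f hf
  obtain ⟨S, hS, h⟩ := hT {f} n
  have h1 := add_mem (h f (Finset.mem_singleton_self f)) (weylAlg_mem_degGE hS hf)
  simpa using h1

lemma weylAlg_le_weylHat : weylAlg 𝕂 U ≤ weylHat 𝕂 U :=
  fun T hT _ _ => ⟨T, hT, fun f _ => by simp⟩

/-- A closure is closed, so later approximants may themselves be taken in the completed algebra. -/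
lemma mem_weylHat_of_approx {T : Op 𝕂 E Θ}
    (h : ∀ (s : Finset (Series 𝕂 E Θ)) (n : ℕ), ∃ S ∈ weylHat 𝕂 U,
      ∀ f ∈ s, T f - S f ∈ degGE 𝕂 E Θ n) : T ∈ weylHat 𝕂 U := by
  intro s n
  obtain ⟨S, hS, h1⟩ := h s n
  obtain ⟨S', hS', h2⟩ := hS s n
  refine ⟨S', hS', fun f hf => ?_⟩
  have := add_mem (h1 f hf) (h2 f hf)
  rwa [sub_add_sub_cancel] at this

lemma hbar_mem_weylAlg : hbar ∈ weylAlg 𝕂 U := Algebra.subset_adjoin (Or.inl (Or.inl rfl))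

lemma mulCoord_mem_weylAlg {a : E ⊕ Θ} (ha : a ∈ U) : mulCoord a ∈ weylAlg 𝕂 U :=
  Algebra.subset_adjoin (Or.inl (Or.inr ⟨a, ha, rfl⟩))

lemma hbarD_mem_weylAlg {a : E ⊕ Θ} (ha : a ∈ U) : hbarD a ∈ weylAlg 𝕂 U :=
  Algebra.subset_adjoin (Or.inr ⟨a, ha, rfl⟩)

lemma hbar_mem_weylHat : hbar ∈ weylHat 𝕂 U := weylAlg_le_weylHat hbar_mem_weylAlg

lemma hbar_mul_mulCoord (a : E ⊕ Θ) : (hbar * mulCoord a : Op 𝕂 E Θ) = mulCoord a * hbar := by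
  rcases a with a | a
  · exact hbar_mulX a
  · exact hbar_mulTheta a

lemma hbar_mul_partial (a : E ⊕ Θ) :
    (hbar * Sum.elim dX dTheta a : Op 𝕂 E Θ) = Sum.elim dX dTheta a * hbar := by
  rcases a with a | a
  · exact hbar_dX a
  · exact hbar_dTheta a

lemma hbar_mul_hbarD (a : E ⊕ Θ) : (hbar * hbarD a : Op 𝕂 E Θ) = hbarD a * hbar := by
  rw [hbarD, mul_assoc, ← hbar_mul_partial]

lemma hbar_comm_of_mem_weylAlg {T : Op 𝕂 E Θ} (hT : T ∈ weylAlg 𝕂 U) : hbar * T = T * hbar := by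
  induction hT using Algebra.adjoin_induction with
  | mem T hT =>
    rcases hT with (hT | ⟨a, _, rfl⟩) | ⟨a, _, rfl⟩
    · rw [Set.mem_singleton_iff.1 hT]
    · exact hbar_mul_mulCoord a
    · exact hbar_mul_hbarD a
  | algebraMap r => exact (Algebra.commutes r _).symm
  | add S T _ _ hS hT => rw [mul_add, add_mul, hS, hT]
  | mul S T _ _ hS hT => rw [← mul_assoc, hS, mul_assoc, hT, mul_assoc]

lemma hbar_comm {T : Op 𝕂 E Θ} (hT : T ∈ weylHat 𝕂 U) : hbar * T = T * hbar := by
  classical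
  refine op_eq_of_forall_sub_mem fun f n => ?_
  -- The commutator with ħ at `f` evaluates the operator at both `f` and `ħ f`, so one approximant
  -- has to serve both.
  obtain ⟨S, hS, h⟩ := hT {f, hbar f} n
  have h1 := (raisesDegree_hbar.mono (Nat.zero_le 2)).apply (h f (by simp))
  have h2 := h (hbar f) (by simp)
  have h3 : hbar (S f) = S (hbar f) := LinearMap.congr_fun (hbar_comm_of_mem_weylAlg hS) f
  have h4 := sub_mem h1 h2
  rw [map_sub, h3] at h4
  simpa using h4

/-- The operators of the form `ħ T` with `T` in the completed Weyl algebra. -/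
def hbarWeyl (𝕂 : Type) [RCLike 𝕂] {E Θ : Type} [LinearOrder Θ] (U : Set (E ⊕ Θ)) :
    Submodule 𝕂 (Op 𝕂 E Θ) :=
  (weylHat 𝕂 U).toSubmodule.map (LinearMap.mulLeft 𝕂 hbar)

lemma mem_hbarWeyl {T : Op 𝕂 E Θ} : T ∈ hbarWeyl 𝕂 U ↔ ∃ S ∈ weylHat 𝕂 U, hbar * S = T := Iff.rfl

lemma mul_mem_hbarWeyl_left {S T : Op 𝕂 E Θ} (hS : S ∈ weylHat 𝕂 U) (hT : T ∈ hbarWeyl 𝕂 U) :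
    S * T ∈ hbarWeyl 𝕂 U := by
  obtain ⟨T, hT', rfl⟩ := mem_hbarWeyl.1 hT
  exact ⟨S * T, (weylHat 𝕂 U).mul_mem hS hT', by
    rw [LinearMap.mulLeft_apply, ← mul_assoc, hbar_comm hS, mul_assoc]⟩

lemma mul_mem_hbarWeyl_right {S T : Op 𝕂 E Θ} (hS : S ∈ hbarWeyl 𝕂 U) (hT : T ∈ weylHat 𝕂 U) :
    S * T ∈ hbarWeyl 𝕂 U := by
  obtain ⟨S, hS', rfl⟩ := mem_hbarWeyl.1 hS
  exact ⟨S * T, (weylHat 𝕂 U).mul_mem hS' hT, (mul_assoc _ _ _).symm⟩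

/-- Multiples of ħ form a closed set: `divHbar` costs only two degrees, so it carries approximants
of `T` to approximants of `divHbar * T`. The coefficients of `T f` at ħ^0 vanish because those of
the approximants do, so multiplying back by ħ recovers `T`. -/
lemma mem_hbarWeyl_of_approx {T : Op 𝕂 E Θ}
    (h : ∀ (s : Finset (Series 𝕂 E Θ)) (n : ℕ), ∃ S ∈ hbarWeyl 𝕂 U,
      ∀ f ∈ s, T f - S f ∈ degGE 𝕂 E Θ n) : T ∈ hbarWeyl 𝕂 U := by
  refine ⟨divHbar * T, mem_weylHat_of_approx fun s n => ?_, op_ext ?_⟩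
  · obtain ⟨S, hS, h1⟩ := h s (n + 2)
    obtain ⟨S, hS', rfl⟩ := mem_hbarWeyl.1 hS
    refine ⟨S, hS', fun f hf => ?_⟩
    have h2 := divHbar_mem_degGE (h1 f hf)
    rw [map_sub, ← Module.End.mul_apply, ← Module.End.mul_apply (divHbar), ← mul_assoc,
      divHbar_mul_hbar, one_mul] at h2
    exact h2
  · rintro f ⟨m, S, k⟩
    rw [LinearMap.mulLeft_apply, Module.End.mul_apply, hbar_apply, Module.End.mul_apply,
      divHbar_apply]
    rcases k with _ | k
    · obtain ⟨R, hR, h1⟩ := h {f} (deg ((m, S, 0) : Mon E Θ) + 1)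
      obtain ⟨R, hR', rfl⟩ := mem_hbarWeyl.1 hR
      have h2 := h1 f (by simp) (m, S, 0) (Nat.lt_succ_self _)
      simp only [AddSubgroupClass.coe_sub, Pi.sub_apply, Module.End.mul_apply, hbar_apply] at h2
      simpa using h2.symm
    · simp

end Closure

/-! ### Conjugation by the parity, and super-commutators -/

section Parity

variable {𝕂 : Type} [RCLike 𝕂] {E Θ : Type}

/-- The parity automorphism of the algebra of operators. -/
def conjParity : Op 𝕂 E Θ →ₐ[𝕂] Op 𝕂 E Θ where
  toFun T := parity * T * parity
  map_one' := by rw [mul_one, parity_mul_parity]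
  map_mul' S T := by
    rw [show parity * S * parity * (parity * T * parity) =
      parity * S * (parity * parity) * T * parity by simp only [mul_assoc], parity_mul_parity]
    simp only [mul_assoc, one_mul]
  map_zero' := by simp
  map_add' S T := by simp [mul_add, add_mul]
  commutes' r := by
    rw [← Algebra.commutes, mul_assoc, parity_mul_parity, mul_one]

lemma conjParity_apply (T : Op 𝕂 E Θ) : conjParity T = parity * T * parity := rfl

@[simp] lemma conjParity_conjParity (T : Op 𝕂 E Θ) : conjParity (conjParity T) = T := by
  rw [conjParity_apply, conjParity_apply, show parity * (parity * T * parity) * parity =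
    (parity * parity) * T * (parity * parity) by simp only [mul_assoc], parity_mul_parity,
    one_mul, mul_one]

/-- The sign twist by an even (`false`) or odd (`true`) operator. -/
def twist (o : Bool) : Op 𝕂 E Θ →ₐ[𝕂] Op 𝕂 E Θ := if o then conjParity else AlgHom.id 𝕂 _

lemma twist_true (T : Op 𝕂 E Θ) : twist true T = conjParity T := rfl

lemma twist_false (T : Op 𝕂 E Θ) : twist false T = T := rfl

lemma twist_twist (o o' : Bool) (T : Op 𝕂 E Θ) : twist o (twist o' T) = twist (xor o o') T := by
  cases o <;> cases o' <;> simp [twist_true, twist_false]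

/-- Operators of parity `o`. -/
def IsHomog (o : Bool) (T : Op 𝕂 E Θ) : Prop := conjParity T = if o then -T else T

lemma isHomog_false_iff {T : Op 𝕂 E Θ} : IsHomog false T ↔ IsEven T := by
  rw [IsHomog, IsEven, conjParity_apply]
  constructor
  · intro h
    rw [if_neg (by simp)] at h
    nth_rw 2 [← h]
    simp [mul_assoc, parity_mul_parity]
  · intro h
    rw [h, mul_assoc, parity_mul_parity]
    simp

lemma isHomog_true_iff {T : Op 𝕂 E Θ} : IsHomog true T ↔ IsOdd T := by
  rw [IsHomog, IsOdd, conjParity_apply]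
  constructor
  · intro h
    rw [if_pos rfl] at h
    rw [← neg_mul, ← h]
    simp [mul_assoc, parity_mul_parity]
  · intro h
    rw [h, neg_mul, mul_assoc, parity_mul_parity]
    simp

namespace IsHomog

variable {o o' : Bool} {S T : Op 𝕂 E Θ}

lemma mul (hS : IsHomog o S) (hT : IsHomog o' T) : IsHomog (xor o o') (S * T) := by
  rw [IsHomog] at *
  rw [map_mul, hS, hT]
  cases o <;> cases o' <;> simp

lemma add (hS : IsHomog o S) (hT : IsHomog o T) : IsHomog o (S + T) := by
  rw [IsHomog] at *
  rw [map_add, hS, hT]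
  cases o
  · simp
  · simp [add_comm]

lemma smul (c : 𝕂) (hT : IsHomog o T) : IsHomog o (c • T) := by
  rw [IsHomog] at *
  rw [map_smul, hT]
  cases o <;> simp

lemma neg (hT : IsHomog o T) : IsHomog o (-T) := by
  rw [IsHomog] at *
  rw [map_neg, hT]
  cases o <;> simp

lemma zero : IsHomog o (0 : Op 𝕂 E Θ) := by
  rw [IsHomog, map_zero]
  cases o <;> simp

lemma twist_mem_pair (hT : IsHomog o T) (o' : Bool) : twist o' T = T ∨ twist o' T = -T := by
  cases o'
  · exact Or.inl rfl
  · rw [twist_true, hT]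
    cases o <;> simp

end IsHomog

lemma isHomog_hbar : IsHomog false (hbar : Op 𝕂 E Θ) :=
  isHomog_false_iff.2 hbar_parity.symm

lemma isHomog_evenPart (T : Op 𝕂 E Θ) : IsHomog false (evenPart T) := by
  rw [IsHomog, evenPart, ← conjParity_apply]
  simp [add_comm]

lemma isHomog_oddPart (T : Op 𝕂 E Θ) : IsHomog true (oddPart T) := by
  rw [IsHomog, oddPart, ← conjParity_apply]
  simp [← smul_neg]

lemma evenPart_add_oddPart (T : Op 𝕂 E Θ) : evenPart T + oddPart T = T := by
  rw [evenPart, oddPart, ← smul_add, add_add_sub_cancel, ← two_smul 𝕂, smul_smul]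
  norm_num

/-- The super-commutator as a combination of products. -/
lemma superComm_expand (S T : Op 𝕂 E Θ) :
    superComm S T = S * T - (1 / 2 : 𝕂) • (T * S + parity * T * parity * S
      + T * parity * S * parity - parity * T * S * parity) := by
  have h : parity * T * parity * (parity * S * parity) = parity * T * S * parity := by
    rw [show parity * T * parity * (parity * S * parity) =
      parity * T * (parity * parity) * S * parity by simp only [mul_assoc], parity_mul_parity,
      mul_one]
  simp only [superComm, evenPart, oddPart, smul_mul_smul, mul_add, add_mul, mul_sub, sub_mul, h]
  simp only [← mul_assoc]
  module

lemma superComm_add_left (S S' T : Op 𝕂 E Θ) :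
    superComm (S + S') T = superComm S T + superComm S' T := by
  simp only [superComm_expand, mul_add, add_mul]
  module

lemma superComm_smul_left (c : 𝕂) (S T : Op 𝕂 E Θ) :
    superComm (c • S) T = c • superComm S T := by
  simp only [superComm_expand, smul_mul_assoc, mul_smul_comm]
  module

lemma superComm_add_right (S T T' : Op 𝕂 E Θ) :
    superComm S (T + T') = superComm S T + superComm S T' := by
  simp only [superComm_expand, mul_add, add_mul]
  module

lemma superComm_smul_right (c : 𝕂) (S T : Op 𝕂 E Θ) :
    superComm S (c • T) = c • superComm S T := by
  simp only [superComm_expand, smul_mul_assoc, mul_smul_comm]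
  module

lemma superComm_sub_left (S S' T : Op 𝕂 E Θ) :
    superComm (S - S') T = superComm S T - superComm S' T := by
  simp only [superComm_expand, mul_sub, sub_mul]
  module

lemma superComm_sub_right (S T T' : Op 𝕂 E Θ) :
    superComm S (T - T') = superComm S T - superComm S T' := by
  simp only [superComm_expand, mul_sub, sub_mul]
  module

/-- When one argument is homogeneous, the sign rule amounts to applying an algebra automorphism to
the other, which then need not be split into its even and odd parts. -/
lemma superComm_of_isHomog {o : Bool} {S : Op 𝕂 E Θ} (hS : IsHomog o S) (T : Op 𝕂 E Θ) :
    superComm S T = S * T - twist o T * S := by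
  cases o
  · have h : parity * S = S * parity := isHomog_false_iff.1 hS
    have h1 : T * parity * S * parity = T * S := by
      rw [mul_assoc T, h, mul_assoc, mul_assoc, parity_mul_parity, mul_one]
    have h2 : parity * T * S * parity = parity * T * parity * S := by
      rw [mul_assoc (parity * T), ← h, ← mul_assoc]
    rw [superComm_expand, twist_false, h1, h2]
    module
  · have h : parity * S = -(S * parity) := isHomog_true_iff.1 hS
    have h1 : T * parity * S * parity = -(T * S) := by
      rw [mul_assoc T, h, mul_assoc, neg_mul, mul_assoc, parity_mul_parity, mul_one, mul_neg]
    have h2 : parity * T * S * parity = -(parity * T * parity * S) := by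
      rw [mul_assoc (parity * T), mul_assoc (parity * T) parity, h, mul_neg, neg_neg]
    rw [superComm_expand, twist_true, conjParity_apply, h1, h2]
    module

variable {n : ℕ} {f : Series 𝕂 E Θ} {R T : Op 𝕂 E Θ}

/-- The hypotheses list the series at which `R` gets evaluated when the super-commutator is
expanded. With `R` the error of an approximation, they say where it must be small. -/
lemma superComm_apply_mem_left (hT : RaisesDegree 0 T) (h1 : R (T f) ∈ degGE 𝕂 E Θ n)
    (h2 : R f ∈ degGE 𝕂 E Θ n) (h3 : R (parity f) ∈ degGE 𝕂 E Θ n) :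
    superComm R T f ∈ degGE 𝕂 E Θ n := by
  have hp := raisesDegree_parity (𝕂 := 𝕂) (E := E) (Θ := Θ)
  rw [superComm_expand]
  exact sub_mem h1 (Submodule.smul_mem _ _ (sub_mem (add_mem (add_mem (hT.apply h2)
    (hp.apply (hT.apply (hp.apply h2)))) (hT.apply (hp.apply h3)))
    (hp.apply (hT.apply h3))))

lemma superComm_apply_mem_right (hT : RaisesDegree 0 T) (h1 : R f ∈ degGE 𝕂 E Θ n)
    (h2 : R (T f) ∈ degGE 𝕂 E Θ n) (h3 : R (parity (T f)) ∈ degGE 𝕂 E Θ n)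
    (h4 : R (parity (T (parity f))) ∈ degGE 𝕂 E Θ n) (h5 : R (T (parity f)) ∈ degGE 𝕂 E Θ n) :
    superComm T R f ∈ degGE 𝕂 E Θ n := by
  have hp := raisesDegree_parity (𝕂 := 𝕂) (E := E) (Θ := Θ)
  rw [superComm_expand]
  exact sub_mem (hT.apply h1) (Submodule.smul_mem _ _ (sub_mem (add_mem (add_mem h2
    (hp.apply h3)) h4) (hp.apply h5)))

end Parity

/-! ### Super-commutators in the completed Weyl algebra are divisible by `ħ` -/

section Brackets

variable {𝕂 : Type} [RCLike 𝕂] {E Θ : Type}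

lemma IsHomog.twist_eq {o' : Bool} {T : Op 𝕂 E Θ} (hT : IsHomog o' T) (o : Bool) :
    twist o T = if o && o' then -T else T := by
  cases o
  · rfl
  · rw [twist_true, hT, Bool.true_and]

lemma isHomog_one : IsHomog false (1 : Op 𝕂 E Θ) := map_one _

/-- Bracketing with a homogeneous operator is a twisted derivation. -/
lemma bracket_mul_right (o : Bool) (P Q R : Op 𝕂 E Θ) :
    P * (Q * R) - twist o (Q * R) * P =
      (P * Q - twist o Q * P) * R + twist o Q * (P * R - twist o R * P) := by
  rw [map_mul]
  noncomm_ring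

/-- A product is moved past `Q` one factor at a time; the twists of the factors compose to the twist
of the product. -/
lemma bracket_mul_left (o o' : Bool) (P P' Q : Op 𝕂 E Θ) :
    P * P' * Q - twist (xor o o') Q * (P * P') =
      P * (P' * Q - twist o' Q * P') + (P * twist o' Q - twist o (twist o' Q) * P) * P' := by
  rw [twist_twist]
  noncomm_ring

variable [LinearOrder Θ] {U : Set (E ⊕ Θ)}

lemma isHomog_mulCoord (a : E ⊕ Θ) : IsHomog a.isRight (mulCoord a : Op 𝕂 E Θ) := by
  rcases a with a | a
  · exact isHomog_false_iff.2 (parity_mulX a)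
  · exact isHomog_true_iff.2 (parity_mulTheta a)

lemma isHomog_hbarD (a : E ⊕ Θ) : IsHomog a.isRight (hbarD a : Op 𝕂 E Θ) := by
  rw [← Bool.false_xor a.isRight]
  refine isHomog_hbar.mul ?_
  rcases a with a | a
  · exact isHomog_false_iff.2 (parity_dX a)
  · exact isHomog_true_iff.2 (parity_dTheta a)

lemma bracket_mulCoord_mulCoord (a b : E ⊕ Θ) :
    (mulCoord a * mulCoord b : Op 𝕂 E Θ) - twist a.isRight (mulCoord b) * mulCoord a = 0 := by
  rw [(isHomog_mulCoord b).twist_eq]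
  rcases a with a | a <;> rcases b with b | b
  · simp [mulCoord, mulX_mulX a b]
  · simp [mulCoord, mulX_mulTheta a b]
  · simp [mulCoord, mulX_mulTheta b a]
  · simpa [mulCoord] using mulTheta_mulTheta a b

lemma bracket_hbarD_hbarD (a b : E ⊕ Θ) :
    (hbarD a * hbarD b : Op 𝕂 E Θ) - twist a.isRight (hbarD b) * hbarD a = 0 := by
  have h : ∀ a b : E ⊕ Θ, (hbarD a * hbarD b : Op 𝕂 E Θ) =
      hbar * hbar * (Sum.elim dX dTheta a * Sum.elim dX dTheta b) := fun a b => by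
    rw [hbarD, hbarD, mul_assoc, ← mul_assoc (Sum.elim dX dTheta a), ← hbar_mul_partial]
    simp only [mul_assoc]
  rw [(isHomog_hbarD b).twist_eq]
  rcases a with a | a <;> rcases b with b | b
  · simp [h, dX_dX a b]
  · simp [h, dX_dTheta a b]
  · simp [h, dX_dTheta b a]
  · simp [h, ← mul_add, dTheta_dTheta a b]

lemma bracket_hbarD_mulCoord (a b : E ⊕ Θ) [Decidable (a = b)] :
    (hbarD a * mulCoord b : Op 𝕂 E Θ) - twist a.isRight (mulCoord b) * hbarD a =
      if a = b then hbar else 0 := by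
  classical
  rw [(isHomog_mulCoord b).twist_eq, hbarD]
  have h : ∀ T : Op 𝕂 E Θ, mulCoord b * (hbar * T) = hbar * (mulCoord b * T) := fun T => by
    rw [← mul_assoc, ← hbar_mul_mulCoord, mul_assoc]
  have h' : (if a = b then hbar else 0 : Op 𝕂 E Θ) = hbar * (if a = b then 1 else 0) := by
    split_ifs <;> simp
  rw [h']
  rcases a with a | a <;> rcases b with b | b
  · simp only [Sum.inl.injEq, ← dX_mulX a b, mul_sub]
    simpa [mulCoord, mul_assoc] using h (dX a)
  · simp [mul_assoc, h]
    simp [mulCoord, dX_mulTheta a b]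
  · simp [mul_assoc, h]
    simp [mulCoord, mulX_dTheta b a]
  · simp only [Sum.inr.injEq, ← dTheta_mulTheta a b, mul_add]
    simpa [mulCoord, mul_assoc] using h (dTheta a)

/-- Super-antisymmetry: exchanging the arguments costs a sign, which is `+1` only if both are odd,
and the exchanged bracket is ħ or 0. -/
lemma bracket_mulCoord_hbarD_mem (a b : E ⊕ Θ) :
    (mulCoord a * hbarD b : Op 𝕂 E Θ) - twist a.isRight (hbarD b) * mulCoord a ∈
      hbarWeyl 𝕂 U := by
  classical
  have h0 : hbar ∈ hbarWeyl 𝕂 U := ⟨1, (weylHat 𝕂 U).one_mem, mul_one _⟩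
  have h : ∃ c : 𝕂, (mulCoord a * hbarD b : Op 𝕂 E Θ) - twist a.isRight (hbarD b) * mulCoord a =
      c • ((hbarD b * mulCoord a : Op 𝕂 E Θ) - twist b.isRight (mulCoord a) * hbarD b) := by
    rw [(isHomog_hbarD b).twist_eq, (isHomog_mulCoord a).twist_eq]
    rcases a with a | a <;> rcases b with b | b
    · exact ⟨-1, by simp⟩
    · exact ⟨-1, by simp⟩
    · exact ⟨-1, by simp⟩
    · exact ⟨1, by simp [add_comm]⟩
  obtain ⟨c, h⟩ := h
  rw [h, bracket_hbarD_mulCoord]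
  split_ifs
  · exact Submodule.smul_mem _ _ h0
  · simp

lemma twist_mem_weylAlg {T : Op 𝕂 E Θ} (hT : T ∈ weylAlg 𝕂 U) (o : Bool) :
    twist o T ∈ weylAlg 𝕂 U := by
  induction hT using Algebra.adjoin_induction with
  | mem T hT =>
    have h : ∃ o', IsHomog o' T := by
      rcases hT with (hT | ⟨a, _, rfl⟩) | ⟨a, _, rfl⟩
      · rw [Set.mem_singleton_iff.1 hT]
        exact ⟨_, isHomog_hbar⟩
      · exact ⟨_, isHomog_mulCoord a⟩
      · exact ⟨_, isHomog_hbarD a⟩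
    obtain ⟨o', h⟩ := h
    rcases h.twist_mem_pair o with h | h <;> rw [h]
    · exact Algebra.subset_adjoin hT
    · exact neg_mem (Algebra.subset_adjoin hT)
  | algebraMap r => rw [AlgHom.commutes]; exact Subalgebra.algebraMap_mem _ r
  | add S T _ _ hS hT => rw [map_add]; exact add_mem hS hT
  | mul S T _ _ hS hT => rw [map_mul]; exact mul_mem hS hT

lemma twist_mem_weylHat {T : Op 𝕂 E Θ} (hT : T ∈ weylHat 𝕂 U) (o : Bool) :
    twist o T ∈ weylHat 𝕂 U := by
  classical
  cases o
  · exact hT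
  intro s n
  -- The conjugated operator at `f` is the original one at `parity f`, followed by the
  -- degree-preserving parity.
  obtain ⟨S, hS, h⟩ := hT (s.image parity) n
  refine ⟨twist true S, twist_mem_weylAlg hS _, fun f hf => ?_⟩
  have := raisesDegree_parity.apply (h _ (Finset.mem_image_of_mem _ hf))
  rwa [map_sub] at this

/-- Bracketing with `P` is a twisted derivation, and `hbarWeyl` absorbs multiplication by the
completed algebra on both sides. -/
lemma bracket_mem_of_generators {o : Bool} {P : Op 𝕂 E Θ} (hP : P ∈ weylHat 𝕂 U)
    (h1 : ∀ a ∈ U, P * mulCoord a - twist o (mulCoord a) * P ∈ hbarWeyl 𝕂 U)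
    (h2 : ∀ a ∈ U, P * hbarD a - twist o (hbarD a) * P ∈ hbarWeyl 𝕂 U)
    {Q : Op 𝕂 E Θ} (hQ : Q ∈ weylAlg 𝕂 U) : P * Q - twist o Q * P ∈ hbarWeyl 𝕂 U := by
  induction hQ using Algebra.adjoin_induction with
  | mem T hT =>
    rcases hT with (hT | ⟨a, ha, rfl⟩) | ⟨a, ha, rfl⟩
    · rw [Set.mem_singleton_iff.1 hT, isHomog_hbar.twist_eq]
      simp [hbar_comm hP]
    · exact h1 a ha
    · exact h2 a ha
  | algebraMap r => simp [Algebra.commutes r P]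
  | add S T _ _ hS hT =>
    convert add_mem hS hT using 1
    rw [map_add]
    noncomm_ring
  | mul S T hS' hT' hS hT =>
    rw [bracket_mul_right]
    exact add_mem (mul_mem_hbarWeyl_right hS (weylAlg_le_weylHat hT'))
      (mul_mem_hbarWeyl_left (weylAlg_le_weylHat (twist_mem_weylAlg hS' _)) hT)

lemma superComm_mem_of_mem_weylAlg {P Q : Op 𝕂 E Θ} (hP : P ∈ weylAlg 𝕂 U)
    (hQ : Q ∈ weylAlg 𝕂 U) : superComm P Q ∈ hbarWeyl 𝕂 U := by
  -- The algebra is spanned by words in the generators, and words are homogeneous. Induction over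
  -- sums and products at once would lose the homogeneity on which the Leibniz rule in the left
  -- argument depends.
  rw [weylAlg, ← Subalgebra.mem_toSubmodule, Algebra.adjoin_eq_span] at hP
  induction hP using Submodule.span_induction with
  | mem P hP =>
    have h : ∃ o, IsHomog o P ∧ P ∈ weylAlg 𝕂 U ∧
        ∀ Q ∈ weylAlg 𝕂 U, P * Q - twist o Q * P ∈ hbarWeyl 𝕂 U := by
      clear hQ
      induction hP using Submonoid.closure_induction with
      | mem P hP =>
        rcases hP with (hP | ⟨a, ha, rfl⟩) | ⟨a, ha, rfl⟩
        · rw [Set.mem_singleton_iff.1 hP]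
          refine ⟨_, isHomog_hbar, hbar_mem_weylAlg, fun Q hQ => ?_⟩
          rw [twist_false, hbar_comm_of_mem_weylAlg hQ, sub_self]
          exact zero_mem _
        · refine ⟨_, isHomog_mulCoord a, mulCoord_mem_weylAlg ha, fun Q hQ =>
            bracket_mem_of_generators (weylAlg_le_weylHat (mulCoord_mem_weylAlg ha))
              (fun b _ => ?_) (fun b _ => bracket_mulCoord_hbarD_mem a b) hQ⟩
          rw [bracket_mulCoord_mulCoord]
          exact zero_mem _
        · refine ⟨_, isHomog_hbarD a, hbarD_mem_weylAlg ha, fun Q hQ =>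
            bracket_mem_of_generators (weylAlg_le_weylHat (hbarD_mem_weylAlg ha))
              (fun b _ => ?_) (fun b _ => ?_) hQ⟩
          · classical
            rw [bracket_hbarD_mulCoord]
            split_ifs
            · exact ⟨1, (weylHat 𝕂 U).one_mem, mul_one _⟩
            · exact zero_mem _
          · rw [bracket_hbarD_hbarD]
            exact zero_mem _
      | one =>
        refine ⟨_, isHomog_one, one_mem _, fun Q _ => ?_⟩
        rw [twist_false, one_mul, mul_one, sub_self]
        exact zero_mem _
      | mul P P' _ _ hP hP' =>
        obtain ⟨o, h1, h2, h3⟩ := hP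
        obtain ⟨o', h1', h2', h3'⟩ := hP'
        refine ⟨_, h1.mul h1', mul_mem h2 h2', fun Q hQ => ?_⟩
        rw [bracket_mul_left]
        exact add_mem (mul_mem_hbarWeyl_left (weylAlg_le_weylHat h2) (h3' Q hQ))
          (mul_mem_hbarWeyl_right (h3 _ (twist_mem_weylAlg hQ _)) (weylAlg_le_weylHat h2'))
    obtain ⟨o, h1, -, h3⟩ := h
    rw [superComm_of_isHomog h1]
    exact h3 Q hQ
  | zero =>
    rw [show superComm 0 Q = (0 : Op 𝕂 E Θ) by simp [superComm_expand]]
    exact zero_mem _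
  | add S T _ _ hS hT => rw [superComm_add_left]; exact add_mem hS hT
  | smul c T _ hT => rw [superComm_smul_left]; exact Submodule.smul_mem _ c hT

/-- The completed Weyl algebra is super-commutative modulo `ħ`. -/
theorem superComm_mem_hbarWeyl {P Q : Op 𝕂 E Θ} (hP : P ∈ weylHat 𝕂 U) (hQ : Q ∈ weylHat 𝕂 U) :
    superComm P Q ∈ hbarWeyl 𝕂 U := by
  classical
  refine mem_hbarWeyl_of_approx fun s n => ?_
  -- The sets contain every series met in the two error estimates. `Q'` has to be chosen before
  -- `P'`, because `P'` must also be accurate at the series `Q' f`.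
  let s₁ := s ∪ s.image parity
  let s₂ := s₁ ∪ s₁.image P
  obtain ⟨Q', hQ', h1⟩ := hQ (s₂ ∪ s₂.image parity) n
  obtain ⟨P', hP', h2⟩ := hP (s₁ ∪ s.image Q') n
  refine ⟨superComm P' Q', superComm_mem_of_mem_weylAlg hP' hQ', fun f hf => ?_⟩
  have e : superComm P Q - superComm P' Q' = superComm P (Q - Q') + superComm (P - P') Q' := by
    rw [superComm_sub_left, superComm_sub_right, sub_add_sub_cancel]
  rw [← LinearMap.sub_apply, e]
  refine add_mem (superComm_apply_mem_right (raisesDegree_of_mem_weylHat hP) ?_ ?_ ?_ ?_ ?_)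
    (superComm_apply_mem_left (raisesDegree_of_mem_weylAlg hQ') ?_ ?_ ?_)
  any_goals refine h1 _ ?_
  any_goals refine h2 _ ?_
  all_goals
    simp only [s₁, s₂, Finset.mem_union, Finset.mem_image]
    grind

end Brackets

/-! ### Left ideals generated by homogeneous elements -/

section Ideals

variable {𝕂 : Type} [RCLike 𝕂] {E Θ : Type} [LinearOrder Θ] {U : Set (E ⊕ Θ)}

/-- The operators `ħ C` with `C` in a left ideal of the completed Weyl algebra. -/
def hbarIdeal (I : Ideal (weylHat 𝕂 U)) : AddSubgroup (Op 𝕂 E Θ) where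
  carrier := {T | ∃ C ∈ I, T = hbar * (C : Op 𝕂 E Θ)}
  zero_mem' := ⟨0, zero_mem _, by simp⟩
  add_mem' := by
    rintro _ _ ⟨C, hC, rfl⟩ ⟨D, hD, rfl⟩
    exact ⟨C + D, add_mem hC hD, by simp [mul_add]⟩
  neg_mem' := by
    rintro _ ⟨C, hC, rfl⟩
    refine ⟨(-1 : 𝕂) • C, ?_, by simp⟩
    rw [← smul_one_mul]
    exact I.mul_mem_left _ hC

lemma mul_mem_hbarIdeal {I : Ideal (weylHat 𝕂 U)} {S T : Op 𝕂 E Θ} (hS : S ∈ weylHat 𝕂 U)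
    (hT : T ∈ hbarIdeal I) : S * T ∈ hbarIdeal I := by
  obtain ⟨C, hC, rfl⟩ := hT
  refine ⟨⟨S, hS⟩ * C, I.mul_mem_left _ hC, ?_⟩
  rw [← mul_assoc, ← hbar_comm hS, mul_assoc]
  rfl

lemma hbarWeyl_mul_mem_hbarIdeal {I : Ideal (weylHat 𝕂 U)} {S : Op 𝕂 E Θ}
    (hS : S ∈ hbarWeyl 𝕂 U) {B : weylHat 𝕂 U} (hB : B ∈ I) :
    S * (B : Op 𝕂 E Θ) ∈ hbarIdeal I := by
  obtain ⟨C, hC, rfl⟩ := mem_hbarWeyl.1 hS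
  exact ⟨⟨C, hC⟩ * B, I.mul_mem_left _ hB, mul_assoc _ _ _⟩

/-- Involutivity of a left ideal can be checked on homogeneous generators. -/
theorem superComm_mem_hbarIdeal_span {G : Set (weylHat 𝕂 U)}
    (hG : ∀ g ∈ G, ∃ o, IsHomog o (g : Op 𝕂 E Θ))
    (hbr : ∀ g ∈ G, ∀ g' ∈ G, superComm (g : Op 𝕂 E Θ) (g' : Op 𝕂 E Θ) ∈
      hbarIdeal (Ideal.span G))
    {A B : weylHat 𝕂 U} (hA : A ∈ Ideal.span G) (hB : B ∈ Ideal.span G) :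
    superComm (A : Op 𝕂 E Θ) (B : Op 𝕂 E Θ) ∈ hbarIdeal (Ideal.span G) := by
  have hW : ∀ {o : Bool} {P Q : Op 𝕂 E Θ}, IsHomog o P → P ∈ weylHat 𝕂 U → Q ∈ weylHat 𝕂 U →
      P * Q - twist o Q * P ∈ hbarWeyl 𝕂 U := fun h hP hQ => by
    rw [← superComm_of_isHomog h]
    exact superComm_mem_hbarWeyl hP hQ
  -- Right argument: in `[g, Q T] = [g, Q] T ± Q [g, T]` the first bracket is divisible by ħ and `T`
  -- is in the ideal, while the second term is covered by induction.
  have h1 : ∀ g ∈ G, ∀ o, IsHomog o (g : Op 𝕂 E Θ) → ∀ B ∈ Ideal.span G,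
      (g : Op 𝕂 E Θ) * (B : Op 𝕂 E Θ) - twist o (B : Op 𝕂 E Θ) * g ∈ hbarIdeal (Ideal.span G) := by
    intro g hg o ho B hB
    induction hB using Submodule.span_induction with
    | mem B hB => rw [← superComm_of_isHomog ho]; exact hbr g hg B hB
    | zero => simp
    | add S T _ _ hS hT =>
      convert add_mem hS hT using 1
      rw [Subalgebra.coe_add, map_add]
      noncomm_ring
    | smul Q T hT' hT =>
      rw [smul_eq_mul, Subalgebra.coe_mul, bracket_mul_right]
      exact add_mem (hbarWeyl_mul_mem_hbarIdeal (hW ho g.2 Q.2) hT')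
        (mul_mem_hbarIdeal (twist_mem_weylHat Q.2 _) hT)
  have h2 : ∀ g ∈ G, ∀ o, IsHomog o (g : Op 𝕂 E Θ) → ∀ o' (P : Op 𝕂 E Θ), IsHomog o' P →
      P ∈ weylHat 𝕂 U → superComm (P * (g : Op 𝕂 E Θ)) (B : Op 𝕂 E Θ) ∈ hbarIdeal (Ideal.span G) := by
    intro g hg o ho o' P hP hPW
    rw [superComm_of_isHomog (hP.mul ho), bracket_mul_left]
    exact add_mem (mul_mem_hbarIdeal hPW (h1 g hg o ho B hB)) (hbarWeyl_mul_mem_hbarIdeal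
      (hW hP hPW (twist_mem_weylHat B.2 _)) (Ideal.subset_span hg))
  -- This principle writes `A` as a sum of products `P g` with `g` a generator. Splitting `P` into
  -- its even and odd parts makes each such product homogeneous.
  induction hA using Submodule.closure_induction with
  | zero => simp [superComm_expand]
  | add S T _ _ hS hT => rw [Subalgebra.coe_add, superComm_add_left]; exact add_mem hS hT
  | smul_mem P g hg =>
    obtain ⟨o, ho⟩ := hG g hg
    have hc := twist_mem_weylHat P.2 true
    rw [smul_eq_mul, Subalgebra.coe_mul, ← evenPart_add_oddPart (P : Op 𝕂 E Θ), add_mul,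
      superComm_add_left]
    exact add_mem
      (h2 g hg o ho _ _ (isHomog_evenPart _) (Subalgebra.smul_mem _ (add_mem P.2 hc) _))
      (h2 g hg o ho _ _ (isHomog_oddPart _) (Subalgebra.smul_mem _ (sub_mem P.2 hc) _))

end Ideals

/-! ### Operators are determined by their commutators and their value at `1` -/

section Determination

variable {𝕂 : Type} [RCLike 𝕂] {E Θ : Type}

/-- The monomial `x ^ α * θ_S * ħ ^ k` as a series. -/
def monomial (𝕂 : Type) [RCLike 𝕂] {E Θ : Type} (M : Mon E Θ) : Series 𝕂 E Θ :=
  ⟨fun M' => by classical exact if M' = M then 1 else 0, fun d =>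
    (Set.finite_singleton M).subset fun M' hM => by
      by_contra h
      exact hM.2 (if_neg h)⟩

lemma monomial_apply (M M' : Mon E Θ) [Decidable (M' = M)] :
    (monomial 𝕂 M).1 M' = if M' = M then 1 else 0 := by
  simp only [monomial]
  congr

lemma hbar_monomial (m : E →₀ ℕ) (S : Finset Θ) (k : ℕ) :
    (hbar : Op 𝕂 E Θ) (monomial 𝕂 (m, S, k)) = monomial 𝕂 (m, S, k + 1) := by
  classical
  refine Subtype.ext (funext fun ⟨m', S', k'⟩ => ?_)
  rw [hbar_apply, monomial_apply, monomial_apply]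
  rcases k' with _ | k' <;> simp

lemma mulX_monomial (a : E) (m : E →₀ ℕ) (S : Finset Θ) (k : ℕ) :
    (mulX a : Op 𝕂 E Θ) (monomial 𝕂 (m, S, k)) = monomial 𝕂 (m + Finsupp.single a 1, S, k) := by
  classical
  refine Subtype.ext (funext fun ⟨m', S', k'⟩ => ?_)
  rw [mulX_apply, monomial_apply, monomial_apply]
  by_cases h : m' a = 0
  · have h1 : m' ≠ m + Finsupp.single a 1 := by
      rintro rfl
      simp at h
    simp [h, h1]
  · have h1 : Finsupp.single a 1 ≤ m' := by
      rw [Finsupp.single_le_iff]; omega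
    simp [h, tsub_eq_iff_eq_add_of_le h1]

/-- Polynomials are dense: below degree `n` a series has only finitely many terms. -/
lemma sub_sum_monomial_mem_degGE (f : Series 𝕂 E Θ) (n : ℕ) :
    ∃ s : Finset (Mon E Θ), f - ∑ M ∈ s, f.1 M • monomial 𝕂 M ∈ degGE 𝕂 E Θ n := by
  classical
  have hfin : (⋃ d ∈ Set.Iio n, {M | deg M = d ∧ f.1 M ≠ 0}).Finite :=
    (Set.finite_Iio n).biUnion fun d _ => f.2 d
  refine ⟨hfin.toFinset, fun M hM => ?_⟩
  simp only [AddSubgroupClass.coe_sub, AddSubmonoidClass.coe_finsetSum, Submodule.coe_smul,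
    Pi.sub_apply, Finset.sum_apply, Pi.smul_apply, monomial_apply, smul_eq_mul, mul_ite, mul_one,
    mul_zero, Finset.sum_ite_eq]
  split_ifs with h
  · exact sub_self _
  · rw [sub_zero]
    by_contra h0
    exact h (by simpa using ⟨hM, h0⟩)

variable [LinearOrder Θ]

lemma mulTheta_monomial {a : Θ} (m : E →₀ ℕ) {S : Finset Θ} (ha : a ∉ S) (k : ℕ) :
    (mulTheta a : Op 𝕂 E Θ) (monomial 𝕂 (m, S, k)) =
      oddSign 𝕂 a (insert a S) • monomial 𝕂 (m, insert a S, k) := by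
  classical
  refine Subtype.ext (funext fun ⟨m', S', k'⟩ => ?_)
  rw [mulTheta_apply, Submodule.coe_smul, Pi.smul_apply, monomial_apply, monomial_apply]
  by_cases h : a ∈ S'
  · have h1 : S'.erase a = S ↔ S' = insert a S := by
      constructor
      · rintro rfl
        rw [Finset.insert_erase h]
      · rintro rfl
        rw [Finset.erase_insert ha]
    simp only [h, Prod.mk.injEq, h1, if_true, smul_eq_mul]
    split_ifs with h2
    · rw [h2.2.1]
    · simp
  · have h1 : S' ≠ insert a S := by
      rintro rfl
      simp at h
    simp [h, h1]

/-- An operator that kills `1` and commutes up to factors with the coordinates and `ħ` is zero. -/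
theorem op_eq_zero_of_comm {T : Op 𝕂 E Θ} (hT : RaisesDegree 0 T)
    (h1 : T (monomial 𝕂 (0, ∅, 0)) = 0) (hh : T * hbar = hbar * T)
    (hc : ∀ a, ∃ c : 𝕂, T * mulCoord a = c • (mulCoord a * T)) : T = 0 := by
  have hstep : ∀ {A : Op 𝕂 E Θ} {c : 𝕂}, T * A = c • (A * T) → ∀ {g}, T g = 0 → T (A g) = 0 := by
    intro A c h g hg
    have := LinearMap.congr_fun h g
    simpa [hg] using this
  -- The starting exponent `m'` is kept arbitrary so that the steps for two summands of `m` can be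
  -- chained.
  have hx : ∀ (m m' : E →₀ ℕ), T (monomial 𝕂 (m', ∅, 0)) = 0 →
      T (monomial 𝕂 (m' + m, ∅, 0)) = 0 := by
    intro m
    induction m using Finsupp.induction_linear with
    | zero => simp
    | add m₁ m₂ h₁ h₂ =>
      intro m' h
      rw [← add_assoc]
      exact h₂ _ (h₁ _ h)
    | single a b =>
      induction b with
      | zero => simp
      | succ b ih =>
        intro m' h
        rw [Finsupp.single_add, ← add_assoc, ← mulX_monomial]
        obtain ⟨c, hc⟩ := hc (Sum.inl a)
        exact hstep hc (ih _ h)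
  have hθ : ∀ (m : E →₀ ℕ) (S : Finset Θ), T (monomial 𝕂 (m, S, 0)) = 0 := by
    intro m S
    induction S using Finset.induction_on with
    | empty => simpa using hx m 0 h1
    | insert a S ha ih =>
      obtain ⟨c, hc⟩ := hc (Sum.inr a)
      have h2 := hstep hc ih
      rw [mulCoord, Sum.elim_inr, mulTheta_monomial _ ha, map_smul] at h2
      -- The sign relating `θ_a θ_S` to the ordered monomial squares to 1, hence can be cancelled.
      refine (smul_eq_zero.1 h2).resolve_left fun h3 => ?_
      have := oddSign_mul_self (𝕂 := 𝕂) a (insert a S)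
      simp [h3] at this
  have hM : ∀ (m : E →₀ ℕ) (S : Finset Θ) (k : ℕ), T (monomial 𝕂 (m, S, k)) = 0 := by
    intro m S k
    induction k with
    | zero => exact hθ m S
    | succ k ih =>
      rw [← hbar_monomial]
      exact hstep (c := 1) (by rw [hh, one_smul]) ih
  refine op_eq_zero_of_forall_mem fun f n => ?_
  obtain ⟨s, hs⟩ := sub_sum_monomial_mem_degGE f n
  have h2 := hT.apply hs
  rwa [map_sub, map_sum, Finset.sum_eq_zero, sub_zero] at h2
  rintro ⟨m, S, k⟩ _
  rw [map_smul, hM, smul_zero]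

end Determination

/-! ### Pointwise convergent sums over an arbitrary index set -/

section FamilySums

variable {𝕂 : Type} [RCLike 𝕂] {E Θ ι : Type}

/-- For every series `f`, only finitely many `T k f` have terms in low degree. -/
def FamilyFinite (T : ι → Op 𝕂 E Θ) : Prop :=
  ∀ (f : Series 𝕂 E Θ) (n : ℕ), {k | T k f ∉ degGE 𝕂 E Θ n}.Finite

lemma FamilyFinite.support {T : ι → Op 𝕂 E Θ} (hT : FamilyFinite T) (f : Series 𝕂 E Θ)
    (M : Mon E Θ) : (Function.support fun k => (T k f).1 M).Finite :=
  (hT f (deg M + 1)).subset fun _ hk h => hk (h M (Nat.lt_succ_self _))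

/-- The pointwise convergent sum of a family of operators. -/
def familySum (T : ι → Op 𝕂 E Θ) (hT : FamilyFinite T) : Op 𝕂 E Θ where
  toFun f := ⟨fun M => ∑ᶠ k, (T k f).1 M, by
    intro d
    refine ((hT f (d + 1)).biUnion (fun k _ => (T k f).2 d)).subset ?_
    rintro M ⟨hM, h⟩
    obtain ⟨k, hk⟩ : ∃ k, (T k f).1 M ≠ 0 := by
      by_contra! h0
      exact h (by simp [h0])
    simp only [Set.mem_iUnion]
    exact ⟨k, fun h0 => hk (h0 M (by omega)), hM, hk⟩⟩
  map_add' f g := by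
    ext M
    simp only [map_add, Submodule.coe_add, Pi.add_apply]
    exact finsum_add_distrib (hT.support f M) (hT.support g M)
  map_smul' c f := by
    ext M
    simp only [map_smul, Submodule.coe_smul, Pi.smul_apply, RingHom.id_apply, smul_eq_mul]
    exact (mul_finsum' _ _ (hT.support f M)).symm

lemma PointwiseFinite.familyFinite {T : ℤ → Op 𝕂 E Θ} (hT : PointwiseFinite T) :
    FamilyFinite T := hT

lemma opSum_eq_familySum (T : ℤ → Op 𝕂 E Θ) (hT : PointwiseFinite T) :
    opSum T hT = familySum T hT.familyFinite := rfl

variable {T : ι → Op 𝕂 E Θ} (hT : FamilyFinite T)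

lemma familySum_sub_sum_mem {f : Series 𝕂 E Θ} {n : ℕ} {s : Finset ι}
    (hs : ∀ k ∉ s, T k f ∈ degGE 𝕂 E Θ n) :
    familySum T hT f - ∑ k ∈ s, T k f ∈ degGE 𝕂 E Θ n := by
  intro M hM
  have h : (familySum T hT f).1 M = ∑ k ∈ s, (T k f).1 M :=
    finsum_eq_sum_of_support_subset _ fun k hk => by
      by_contra h
      exact hk (hs k h M hM)
  simp [h]

lemma familySum_apply_mem {f : Series 𝕂 E Θ} {n : ℕ} (h : ∀ k, T k f ∈ degGE 𝕂 E Θ n) :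
    familySum T hT f ∈ degGE 𝕂 E Θ n := by
  simpa using familySum_sub_sum_mem hT (s := ∅) fun k _ => h k

lemma raisesDegree_familySum {d : ℕ} (h : ∀ k, RaisesDegree d (T k)) :
    RaisesDegree d (familySum T hT) :=
  fun n f hf => familySum_apply_mem hT fun k => h k n f hf

lemma familySum_apply_eq_zero {f : Series 𝕂 E Θ} (h : ∀ k, T k f = 0) : familySum T hT f = 0 :=
  eq_zero_of_forall_mem_degGE fun n => familySum_apply_mem hT fun k => by
    rw [h]
    exact zero_mem _

lemma familySum_mem_weylHat [LinearOrder Θ] {U : Set (E ⊕ Θ)} (h : ∀ k, T k ∈ weylHat 𝕂 U) :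
    familySum T hT ∈ weylHat 𝕂 U := by
  classical
  refine mem_weylHat_of_approx fun s n => ?_
  have hfin : (⋃ f ∈ (s : Set (Series 𝕂 E Θ)), {k | T k f ∉ degGE 𝕂 E Θ n}).Finite :=
    s.finite_toSet.biUnion fun f _ => hT f n
  refine ⟨∑ k ∈ hfin.toFinset, T k, sum_mem fun k _ => h k, fun f hf => ?_⟩
  rw [LinearMap.sum_apply]
  refine familySum_sub_sum_mem hT fun k hk => ?_
  by_contra h0
  exact hk (hfin.mem_toFinset.2 (Set.mem_biUnion hf h0))

/-- If almost all members of a family commute with `A` up to a factor, then so does the sum, up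
to the contributions of the other members. -/
lemma familySum_bracket {A : Op 𝕂 E Θ} (hA : RaisesDegree 0 A) (c : 𝕂) (s : Finset ι)
    (h : ∀ k ∉ s, T k * A = c • (A * T k)) :
    familySum T hT * A - c • (A * familySum T hT) = ∑ k ∈ s, (T k * A - c • (A * T k)) := by
  classical
  refine op_eq_of_forall_sub_mem fun f n => ?_
  -- Outside `t` the summands are negligible both at `f` and at `A f`, so modulo degree `n` both
  -- infinite sums become finite sums over the same set.
  let t := s ∪ (hT f n).toFinset ∪ (hT (A f) n).toFinset
  have h1 : ∑ k ∈ s, (T k * A - c • (A * T k)) = ∑ k ∈ t, (T k * A - c • (A * T k)) := by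
    refine Finset.sum_subset (fun k hk => ?_) fun k _ hk => ?_
    · simp [t, hk]
    · rw [h k hk, sub_self]
  have h2 := familySum_sub_sum_mem hT (f := A f) (n := n) (s := t) fun k hk => by
    by_contra h0
    exact hk (by simp [t, h0])
  have h3 := hA.apply (familySum_sub_sum_mem hT (f := f) (n := n) (s := t) fun k hk => by
    by_contra h0
    exact hk (by simp [t, h0]))
  have h4 := sub_mem h2 (Submodule.smul_mem _ c h3)
  rw [h1]
  convert h4 using 1
  simp only [LinearMap.sub_apply, LinearMap.sum_apply, LinearMap.smul_apply, Module.End.mul_apply,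
    map_sub, map_sum, Finset.sum_sub_distrib, ← Finset.smul_sum, smul_sub]
  abel

/-- Homogeneity is commutation with `parity` up to a sign, so `familySum_bracket` applies with no
exceptional members. -/
lemma isHomog_familySum {o : Bool} (h : ∀ k, IsHomog o (T k)) : IsHomog o (familySum T hT) := by
  cases o
  · have := familySum_bracket hT raisesDegree_parity 1 ∅ fun k _ => by
      rw [one_smul]
      exact (isHomog_false_iff.1 (h k)).symm
    rw [Finset.sum_empty, one_smul, sub_eq_zero] at this
    exact isHomog_false_iff.2 this.symm
  · have := familySum_bracket hT raisesDegree_parity (-1) ∅ fun k _ => by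
      rw [isHomog_true_iff.1 (h k)]
      simp
    rw [Finset.sum_empty, neg_one_smul, sub_neg_eq_add, add_comm] at this
    exact isHomog_true_iff.2 (eq_neg_of_add_eq_zero_left this)

end FamilySums

/-! ### The modes -/

section Modes

variable {𝕂 : Type} [RCLike 𝕂] {Θ : Type} [LinearOrder Θ] (ι : ℕ+ ↪ Θ)

/-- The integer `k` stands for the half-integer `k + 1/2`, so differentiation by the `i`-th
coordinate has index `i - 1`. The linear terms of the Virasoro operators thereby become modes. -/
lemma bMode_sub_one (i : ℕ+) : (bMode ((i : ℤ) - 1) : Op 𝕂 ℕ+ Θ) = hbarD (Sum.inl i) := by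
  obtain ⟨j, rfl⟩ : ∃ j : ℕ, i = j.succPNat := ⟨i.natPred, by simp⟩
  rw [show ((j.succPNat : ℕ+) : ℤ) - 1 = Int.ofNat j by simp]
  rfl

lemma psiMode_sub_one (i : ℕ+) :
    (psiMode ι ((i : ℤ) - 1) : Op 𝕂 ℕ+ Θ) = hbarD (Sum.inr (ι i)) := by
  obtain ⟨j, rfl⟩ : ∃ j : ℕ, i = j.succPNat := ⟨i.natPred, by simp⟩
  rw [show ((j.succPNat : ℕ+) : ℤ) - 1 = Int.ofNat j by simp]
  rfl

variable {U : Set (ℕ+ ⊕ Θ)}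

lemma bMode_mem_weylHat (hU : ∀ a, Sum.inl a ∈ U) (k : ℤ) : bMode k ∈ weylHat 𝕂 U := by
  rcases k with j | j
  · exact weylAlg_le_weylHat (hbarD_mem_weylAlg (hU _))
  · exact Subalgebra.smul_mem _ (weylAlg_le_weylHat (mulCoord_mem_weylAlg (hU _))) _

lemma psiMode_mem_weylHat (hU : ∀ j, Sum.inr (ι j) ∈ U) (k : ℤ) :
    psiMode ι k ∈ weylHat 𝕂 U := by
  rcases k with j | j
  · exact weylAlg_le_weylHat (hbarD_mem_weylAlg (hU _))
  · exact weylAlg_le_weylHat (mulCoord_mem_weylAlg (hU _))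

lemma raisesDegree_bMode (k : ℤ) : RaisesDegree 0 (bMode k : Op 𝕂 ℕ+ Θ) :=
  fun _ _ hf => bMode_mem_degGE k hf

lemma raisesDegree_psiMode (k : ℤ) : RaisesDegree 0 (psiMode ι k : Op 𝕂 ℕ+ Θ) :=
  fun _ _ hf => psiMode_mem_degGE ι k hf

lemma isHomog_bMode (k : ℤ) : IsHomog false (bMode k : Op 𝕂 ℕ+ Θ) := by
  rcases k with j | j
  · exact isHomog_hbarD _
  · exact (isHomog_mulCoord (Sum.inl _)).smul _

lemma isHomog_psiMode (k : ℤ) : IsHomog true (psiMode ι k : Op 𝕂 ℕ+ Θ) := by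
  rcases k with j | j
  · exact isHomog_hbarD _
  · exact isHomog_mulCoord (Sum.inr _)

lemma hbar_mul_bMode (k : ℤ) : (hbar * bMode k : Op 𝕂 ℕ+ Θ) = bMode k * hbar :=
  hbar_comm (U := Set.univ) (bMode_mem_weylHat (fun _ => Set.mem_univ _) k)

lemma hbar_mul_psiMode (k : ℤ) : (hbar * psiMode ι k : Op 𝕂 ℕ+ Θ) = psiMode ι k * hbar :=
  hbar_comm (U := Set.univ) (psiMode_mem_weylHat ι (fun _ => Set.mem_univ _) k)

lemma hbarD_mul_mulCoord_inl (a b : ℕ+) :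
    (hbarD (Sum.inl a) * mulCoord (Sum.inl b) : Op 𝕂 ℕ+ Θ) - mulCoord (Sum.inl b) *
      hbarD (Sum.inl a) = if a = b then hbar else 0 := by
  have := bracket_hbarD_mulCoord (𝕂 := 𝕂) (Sum.inl a : ℕ+ ⊕ Θ) (Sum.inl b)
  exact this.trans (if_congr Sum.inl_injective.eq_iff rfl rfl)

lemma hbarD_mul_mulCoord_inr (a b : Θ) :
    (hbarD (Sum.inr a) * mulCoord (Sum.inr b) : Op 𝕂 ℕ+ Θ) + mulCoord (Sum.inr b) *
      hbarD (Sum.inr a) = if a = b then hbar else 0 := by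
  have := bracket_hbarD_mulCoord (𝕂 := 𝕂) (Sum.inr a : ℕ+ ⊕ Θ) (Sum.inr b)
  rw [(isHomog_mulCoord _).twist_eq] at this
  simpa only [Sum.isRight_inr, Bool.and_true, if_true, neg_mul, sub_neg_eq_add,
    Sum.inr.injEq] using this

lemma bMode_bMode (k l : ℤ) : (bMode k * bMode l : Op 𝕂 ℕ+ Θ) - bMode l * bMode k =
    if k + l + 1 = 0 then ((k : 𝕂) + 1 / 2) • hbar else 0 := by
  -- Only a derivative against a coordinate can contribute; the scalar `j + 1/2` in the definition
  -- of the negative modes becomes the value of the commutator.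
  have key : ∀ i j : ℕ, (bMode (Int.ofNat i) * bMode (Int.negSucc j) : Op 𝕂 ℕ+ Θ) -
      bMode (Int.negSucc j) * bMode (Int.ofNat i) =
      if i = j then ((i : 𝕂) + 1 / 2) • hbar else 0 := by
    intro i j
    have := hbarD_mul_mulCoord_inl (𝕂 := 𝕂) (Θ := Θ) i.succPNat j.succPNat
    simp only [Nat.succPNat_injective.eq_iff] at this
    simp only [bMode, mul_smul_comm, smul_mul_assoc]
    rw [← smul_sub, this]
    split_ifs with h
    · rw [h]
    · rw [smul_zero]
  rcases k with i | i <;> rcases l with j | j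
  · rw [if_neg (by simp only [Int.ofNat_eq_natCast]; omega)]
    exact bracket_hbarD_hbarD (Sum.inl _) (Sum.inl _)
  · rw [key]
    simp only [Int.ofNat_eq_natCast, Int.cast_natCast]
    exact if_congr (by omega) rfl rfl
  · rw [← neg_sub, key]
    simp only [Int.ofNat_eq_natCast, Int.cast_negSucc]
    by_cases h : j = i
    · rw [if_pos h, if_pos (by omega), h, ← neg_smul]
      push_cast
      congr 1
      ring
    · rw [if_neg h, if_neg (by omega), neg_zero]
  · rw [if_neg (by omega)]
    have := bracket_mulCoord_mulCoord (𝕂 := 𝕂) (Sum.inl i.succPNat : ℕ+ ⊕ Θ) (Sum.inl j.succPNat)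
    rw [Sum.isRight_inl, twist_false, sub_eq_zero] at this
    simp only [bMode, mul_smul_comm, smul_mul_assoc]
    rw [this, smul_comm, sub_self]

lemma psiMode_psiMode (k l : ℤ) :
    (psiMode ι k * psiMode ι l : Op 𝕂 ℕ+ Θ) + psiMode ι l * psiMode ι k =
      if k + l + 1 = 0 then hbar else 0 := by
  rcases k with i | i <;> rcases l with j | j
  · rw [if_neg (by simp only [Int.ofNat_eq_natCast]; omega)]
    have := bracket_hbarD_hbarD (𝕂 := 𝕂) (Sum.inr (ι i.succPNat) : ℕ+ ⊕ Θ)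
      (Sum.inr (ι j.succPNat))
    rw [(isHomog_hbarD _).twist_eq] at this
    simp only [Sum.isRight_inr, Bool.and_self, if_true, neg_mul, sub_neg_eq_add] at this
    exact this
  · have := hbarD_mul_mulCoord_inr (𝕂 := 𝕂) (ι i.succPNat) (ι j.succPNat)
    simp only [ι.injective.eq_iff, Nat.succPNat_injective.eq_iff] at this
    simp only [psiMode, Int.ofNat_eq_natCast]
    rw [this]
    exact if_congr (by omega) rfl rfl
  · have := hbarD_mul_mulCoord_inr (𝕂 := 𝕂) (ι j.succPNat) (ι i.succPNat)
    simp only [ι.injective.eq_iff, Nat.succPNat_injective.eq_iff] at this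
    simp only [psiMode, Int.ofNat_eq_natCast]
    rw [add_comm, this]
    exact if_congr (by omega) rfl rfl
  · rw [if_neg (by omega)]
    have := bracket_mulCoord_mulCoord (𝕂 := 𝕂) (Sum.inr (ι i.succPNat) : ℕ+ ⊕ Θ)
      (Sum.inr (ι j.succPNat))
    rw [(isHomog_mulCoord _).twist_eq] at this
    simp only [Sum.isRight_inr, Bool.and_self, if_true, neg_mul, sub_neg_eq_add] at this
    exact this

lemma bMode_mulCoord_inr (k : ℤ) (t : Θ) :
    (bMode k * mulCoord (Sum.inr t) : Op 𝕂 ℕ+ Θ) = mulCoord (Sum.inr t) * bMode k := by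
  rcases k with i | i
  · have := bracket_hbarD_mulCoord (𝕂 := 𝕂) (Sum.inl i.succPNat : ℕ+ ⊕ Θ) (Sum.inr t)
    rw [Sum.isRight_inl, twist_false, if_neg (by simp), sub_eq_zero] at this
    exact this
  · have := bracket_mulCoord_mulCoord (𝕂 := 𝕂) (Sum.inl i.succPNat : ℕ+ ⊕ Θ) (Sum.inr t)
    rw [Sum.isRight_inl, twist_false, sub_eq_zero] at this
    simp only [bMode, smul_mul_assoc, mul_smul_comm, this]

lemma bMode_hbarD_inr (k : ℤ) (t : Θ) :
    (bMode k * hbarD (Sum.inr t) : Op 𝕂 ℕ+ Θ) = hbarD (Sum.inr t) * bMode k := by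
  rcases k with i | i
  · exact sub_eq_zero.1 (bracket_hbarD_hbarD (𝕂 := 𝕂) (Sum.inl i.succPNat : ℕ+ ⊕ Θ) (Sum.inr t))
  · have := bracket_hbarD_mulCoord (𝕂 := 𝕂) (Sum.inr t : ℕ+ ⊕ Θ) (Sum.inl i.succPNat)
    rw [(isHomog_mulCoord _).twist_eq] at this
    simp only [bMode, smul_mul_assoc, mul_smul_comm]
    congr 1
    simpa [sub_eq_zero, eq_comm] using this

lemma bMode_psiMode (k l : ℤ) :
    (bMode k * psiMode ι l : Op 𝕂 ℕ+ Θ) = psiMode ι l * bMode k := by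
  rcases l with j | j
  · exact bMode_hbarD_inr k _
  · exact bMode_mulCoord_inr k _

lemma psiMode_mulCoord_inr (k : ℤ) {t : Θ} (ht : t ∉ Set.range ι) :
    (psiMode ι k * mulCoord (Sum.inr t) : Op 𝕂 ℕ+ Θ) = -(mulCoord (Sum.inr t) * psiMode ι k) := by
  rcases k with i | i
  · have := hbarD_mul_mulCoord_inr (𝕂 := 𝕂) (ι i.succPNat) t
    rw [if_neg fun h => ht ⟨_, h⟩] at this
    exact eq_neg_of_add_eq_zero_left this
  · have := bracket_mulCoord_mulCoord (𝕂 := 𝕂) (Sum.inr (ι i.succPNat) : ℕ+ ⊕ Θ) (Sum.inr t)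
    rw [(isHomog_mulCoord _).twist_eq] at this
    simp only [Sum.isRight_inr, Bool.and_self, if_true, neg_mul, sub_neg_eq_add] at this
    exact eq_neg_of_add_eq_zero_left this

theorem heisenbergRelations :
    HeisenbergRelations (𝕂 := 𝕂) (Θ := Θ) bMode (psiMode ι) where
  b_b := bMode_bMode
  psi_psi := psiMode_psiMode ι
  b_psi k l := sub_eq_zero.2 (bMode_psiMode ι k l)

/-- Normal ordering alters a product by a central term only, so brackets may be computed with plain
products. -/
lemma normalB_eq (k l : ℤ) :
    ∃ c : 𝕂, (normalB k l : Op 𝕂 ℕ+ Θ) = bMode k * bMode l - c • hbar := by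
  rw [normalB]
  split_ifs
  · by_cases h : k + l + 1 = 0
    · refine ⟨(k : 𝕂) + 1 / 2, ?_⟩
      have := bMode_bMode (𝕂 := 𝕂) (Θ := Θ) k l
      rw [if_pos h] at this
      rw [← this, sub_sub_cancel]
    · refine ⟨0, ?_⟩
      have := bMode_bMode (𝕂 := 𝕂) (Θ := Θ) k l
      rw [if_neg h, sub_eq_zero] at this
      rw [this, zero_smul, sub_zero]
  · exact ⟨0, by simp⟩

lemma normalPsi_eq (k l : ℤ) :
    ∃ c : 𝕂, (normalPsi ι k l : Op 𝕂 ℕ+ Θ) = psiMode ι k * psiMode ι l - c • hbar := by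
  rw [normalPsi]
  split_ifs
  · exact ⟨0, by simp⟩
  · have := psiMode_psiMode (𝕂 := 𝕂) ι k l
    by_cases h : k + l + 1 = 0
    · refine ⟨1, ?_⟩
      rw [if_pos h] at this
      rw [← this, one_smul]
      abel
    · refine ⟨0, ?_⟩
      rw [if_neg h] at this
      rw [eq_neg_of_add_eq_zero_left this, zero_smul, sub_zero]

lemma isHomog_normalB (k l : ℤ) : IsHomog false (normalB k l : Op 𝕂 ℕ+ Θ) := by
  rw [normalB]
  split_ifs
  · exact (isHomog_bMode _).mul (isHomog_bMode _)
  · exact (isHomog_bMode _).mul (isHomog_bMode _)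

lemma isHomog_normalPsi (k l : ℤ) : IsHomog false (normalPsi ι k l : Op 𝕂 ℕ+ Θ) := by
  rw [normalPsi]
  split_ifs
  · exact (isHomog_psiMode ι _).mul (isHomog_psiMode ι _)
  · exact ((isHomog_psiMode ι _).mul (isHomog_psiMode ι _)).neg

end Modes

/-! ### Brackets of the Virasoro operators with the modes -/

section ModeBrackets

variable {𝕂 : Type} [RCLike 𝕂]

/-- The two contributions are separate conditionals so that they simply add when `p = q`. -/
lemma familySum_bracket_of_ite {E Θ ι : Type} {T : ι → Op 𝕂 E Θ} (hT : FamilyFinite T)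
    [DecidableEq ι] {A : Op 𝕂 E Θ} (hA : RaisesDegree 0 A) (c : 𝕂) (p q : ι) (X Y : Op 𝕂 E Θ)
    (h : ∀ k, T k * A - c • (A * T k) = (if k = p then X else 0) + if k = q then Y else 0) :
    familySum T hT * A - c • (A * familySum T hT) = X + Y := by
  rw [familySum_bracket hT hA c {p, q}]
  · simp [h, Finset.sum_add_distrib]
  · intro k hk
    simp only [Finset.mem_insert, Finset.mem_singleton, not_or] at hk
    rw [← sub_eq_zero, h, if_neg hk.1, if_neg hk.2, add_zero]

lemma familySum_bracket_of_eq {E Θ ι : Type} {T : ι → Op 𝕂 E Θ} (hT : FamilyFinite T)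
    {A : Op 𝕂 E Θ} (hA : RaisesDegree 0 A) (c : 𝕂) (h : ∀ k, T k * A = c • (A * T k)) :
    familySum T hT * A = c • (A * familySum T hT) := by
  rw [← sub_eq_zero, familySum_bracket hT hA c ∅ fun k _ => h k, Finset.sum_empty]

variable {Θ : Type} [LinearOrder Θ] (ι : ℕ+ ↪ Θ)

/-- A summand sees the mode `k` only if one of its two factors is conjugate to it, which fixes `j`.
The two cases contribute equally, which later cancels the factor `1/2` in `H_i`. -/
lemma normalB_bracket_bMode (m j k : ℤ) :
    (normalB j (m - 1 - j) * bMode k : Op 𝕂 ℕ+ Θ) - (1 : 𝕂) • (bMode k * normalB j (m - 1 - j)) =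
      (if j = m + k then -((k : 𝕂) + 1 / 2) • (hbar * bMode (m + k)) else 0) +
      if j = -k - 1 then -((k : 𝕂) + 1 / 2) • (hbar * bMode (m + k)) else 0 := by
  obtain ⟨c, hc⟩ := normalB_eq (𝕂 := 𝕂) (Θ := Θ) j (m - 1 - j)
  have e : (normalB j (m - 1 - j) * bMode k : Op 𝕂 ℕ+ Θ) -
      (1 : 𝕂) • (bMode k * normalB j (m - 1 - j)) =
      bMode j * (bMode (m - 1 - j) * bMode k - bMode k * bMode (m - 1 - j)) +
      (bMode j * bMode k - bMode k * bMode j) * bMode (m - 1 - j) := by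
    rw [hc, one_smul, sub_mul, mul_sub, smul_mul_assoc, mul_smul_comm, hbar_mul_bMode]
    noncomm_ring
  rw [e, bMode_bMode, bMode_bMode]
  congr 1
  · by_cases h : j = m + k
    · rw [if_pos (by omega), if_pos h, h, mul_smul_comm, ← hbar_mul_bMode]
      congr 1
      push_cast
      ring
    · rw [if_neg (by omega), if_neg h, mul_zero]
  · by_cases h : j = -k - 1
    · rw [if_pos (by omega), if_pos h, h, smul_mul_assoc, show m - 1 - (-k - 1) = m + k by ring]
      congr 1
      push_cast
      ring
    · rw [if_neg (by omega), if_neg h, zero_mul]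

/-- The weight `j + 1/2 + m/2` changes sign under `j ↦ -m - j - 1`. This makes up for the sign of
exchanging two odd modes, so here too the two contributions agree. -/
lemma normalPsi_bracket_psiMode (m j k : ℤ) :
    (((j : 𝕂) + 1 / 2 + (m : 𝕂) / 2) • normalPsi ι (-j - 1) (m + j) * psiMode ι k : Op 𝕂 ℕ+ Θ) -
      (1 : 𝕂) • (psiMode ι k * (((j : 𝕂) + 1 / 2 + (m : 𝕂) / 2) • normalPsi ι (-j - 1) (m + j))) =
      (if j = -m - k - 1 then
        -((k : 𝕂) + 1 / 2 + (m : 𝕂) / 2) • (hbar * psiMode ι (m + k)) else 0) +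
      if j = k then -((k : 𝕂) + 1 / 2 + (m : 𝕂) / 2) • (hbar * psiMode ι (m + k)) else 0 := by
  obtain ⟨c, hc⟩ := normalPsi_eq (𝕂 := 𝕂) ι (-j - 1) (m + j)
  have e : (((j : 𝕂) + 1 / 2 + (m : 𝕂) / 2) • normalPsi ι (-j - 1) (m + j) * psiMode ι k :
      Op 𝕂 ℕ+ Θ) -
      (1 : 𝕂) • (psiMode ι k * (((j : 𝕂) + 1 / 2 + (m : 𝕂) / 2) • normalPsi ι (-j - 1) (m + j))) =
      ((j : 𝕂) + 1 / 2 + (m : 𝕂) / 2) • (psiMode ι (-j - 1) *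
        (psiMode ι (m + j) * psiMode ι k + psiMode ι k * psiMode ι (m + j))) +
      (-((j : 𝕂) + 1 / 2 + (m : 𝕂) / 2)) •
        ((psiMode ι (-j - 1) * psiMode ι k + psiMode ι k * psiMode ι (-j - 1)) *
          psiMode ι (m + j)) := by
    rw [hc, one_smul, smul_mul_assoc, mul_smul_comm, ← smul_sub, neg_smul, ← sub_eq_add_neg,
      ← smul_sub, sub_mul, mul_sub, smul_mul_assoc, mul_smul_comm, hbar_mul_psiMode]
    congr 1
    noncomm_ring
  rw [e, psiMode_psiMode, psiMode_psiMode]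
  congr 1
  · by_cases h : j = -m - k - 1
    · rw [if_pos (by omega), if_pos h, h, ← hbar_mul_psiMode,
        show -(-m - k - 1) - 1 = m + k by ring]
      congr 1
      push_cast
      ring
    · rw [if_neg (by omega), if_neg h, mul_zero, smul_zero]
  · by_cases h : j = k
    · rw [if_pos (by omega), if_pos h, h]
    · rw [if_neg (by omega), if_neg h, zero_mul, smul_zero]

/-- A mixed summand has just one even factor, hence a single contribution; the vacuous second
conditional only fits the shape of `familySum_bracket_of_ite`. -/
lemma bMode_psiMode_bracket_bMode (m j k : ℤ) :
    (bMode (m - 1 - j) * psiMode ι j * bMode k : Op 𝕂 ℕ+ Θ) -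
      (1 : 𝕂) • (bMode k * (bMode (m - 1 - j) * psiMode ι j)) =
      (if j = m + k then -((k : 𝕂) + 1 / 2) • (hbar * psiMode ι (m + k)) else 0) +
      if j = m + k then 0 else 0 := by
  have e : (bMode (m - 1 - j) * psiMode ι j * bMode k : Op 𝕂 ℕ+ Θ) -
      (1 : 𝕂) • (bMode k * (bMode (m - 1 - j) * psiMode ι j)) =
      (bMode (m - 1 - j) * bMode k - bMode k * bMode (m - 1 - j)) * psiMode ι j := by
    rw [mul_assoc, ← bMode_psiMode, one_smul]
    noncomm_ring
  rw [e, bMode_bMode, ite_self, add_zero]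
  by_cases h : j = m + k
  · rw [if_pos (by omega), if_pos h, h, smul_mul_assoc]
    congr 1
    push_cast
    ring
  · rw [if_neg (by omega), if_neg h, zero_mul]

lemma bMode_psiMode_bracket_psiMode (m j k : ℤ) :
    (bMode (m - 1 - j) * psiMode ι j * psiMode ι k : Op 𝕂 ℕ+ Θ) -
      (-1 : 𝕂) • (psiMode ι k * (bMode (m - 1 - j) * psiMode ι j)) =
      (if j = -k - 1 then hbar * bMode (m + k) else 0) + if j = -k - 1 then 0 else 0 := by
  have e : (bMode (m - 1 - j) * psiMode ι j * psiMode ι k : Op 𝕂 ℕ+ Θ) -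
      (-1 : 𝕂) • (psiMode ι k * (bMode (m - 1 - j) * psiMode ι j)) =
      bMode (m - 1 - j) * (psiMode ι j * psiMode ι k + psiMode ι k * psiMode ι j) := by
    rw [← mul_assoc (psiMode ι k), ← bMode_psiMode, neg_one_smul]
    noncomm_ring
  rw [e, psiMode_psiMode, ite_self, add_zero]
  by_cases h : j = -k - 1
  · rw [if_pos (by omega), if_pos h, h, ← hbar_mul_bMode, show m - 1 - (-k - 1) = m + k by ring]
  · rw [if_neg (by omega), if_neg h, mul_zero]

lemma normalB_comm {A : Op 𝕂 ℕ+ Θ} (hA : ∀ k, bMode k * A = A * bMode k) (k l : ℤ) :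
    normalB k l * A = A * normalB k l := by
  rw [normalB]
  split_ifs
  · rw [mul_assoc, hA, ← mul_assoc, hA, mul_assoc]
  · rw [mul_assoc, hA, ← mul_assoc, hA, mul_assoc]

/-- Each odd mode picks up the factor `ε`, and a quadratic expression picks up its square. This
covers even modes (`ε = 1`) and foreign odd coordinates (`ε = -1`) at once. -/
lemma normalPsi_comm {A : Op 𝕂 ℕ+ Θ} {ε : 𝕂} (hε : ε * ε = 1)
    (hA : ∀ k, psiMode ι k * A = ε • (A * psiMode ι k)) (k l : ℤ) :
    normalPsi ι k l * A = A * normalPsi ι k l := by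
  have h : ∀ k l, psiMode ι k * psiMode ι l * A = A * (psiMode ι k * psiMode ι l) := by
    intro k l
    rw [mul_assoc, hA, mul_smul_comm, ← mul_assoc, hA, smul_mul_assoc, smul_smul, hε, one_smul,
      mul_assoc]
  rw [normalPsi]
  split_ifs
  · exact h k l
  · rw [neg_mul, h, mul_neg]

/-- The even modes, shifted by the constant that produces the linear terms of `H_i` and `F_i`. -/
def shiftedBMode (𝕂 : Type) [RCLike 𝕂] (Θ : Type) [LinearOrder Θ] (N : ℕ) (k : ℤ) : Op 𝕂 ℕ+ Θ :=
  bMode k + if k = N - 1 then 1 else 0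

variable (N : ℕ)

lemma bracket_shiftedBMode (A : Op 𝕂 ℕ+ Θ) (k : ℤ) :
    A * shiftedBMode 𝕂 Θ N k - shiftedBMode 𝕂 Θ N k * A = A * bMode k - bMode k * A := by
  rw [shiftedBMode]
  split_ifs
  · noncomm_ring
  · rw [add_zero]

/-- The linear term of `H_i` contributes `(i - 1/2) ħ` exactly when `k = -i`. That is when the
target index is `N - 1`, where the shifted mode contains the constant 1, and then `-(k + 1/2) = i -
1/2`. -/
lemma opH_bracket_shiftedBMode (i : ℕ+) (k : ℤ) :
    (opH N ι i * shiftedBMode 𝕂 Θ N k : Op 𝕂 ℕ+ Θ) - shiftedBMode 𝕂 Θ N k * opH N ι i =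
      -((k : 𝕂) + 1 / 2) • (hbar * shiftedBMode 𝕂 Θ N ((i : ℤ) + N - 1 + k)) := by
  have h1 := familySum_bracket_of_ite (pointwiseFinite_normalB (𝕂 := 𝕂) (Θ := Θ) ((i : ℤ) + N - 1)).familyFinite
    (raisesDegree_bMode k) 1 _ _ _ _ fun j => normalB_bracket_bMode _ j k
  have h2 := familySum_bracket_of_eq (pointwiseFinite_normalPsi (𝕂 := 𝕂) ι ((i : ℤ) + N - 1)).familyFinite
    (raisesDegree_bMode k) 1 fun j => by
      rw [one_smul, smul_mul_assoc, mul_smul_comm, normalPsi_comm ι (ε := 1) (one_mul 1)]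
      intro l
      rw [one_smul, bMode_psiMode]
  have h3 := bMode_bMode (𝕂 := 𝕂) (Θ := Θ) ((i : ℤ) - 1) k
  rw [one_smul] at h1 h2
  rw [bracket_shiftedBMode, opH, opSum_eq_familySum, opSum_eq_familySum, ← bMode_sub_one]
  have e : ∀ X Y Z B : Op 𝕂 ℕ+ Θ, (X + (1 / 2 : 𝕂) • Y + (1 / 2 : 𝕂) • Z) * B -
      B * (X + (1 / 2 : 𝕂) • Y + (1 / 2 : 𝕂) • Z) = (X * B - B * X) +
      (1 / 2 : 𝕂) • (Y * B - B * Y) + (1 / 2 : 𝕂) • (Z * B - B * Z) := by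
    intro X Y Z B
    simp only [add_mul, mul_add, smul_mul_assoc, mul_smul_comm]
    module
  rw [e, h1, h2, h3, sub_self, shiftedBMode]
  by_cases h : (i : ℤ) + k = 0
  · rw [if_pos (by omega), if_pos (by omega), show (k : 𝕂) = -(i : ℤ) by
      rw [← Int.cast_neg]; congr 1; omega]
    rw [mul_add, mul_one]
    push_cast
    module
  · rw [if_neg (by omega), if_neg (by omega), add_zero]
    module

lemma opH_bracket_psiMode (i : ℕ+) (k : ℤ) :
    (opH N ι i * psiMode ι k : Op 𝕂 ℕ+ Θ) - psiMode ι k * opH N ι i =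
      -((k : 𝕂) + 1 / 2 + (((i : ℤ) + N - 1 : ℤ) : 𝕂) / 2) •
        (hbar * psiMode ι ((i : ℤ) + N - 1 + k)) := by
  have h1 := familySum_bracket_of_eq (pointwiseFinite_normalB (𝕂 := 𝕂) (Θ := Θ) ((i : ℤ) + N - 1)).familyFinite
    (raisesDegree_psiMode ι k) 1 fun j => by
      rw [one_smul, normalB_comm]
      exact fun l => bMode_psiMode ι l k
  have h2 := familySum_bracket_of_ite (pointwiseFinite_normalPsi (𝕂 := 𝕂) ι ((i : ℤ) + N - 1)).familyFinite
    (raisesDegree_psiMode ι k) 1 _ _ _ _ fun j => normalPsi_bracket_psiMode ι _ j k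
  have h3 := bMode_psiMode (𝕂 := 𝕂) ι ((i : ℤ) - 1) k
  rw [one_smul] at h1 h2
  rw [opH, opSum_eq_familySum, opSum_eq_familySum, ← bMode_sub_one]
  have e : ∀ X Y Z B : Op 𝕂 ℕ+ Θ, (X + (1 / 2 : 𝕂) • Y + (1 / 2 : 𝕂) • Z) * B -
      B * (X + (1 / 2 : 𝕂) • Y + (1 / 2 : 𝕂) • Z) = (X * B - B * X) +
      (1 / 2 : 𝕂) • (Y * B - B * Y) + (1 / 2 : 𝕂) • (Z * B - B * Z) := by
    intro X Y Z B
    simp only [add_mul, mul_add, smul_mul_assoc, mul_smul_comm]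
    module
  rw [e, h1, h2, h3, sub_self, sub_self]
  module

lemma opF_bracket_shiftedBMode (i : ℕ+) (k : ℤ) :
    (opF N ι i * shiftedBMode 𝕂 Θ N k : Op 𝕂 ℕ+ Θ) - shiftedBMode 𝕂 Θ N k * opF N ι i =
      -((k : 𝕂) + 1 / 2) • (hbar * psiMode ι ((i : ℤ) + N - 1 + k)) := by
  have h1 := familySum_bracket_of_ite (pointwiseFinite_bMode_psiMode (𝕂 := 𝕂) ι ((i : ℤ) + N - 1)).familyFinite
    (raisesDegree_bMode k) 1 _ _ _ _ fun j => bMode_psiMode_bracket_bMode ι _ j k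
  have h3 := bMode_psiMode (𝕂 := 𝕂) ι k ((i : ℤ) - 1)
  rw [one_smul] at h1
  rw [bracket_shiftedBMode, opF, opSum_eq_familySum, ← psiMode_sub_one, add_mul, mul_add, h3,
    add_sub_add_left_eq_sub, h1, add_zero]

/-- The quadratic part gives the unshifted mode; the linear part gives ħ exactly when `i + k = 0`,
which supplies the shift. -/
lemma opF_bracket_psiMode (i : ℕ+) (k : ℤ) :
    (opF N ι i * psiMode ι k : Op 𝕂 ℕ+ Θ) + psiMode ι k * opF N ι i =
      hbar * shiftedBMode 𝕂 Θ N ((i : ℤ) + N - 1 + k) := by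
  have h1 := familySum_bracket_of_ite (pointwiseFinite_bMode_psiMode (𝕂 := 𝕂) ι ((i : ℤ) + N - 1)).familyFinite
    (raisesDegree_psiMode ι k) (-1) _ _ _ _ fun j => bMode_psiMode_bracket_psiMode ι _ j k
  have h3 := psiMode_psiMode (𝕂 := 𝕂) ι ((i : ℤ) - 1) k
  rw [neg_one_smul, sub_neg_eq_add, add_zero] at h1
  rw [opF, opSum_eq_familySum, ← psiMode_sub_one, add_mul, mul_add, add_add_add_comm, h1, h3,
    shiftedBMode, mul_add, add_comm]
  congr 1
  by_cases h : (i : ℤ) + k = 0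
  · rw [if_pos (by omega), if_pos (by omega), mul_one]
  · rw [if_neg (by omega), if_neg (by omega), mul_zero]

/-! ### General properties of the Virasoro operators -/

variable {U : Set (ℕ+ ⊕ Θ)}

lemma opH_mem_weylHat (hU : ∀ a, Sum.inl a ∈ U) (hU' : ∀ j, Sum.inr (ι j) ∈ U) (i : ℕ+) :
    opH N ι i ∈ weylHat 𝕂 U := by
  refine add_mem (add_mem (weylAlg_le_weylHat (hbarD_mem_weylAlg (hU i)))
    (Subalgebra.smul_mem _ ?_ _)) (Subalgebra.smul_mem _ ?_ _)
  · refine familySum_mem_weylHat (pointwiseFinite_normalB _).familyFinite fun k => ?_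
    rw [normalB]
    split_ifs
    · exact mul_mem (bMode_mem_weylHat hU _) (bMode_mem_weylHat hU _)
    · exact mul_mem (bMode_mem_weylHat hU _) (bMode_mem_weylHat hU _)
  · refine familySum_mem_weylHat (pointwiseFinite_normalPsi ι _).familyFinite fun k =>
      Subalgebra.smul_mem _ ?_ _
    rw [normalPsi]
    split_ifs
    · exact mul_mem (psiMode_mem_weylHat ι hU' _) (psiMode_mem_weylHat ι hU' _)
    · exact neg_mem (mul_mem (psiMode_mem_weylHat ι hU' _) (psiMode_mem_weylHat ι hU' _))

lemma opF_mem_weylHat (hU : ∀ a, Sum.inl a ∈ U) (hU' : ∀ j, Sum.inr (ι j) ∈ U) (i : ℕ+) :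
    opF N ι i ∈ weylHat 𝕂 U :=
  add_mem (weylAlg_le_weylHat (hbarD_mem_weylAlg (hU' i))) (familySum_mem_weylHat
    (pointwiseFinite_bMode_psiMode ι _).familyFinite fun _ => mul_mem (bMode_mem_weylHat hU _) (psiMode_mem_weylHat ι hU' _))

lemma isHomog_opH (i : ℕ+) : IsHomog false (opH N ι i : Op 𝕂 ℕ+ Θ) :=
  ((isHomog_hbarD (Sum.inl i)).add
    ((isHomog_familySum (pointwiseFinite_normalB _).familyFinite fun _ =>
      isHomog_normalB _ _).smul _)).add
    ((isHomog_familySum (pointwiseFinite_normalPsi ι _).familyFinite fun _ =>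
      (isHomog_normalPsi ι _ _).smul _).smul _)

lemma isHomog_opF (i : ℕ+) : IsHomog true (opF N ι i : Op 𝕂 ℕ+ Θ) :=
  (isHomog_hbarD (Sum.inr (ι i))).add
    (isHomog_familySum (pointwiseFinite_bMode_psiMode ι _).familyFinite fun _ =>
      (isHomog_bMode _).mul (isHomog_psiMode ι _))

/-- Odd coordinates outside the range of `ι`, such as `θ^0` in the first class, must be tested as
well before an operator can be shown to vanish. -/
lemma opH_mulCoord_inr (i : ℕ+) {t : Θ} (ht : t ∉ Set.range ι) :
    (opH N ι i * mulCoord (Sum.inr t) : Op 𝕂 ℕ+ Θ) = mulCoord (Sum.inr t) * opH N ι i := by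
  have hA : RaisesDegree 0 (mulCoord (Sum.inr t) : Op 𝕂 ℕ+ Θ) := fun _ _ => mulCoord_mem_degGE _
  have h1 := familySum_bracket_of_eq (pointwiseFinite_normalB (𝕂 := 𝕂) (Θ := Θ) ((i : ℤ) + N - 1)).familyFinite
    hA 1 fun j => by
      rw [one_smul, normalB_comm]
      exact fun l => bMode_mulCoord_inr l t
  have h2 := familySum_bracket_of_eq (pointwiseFinite_normalPsi (𝕂 := 𝕂) ι ((i : ℤ) + N - 1)).familyFinite
    hA 1 fun j => by
      rw [one_smul, smul_mul_assoc, mul_smul_comm, normalPsi_comm ι (ε := -1) (by norm_num)]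
      intro l
      rw [neg_one_smul, psiMode_mulCoord_inr ι l ht]
  rw [one_smul] at h1 h2
  rw [opH, opSum_eq_familySum, opSum_eq_familySum, ← bMode_sub_one]
  simp only [add_mul, mul_add, smul_mul_assoc, mul_smul_comm]
  rw [h1, h2, bMode_mulCoord_inr]

lemma opF_mulCoord_inr (i : ℕ+) {t : Θ} (ht : t ∉ Set.range ι) :
    (opF N ι i * mulCoord (Sum.inr t) : Op 𝕂 ℕ+ Θ) = -(mulCoord (Sum.inr t) * opF N ι i) := by
  have hA : RaisesDegree 0 (mulCoord (Sum.inr t) : Op 𝕂 ℕ+ Θ) := fun _ _ => mulCoord_mem_degGE _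
  have h1 := familySum_bracket_of_eq (pointwiseFinite_bMode_psiMode (𝕂 := 𝕂) ι ((i : ℤ) + N - 1)).familyFinite
    hA (-1) fun j => by
      rw [mul_assoc, psiMode_mulCoord_inr ι j ht, mul_neg, ← mul_assoc, bMode_mulCoord_inr,
        neg_one_smul, mul_assoc]
  rw [opF, opSum_eq_familySum, ← psiMode_sub_one, add_mul, h1, psiMode_mulCoord_inr ι _ ht,
    mul_add, neg_one_smul, neg_add]

/-! Positive modes, and hence the Virasoro operators, annihilate `1`. -/

lemma hbarD_one (a : ℕ+ ⊕ Θ) : (hbarD a : Op 𝕂 ℕ+ Θ) (monomial 𝕂 (0, ∅, 0)) = 0 := by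
  classical
  refine Subtype.ext (funext fun ⟨m, S, k⟩ => ?_)
  rcases a with a | a
  · have h : (monomial 𝕂 ((0, ∅, 0) : Mon ℕ+ Θ)).1 (m + Finsupp.single a 1, S, k - 1) = 0 := by
      rw [monomial_apply, if_neg (by simp)]
    rw [hbarD, Module.End.mul_apply, Sum.elim_inl, hbar_apply, dX_apply, h]
    simp
  · have h : (monomial 𝕂 ((0, ∅, 0) : Mon ℕ+ Θ)).1 (m, insert a S, k - 1) = 0 := by
      rw [monomial_apply, if_neg (by simp)]
    rw [hbarD, Module.End.mul_apply, Sum.elim_inr, hbar_apply, dTheta_apply, h]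
    simp

lemma bMode_one {k : ℤ} (hk : 0 ≤ k) : (bMode k : Op 𝕂 ℕ+ Θ) (monomial 𝕂 (0, ∅, 0)) = 0 := by
  rcases k with j | j
  · exact hbarD_one _
  · exact absurd hk (by simp)

lemma psiMode_one {k : ℤ} (hk : 0 ≤ k) :
    (psiMode ι k : Op 𝕂 ℕ+ Θ) (monomial 𝕂 (0, ∅, 0)) = 0 := by
  rcases k with j | j
  · exact hbarD_one _
  · exact absurd hk (by simp)

/-- The two indices in a summand add up to `i + N - 2 ≥ -1`, so at least one is nonnegative. Normal
ordering puts such a mode on the right, where it kills 1. -/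
lemma opH_one (i : ℕ+) : (opH N ι i : Op 𝕂 ℕ+ Θ) (monomial 𝕂 (0, ∅, 0)) = 0 := by
  have hi := i.pos
  rw [opH, opSum_eq_familySum, opSum_eq_familySum, LinearMap.add_apply, LinearMap.add_apply,
    LinearMap.smul_apply, LinearMap.smul_apply, hbarD_one, familySum_apply_eq_zero,
    familySum_apply_eq_zero]
  · simp
  · intro k
    rw [LinearMap.smul_apply, normalPsi]
    split_ifs
    · rw [Module.End.mul_apply, psiMode_one ι (by omega), map_zero, smul_zero]
    · rw [LinearMap.neg_apply, Module.End.mul_apply, psiMode_one ι (by omega), map_zero, neg_zero,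
        smul_zero]
  · intro k
    rw [normalB]
    split_ifs
    · rw [Module.End.mul_apply, bMode_one (by omega), map_zero]
    · rw [Module.End.mul_apply, bMode_one (by omega), map_zero]

lemma opF_one (i : ℕ+) : (opF N ι i : Op 𝕂 ℕ+ Θ) (monomial 𝕂 (0, ∅, 0)) = 0 := by
  have hi := i.pos
  rw [opF, opSum_eq_familySum, LinearMap.add_apply, hbarD_one, familySum_apply_eq_zero, add_zero]
  intro k
  by_cases hk : 0 ≤ k
  · rw [Module.End.mul_apply, psiMode_one ι hk, map_zero]
  · rw [bMode_psiMode, Module.End.mul_apply, bMode_one (by omega), map_zero]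

end ModeBrackets

/-! ### The Ramond relations -/

section Ramond

variable {𝕂 : Type} [RCLike 𝕂] {Θ : Type} [LinearOrder Θ] (ι : ℕ+ ↪ Θ) (N : ℕ)

/-- Up to non-zero scalars the negative modes are the coordinates in question. Shifted modes may be
used since the shift is a constant and drops out of commutators. -/
lemma op_eq_zero_of_bracket_modes {T : Op 𝕂 ℕ+ Θ} (hT : T ∈ weylHat 𝕂 (Set.univ : Set (ℕ+ ⊕ Θ)))
    (h1 : T (monomial 𝕂 (0, ∅, 0)) = 0) (ε : 𝕂)
    (hB : ∀ k, T * shiftedBMode 𝕂 Θ N k - shiftedBMode 𝕂 Θ N k * T = 0)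
    (hψ : ∀ k, T * psiMode ι k = ε • (psiMode ι k * T))
    (hθ : ∀ t ∉ Set.range ι, T * mulCoord (Sum.inr t) = ε • (mulCoord (Sum.inr t) * T)) :
    T = 0 := by
  refine op_eq_zero_of_comm (raisesDegree_of_mem_weylHat hT) h1 (hbar_comm hT).symm fun a => ?_
  rcases a with a | t
  · refine ⟨1, ?_⟩
    obtain ⟨j, rfl⟩ : ∃ j : ℕ, a = j.succPNat := ⟨a.natPred, by simp⟩
    have h := hB (Int.negSucc j)
    rw [bracket_shiftedBMode, bMode, mul_smul_comm, smul_mul_assoc, ← smul_sub] at h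
    have hj : (j : 𝕂) + 1 / 2 ≠ 0 := by
      have : ((2 * j + 1 : ℕ) : 𝕂) ≠ 0 := Nat.cast_ne_zero.2 (by omega)
      intro h0
      apply this
      push_cast
      linear_combination 2 * h0
    rw [one_smul, ← sub_eq_zero]
    exact (smul_eq_zero.1 h).resolve_left hj
  · refine ⟨ε, ?_⟩
    by_cases ht : t ∈ Set.range ι
    · obtain ⟨a, rfl⟩ := ht
      obtain ⟨j, rfl⟩ : ∃ j : ℕ, a = j.succPNat := ⟨a.natPred, by simp⟩
      exact hψ (Int.negSucc j)
    · exact hθ t ht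

variable {ι N}

lemma opH_mem (i : ℕ+) : opH N ι i ∈ weylHat 𝕂 (Set.univ : Set (ℕ+ ⊕ Θ)) :=
  opH_mem_weylHat ι N (fun _ => Set.mem_univ _) (fun _ => Set.mem_univ _) i

lemma opF_mem (i : ℕ+) : opF N ι i ∈ weylHat 𝕂 (Set.univ : Set (ℕ+ ⊕ Θ)) :=
  opF_mem_weylHat ι N (fun _ => Set.mem_univ _) (fun _ => Set.mem_univ _) i

lemma mul_smul_hbar_sub {A : Op 𝕂 ℕ+ Θ} (hA : A ∈ weylHat 𝕂 (Set.univ : Set (ℕ+ ⊕ Θ))) (c : 𝕂)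
    (X : Op 𝕂 ℕ+ Θ) :
    A * (c • (hbar * X)) - c • (hbar * X) * A = c • (hbar * (A * X - X * A)) := by
  rw [mul_smul_comm, smul_mul_assoc, ← smul_sub, ← mul_assoc, ← hbar_comm hA]
  simp only [mul_assoc, mul_sub]

lemma mul_smul_hbar_add {A : Op 𝕂 ℕ+ Θ} (hA : A ∈ weylHat 𝕂 (Set.univ : Set (ℕ+ ⊕ Θ))) (c : 𝕂)
    (X : Op 𝕂 ℕ+ Θ) :
    A * (c • (hbar * X)) + c • (hbar * X) * A = c • (hbar * (A * X + X * A)) := by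
  rw [mul_smul_comm, smul_mul_assoc, ← smul_add, ← mul_assoc, ← hbar_comm hA]
  simp only [mul_assoc, mul_add]

-- The explicit scalar lets `mul_smul_hbar_sub` and `mul_smul_hbar_add` rewrite the iterated
-- bracket.
variable (ι N) in
lemma opF_bracket_psiMode' (i : ℕ+) (k : ℤ) :
    (opF N ι i * psiMode ι k : Op 𝕂 ℕ+ Θ) + psiMode ι k * opF N ι i =
      (1 : 𝕂) • (hbar * shiftedBMode 𝕂 Θ N ((i : ℤ) + N - 1 + k)) := by
  rw [opF_bracket_psiMode, one_smul]

/-! ### Super-Jacobi identities for the defect of a bracket relation. -/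

section Jacobi

variable {R : Type*} [Ring R] [Algebra 𝕂 R] (c : 𝕂) (A B C X h : R)

/-- The right hand side contains only brackets of `A`, `B`, `C` with `X`, all known when `X` is a
mode. The variants below differ in the parities of `A`, `B` and `X`. -/
lemma jacobi_even (hX : h * X = X * h) :
    (A * B - B * A - c • (h * C)) * X - X * (A * B - B * A - c • (h * C)) =
      (A * (B * X - X * B) - (B * X - X * B) * A) - (B * (A * X - X * A) - (A * X - X * A) * B) -
        c • (h * (C * X - X * C)) := by
  have e : X * (h * C) = h * (X * C) := by rw [← mul_assoc, ← hX, mul_assoc]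
  simp only [sub_mul, mul_sub, smul_mul_assoc, mul_smul_comm, smul_sub, e]
  simp only [mul_assoc]
  abel

lemma jacobi_odd (hX : h * X = X * h) :
    (A * B - B * A - c • (h * C)) * X + X * (A * B - B * A - c • (h * C)) =
      (A * (B * X + X * B) - (B * X + X * B) * A) - (B * (A * X - X * A) + (A * X - X * A) * B) -
        c • (h * (C * X + X * C)) := by
  have e : X * (h * C) = h * (X * C) := by rw [← mul_assoc, ← hX, mul_assoc]
  simp only [sub_mul, mul_sub, add_mul, mul_add, smul_mul_assoc, mul_smul_comm, smul_add, e]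
  simp only [mul_assoc]
  abel

lemma jacobi_odd_odd_even (hX : h * X = X * h) :
    (A * B + B * A - c • (h * C)) * X - X * (A * B + B * A - c • (h * C)) =
      (A * (B * X - X * B) + (B * X - X * B) * A) + (B * (A * X - X * A) + (A * X - X * A) * B) -
        c • (h * (C * X - X * C)) := by
  have e : X * (h * C) = h * (X * C) := by rw [← mul_assoc, ← hX, mul_assoc]
  simp only [sub_mul, mul_sub, add_mul, mul_add, smul_mul_assoc, mul_smul_comm, smul_sub, e]
  simp only [mul_assoc]
  abel

lemma jacobi_odd_odd_odd (hX : h * X = X * h) :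
    (A * B + B * A - c • (h * C)) * X - X * (A * B + B * A - c • (h * C)) =
      (A * (B * X + X * B) - (B * X + X * B) * A) + (B * (A * X + X * A) - (A * X + X * A) * B) -
        c • (h * (C * X - X * C)) := by
  have e : X * (h * C) = h * (X * C) := by rw [← mul_assoc, ← hX, mul_assoc]
  simp only [sub_mul, mul_sub, add_mul, mul_add, smul_mul_assoc, mul_smul_comm, smul_sub, e]
  simp only [mul_assoc]
  abel

/-- Meant for an extra odd coordinate `X`, which passes each operator at the cost of a sign; `σ`
selects commutator or anticommutator. -/
lemma extra_even {ε δ : 𝕂} (hX : h * X = X * h) (hA : A * X = ε • (X * A))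
    (hB : B * X = δ • (X * B)) (hC : C * X = (ε * δ) • (X * C)) (σ : 𝕂) :
    (A * B + σ • (B * A) - c • (h * C)) * X =
      (ε * δ) • (X * (A * B + σ • (B * A) - c • (h * C))) := by
  have e : X * (h * C) = h * (X * C) := by rw [← mul_assoc, ← hX, mul_assoc]
  simp only [sub_mul, add_mul, smul_mul_assoc, mul_assoc, hA, hB, hC, mul_smul_comm]
  simp only [← mul_assoc, hA, hB, mul_sub, mul_add, smul_mul_assoc, mul_smul_comm]
  simp only [mul_assoc, e]
  module

end Jacobi

lemma hbar_mul_shiftedBMode (k : ℤ) :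
    (hbar * shiftedBMode 𝕂 Θ N k : Op 𝕂 ℕ+ Θ) = shiftedBMode 𝕂 Θ N k * hbar := by
  have := bracket_shiftedBMode (𝕂 := 𝕂) (Θ := Θ) N hbar k
  rwa [hbar_mul_bMode, sub_self, sub_eq_zero] at this

lemma opH_opH_bracket (m n l : ℕ+) (hl : (l : ℤ) = m + n + N - 1) :
    (opH N ι m * opH N ι n : Op 𝕂 ℕ+ Θ) - opH N ι n * opH N ι m =
      ((m : 𝕂) - n) • (hbar * opH N ι l) := by
  have hl' : ((l : ℕ) : 𝕂) = m + n + N - 1 := by exact_mod_cast congrArg (Int.cast (R := 𝕂)) hl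
  rw [← sub_eq_zero]
  refine op_eq_zero_of_bracket_modes ι N ?_ ?_ 1 (fun k => ?_) (fun k => ?_) (fun t ht => ?_)
  · exact sub_mem (sub_mem (mul_mem (opH_mem m) (opH_mem n)) (mul_mem (opH_mem n) (opH_mem m)))
      (Subalgebra.smul_mem _ (mul_mem hbar_mem_weylHat (opH_mem l)) _)
  · simp [opH_one]
  · rw [jacobi_even _ _ _ _ _ _ (hbar_mul_shiftedBMode k)]
    simp only [opH_bracket_shiftedBMode, mul_smul_hbar_sub (opH_mem m),
      mul_smul_hbar_sub (opH_mem n)]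
    -- Both iterated brackets and the bracket with `H_l` land on the same mode, which leaves a
    -- scalar identity in `m`, `n`, `k`, `N`.
    rw [show (m : ℤ) + N - 1 + ((n : ℤ) + N - 1 + k) = l + N - 1 + k by omega,
      show (n : ℤ) + N - 1 + ((m : ℤ) + N - 1 + k) = l + N - 1 + k by omega]
    simp only [mul_smul_comm]
    push_cast
    module
  · rw [one_smul, ← sub_eq_zero, jacobi_even _ _ _ _ _ _ (hbar_mul_psiMode ι k)]
    simp only [opH_bracket_psiMode, mul_smul_hbar_sub (opH_mem m), mul_smul_hbar_sub (opH_mem n)]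
    rw [show (m : ℤ) + N - 1 + ((n : ℤ) + N - 1 + k) = l + N - 1 + k by omega,
      show (n : ℤ) + N - 1 + ((m : ℤ) + N - 1 + k) = l + N - 1 + k by omega]
    simp only [mul_smul_comm]
    push_cast
    rw [hl']
    module
  · have h := fun i => opH_mulCoord_inr (𝕂 := 𝕂) ι N i ht
    have := extra_even ((m : 𝕂) - n) (opH N ι m) (opH N ι n) (opH N ι l) _ hbar (ε := 1) (δ := 1)
      (hbar_mul_mulCoord (Sum.inr t)) (by rw [h, one_smul]) (by rw [h, one_smul])
      (by rw [h, mul_one, one_smul]) (-1)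
    rwa [neg_one_smul, ← sub_eq_add_neg, mul_one] at this

lemma opH_opF_bracket (m n l : ℕ+) (hl : (l : ℤ) = m + n + N - 1) :
    (opH N ι m * opF N ι n : Op 𝕂 ℕ+ Θ) - opF N ι n * opH N ι m =
      (((m : 𝕂) - N + 1) / 2 - n) • (hbar * opF N ι l) := by
  rw [← sub_eq_zero]
  refine op_eq_zero_of_bracket_modes ι N ?_ ?_ (-1) (fun k => ?_) (fun k => ?_) (fun t ht => ?_)
  · exact sub_mem (sub_mem (mul_mem (opH_mem m) (opF_mem n)) (mul_mem (opF_mem n) (opH_mem m)))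
      (Subalgebra.smul_mem _ (mul_mem hbar_mem_weylHat (opF_mem l)) _)
  · simp [opH_one, opF_one]
  · rw [jacobi_even _ _ _ _ _ _ (hbar_mul_shiftedBMode k)]
    simp only [opH_bracket_shiftedBMode, opF_bracket_shiftedBMode, opH_bracket_psiMode,
      mul_smul_hbar_sub (opH_mem m), mul_smul_hbar_sub (opF_mem n)]
    rw [show (m : ℤ) + N - 1 + ((n : ℤ) + N - 1 + k) = l + N - 1 + k by omega,
      show (n : ℤ) + N - 1 + ((m : ℤ) + N - 1 + k) = l + N - 1 + k by omega]
    simp only [mul_smul_comm]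
    push_cast
    module
  · rw [neg_one_smul, ← sub_eq_zero, sub_neg_eq_add,
      jacobi_odd _ _ _ _ _ _ (hbar_mul_psiMode ι k)]
    simp only [opH_bracket_psiMode, opF_bracket_psiMode', opH_bracket_shiftedBMode,
      mul_smul_hbar_sub (opH_mem m), mul_smul_hbar_add (opF_mem n)]
    rw [show (m : ℤ) + N - 1 + ((n : ℤ) + N - 1 + k) = l + N - 1 + k by omega,
      show (n : ℤ) + N - 1 + ((m : ℤ) + N - 1 + k) = l + N - 1 + k by omega]
    simp only [mul_smul_comm]
    push_cast
    module
  · have h := fun i => opH_mulCoord_inr (𝕂 := 𝕂) ι N i ht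
    have h' := fun i => opF_mulCoord_inr (𝕂 := 𝕂) ι N i ht
    have := extra_even (((m : 𝕂) - N + 1) / 2 - n) (opH N ι m) (opF N ι n) (opF N ι l) _ hbar
      (ε := 1) (δ := -1)
      (hbar_mul_mulCoord (Sum.inr t)) (by rw [h, one_smul]) (by rw [h', neg_one_smul])
      (by rw [h', one_mul, neg_one_smul]) (-1)
    rwa [neg_one_smul, ← sub_eq_add_neg, one_mul] at this

lemma opF_opF_bracket (m n l : ℕ+) (hl : (l : ℤ) = m + n + N - 1) :
    (opF N ι m * opF N ι n : Op 𝕂 ℕ+ Θ) + opF N ι n * opF N ι m =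
      (2 : 𝕂) • (hbar * opH N ι l) := by
  have hl' : ((l : ℕ) : 𝕂) = m + n + N - 1 := by exact_mod_cast congrArg (Int.cast (R := 𝕂)) hl
  rw [← sub_eq_zero]
  refine op_eq_zero_of_bracket_modes ι N ?_ ?_ 1 (fun k => ?_) (fun k => ?_) (fun t ht => ?_)
  · exact sub_mem (add_mem (mul_mem (opF_mem m) (opF_mem n)) (mul_mem (opF_mem n) (opF_mem m)))
      (Subalgebra.smul_mem _ (mul_mem hbar_mem_weylHat (opH_mem l)) _)
  · simp [opH_one, opF_one]
  · rw [jacobi_odd_odd_even _ _ _ _ _ _ (hbar_mul_shiftedBMode k)]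
    simp only [opH_bracket_shiftedBMode, opF_bracket_shiftedBMode, opF_bracket_psiMode',
      mul_smul_hbar_add (opF_mem m), mul_smul_hbar_add (opF_mem n)]
    rw [show (m : ℤ) + N - 1 + ((n : ℤ) + N - 1 + k) = l + N - 1 + k by omega,
      show (n : ℤ) + N - 1 + ((m : ℤ) + N - 1 + k) = l + N - 1 + k by omega]
    simp only [mul_smul_comm]
    module
  · rw [one_smul, ← sub_eq_zero, jacobi_odd_odd_odd _ _ _ _ _ _ (hbar_mul_psiMode ι k)]
    simp only [opH_bracket_psiMode, opF_bracket_psiMode', opF_bracket_shiftedBMode,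
      mul_smul_hbar_sub (opF_mem m), mul_smul_hbar_sub (opF_mem n)]
    rw [show (m : ℤ) + N - 1 + ((n : ℤ) + N - 1 + k) = l + N - 1 + k by omega,
      show (n : ℤ) + N - 1 + ((m : ℤ) + N - 1 + k) = l + N - 1 + k by omega]
    simp only [mul_smul_comm]
    push_cast
    rw [hl']
    module
  · have h := fun i => opH_mulCoord_inr (𝕂 := 𝕂) ι N i ht
    have h' := fun i => opF_mulCoord_inr (𝕂 := 𝕂) ι N i ht
    have := extra_even (2 : 𝕂) (opF N ι m) (opF N ι n) (opH N ι l) _ hbar (ε := -1) (δ := -1)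
      (hbar_mul_mulCoord (Sum.inr t)) (by rw [h', neg_one_smul]) (by rw [h', neg_one_smul])
      (by rw [h]; simp) 1
    simpa using this

theorem ramondRelations_opH :
    RamondRelations (𝕂 := 𝕂) N 1 (opH N ι) (opF N ι) where
  even_even := opH_opH_bracket
  even_odd m n l _ hl := opH_opF_bracket m n l hl
  odd_odd m n l _ _ hl := opF_opF_bracket m n l hl

/-- Adding central terms `ħ D_i`, `i ≤ R`, does not affect the relations, as long as the indices
`l ≤ R` do not occur on the right hand sides. -/
theorem ramondRelations_opHD {R : ℕ} {j₀ : ℕ+} (D : ℕ+ → 𝕂)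
    (h1 : ∀ m n l : ℕ+, (l : ℤ) = m + n + N - 1 → m ≠ n → R < (l : ℕ))
    (h2 : ∀ m n l : ℕ+, j₀ ≤ m → j₀ ≤ n → (l : ℤ) = m + n + N - 1 → R < (l : ℕ)) :
    RamondRelations N j₀ (opHD N ι R D) (opF N ι) := by
  have hD : ∀ i, ∃ d : 𝕂, (opHD N ι R D i : Op 𝕂 ℕ+ Θ) = opH N ι i + d • hbar := fun i => by
    rw [opHD]
    split_ifs
    · exact ⟨_, rfl⟩
    · exact ⟨0, by rw [zero_smul]⟩
  have hD' : ∀ i : ℕ+, R < (i : ℕ) → (opHD N ι R D i : Op 𝕂 ℕ+ Θ) = opH N ι i := fun i hi => by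
    rw [opHD, if_neg (by omega), add_zero]
  have hc : ∀ (A B : Op 𝕂 ℕ+ Θ), B ∈ weylHat 𝕂 (Set.univ : Set (ℕ+ ⊕ Θ)) → ∀ d : 𝕂,
      (A + d • hbar) * B - B * (A + d • hbar) = A * B - B * A := fun A B hB d => by
    rw [add_mul, mul_add, smul_mul_assoc, mul_smul_comm, hbar_comm hB, add_sub_add_right_eq_sub]
  refine ⟨fun m n l hl => ?_, fun m n l _ hl => ?_, fun m n l hm hn hl => ?_⟩
  · obtain ⟨d, hd⟩ := hD m
    obtain ⟨d', hd'⟩ := hD n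
    rw [hd, hd', hc _ _ (add_mem (opH_mem n) (Subalgebra.smul_mem _ hbar_mem_weylHat _)),
      ← neg_sub, hc _ _ (opH_mem m), neg_sub, opH_opH_bracket m n l hl]
    rcases eq_or_ne m n with rfl | h
    -- For `m = n` the coefficient `m - n` is zero, so nothing is needed about `l`; hence `h1` asks
    -- only for distinct indices.
    · simp
    · rw [hD' l (h1 m n l hl h)]
  · obtain ⟨d, hd⟩ := hD m
    rw [hd, hc _ _ (opF_mem n), opH_opF_bracket m n l hl]
  · rw [opF_opF_bracket m n l hl, hD' l (h2 m n l hm hn hl)]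

end Ramond

end Operators

/-! ### Super quantum Airy structures from structure constants -/

section AiryMap

variable {𝕂 : Type} [RCLike 𝕂] {E Θ : Type} {o : Θ}

/-- The value of a functional on a basis vector. -/
abbrev dualCoeff (φ : Module.Dual 𝕂 (VSpace 𝕂 E o)) (j : E ⊕ {t : Θ // t ≠ o}) : 𝕂 :=
  φ (Finsupp.single j 1)

lemma dual_ext {φ ψ : Module.Dual 𝕂 (VSpace 𝕂 E o)} (h : ∀ j, dualCoeff φ j = dualCoeff ψ j) :
    φ = ψ :=
  Finsupp.lhom_ext' fun j => LinearMap.ext_ring (h j)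

/-- The functional with given values on the basis. -/
def dualOfCoeff (v : E ⊕ {t : Θ // t ≠ o} → 𝕂) : Module.Dual 𝕂 (VSpace 𝕂 E o) :=
  Finsupp.linearCombination 𝕂 v

lemma dualCoeff_dualOfCoeff (v : E ⊕ {t : Θ // t ≠ o} → 𝕂) (j) :
    dualCoeff (dualOfCoeff v) j = v j := by
  simp [dualCoeff, dualOfCoeff]

lemma dualCoeff_dualVec (i j : E ⊕ {t : Θ // t ≠ o}) [Decidable (j = i)] :
    dualCoeff (dualVec i : Module.Dual 𝕂 (VSpace 𝕂 E o)) j = if j = i then 1 else 0 := by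
  classical
  rw [dualCoeff, dualVec, Finsupp.lapply_apply, Finsupp.single_apply]

lemma dualCoeff_add (φ ψ : Module.Dual 𝕂 (VSpace 𝕂 E o)) (j) :
    dualCoeff (φ + ψ) j = dualCoeff φ j + dualCoeff ψ j := rfl

lemma dualCoeff_smul (c : 𝕂) (φ : Module.Dual 𝕂 (VSpace 𝕂 E o)) (j) :
    dualCoeff (c • φ) j = c * dualCoeff φ j := rfl

/-- Continuity for the topologies of pointwise convergence. -/
def IsContinuousOp (M : Module.Dual 𝕂 (VSpace 𝕂 E o) →ₗ[𝕂] Op 𝕂 E Θ) : Prop :=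
  ∀ (f : Series 𝕂 E Θ) (n : ℕ), ∃ J : Finset (E ⊕ {t : Θ // t ≠ o}),
    ∀ φ : Module.Dual 𝕂 (VSpace 𝕂 E o), (∀ j ∈ J, dualCoeff φ j = 0) → M φ f ∈ degGE 𝕂 E Θ n

lemma IsContinuousOp.exists_finset {M : Module.Dual 𝕂 (VSpace 𝕂 E o) →ₗ[𝕂] Op 𝕂 E Θ}
    (h : IsContinuousOp M) (s : Finset (Series 𝕂 E Θ)) (n : ℕ) :
    ∃ J : Finset (E ⊕ {t : Θ // t ≠ o}), ∀ φ : Module.Dual 𝕂 (VSpace 𝕂 E o),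
      (∀ j ∈ J, dualCoeff φ j = 0) → ∀ f ∈ s, M φ f ∈ degGE 𝕂 E Θ n := by
  classical
  choose J hJ using fun f => h f n
  exact ⟨s.biUnion J, fun φ hφ f hf =>
    hJ f φ fun j hj => hφ j (Finset.mem_biUnion.2 ⟨f, hf, hj⟩)⟩

/-- A continuous linear map is determined by its values on the dual basis. -/
lemma IsContinuousOp.eq_of_dualVec {M M' : Module.Dual 𝕂 (VSpace 𝕂 E o) →ₗ[𝕂] Op 𝕂 E Θ}
    (h : IsContinuousOp M) (h' : IsContinuousOp M')
    (h0 : ∀ j, M (dualVec j) = M' (dualVec j)) (φ : Module.Dual 𝕂 (VSpace 𝕂 E o)) :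
    M φ = M' φ := by
  classical
  refine op_eq_of_forall_sub_mem fun f n => ?_
  obtain ⟨J, hJ⟩ := h f n
  obtain ⟨J', hJ'⟩ := h' f n
  -- A finite truncation of `φ`: both maps agree on it, and continuity makes both negligible on the
  -- remainder.
  let ψ : Module.Dual 𝕂 (VSpace 𝕂 E o) := ∑ j ∈ J ∪ J', dualCoeff φ j • dualVec j
  have hψ : ∀ i ∈ J ∪ J', dualCoeff (φ - ψ) i = 0 := fun i hi => by
    have h2 : ∀ j, (dualVec j : Module.Dual 𝕂 (VSpace 𝕂 E o)) (Finsupp.single i 1) =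
        if i = j then 1 else 0 := fun j => dualCoeff_dualVec j i
    simp only [ψ, dualCoeff, LinearMap.sub_apply, LinearMap.sum_apply, LinearMap.smul_apply, h2,
      smul_eq_mul, mul_ite, mul_one, mul_zero, Finset.sum_ite_eq, if_pos hi, sub_self]
  have e : M ψ = M' ψ := by
    simp only [ψ, map_sum, map_smul, h0]
  have h1 := sub_mem (hJ _ fun i hi => hψ i (Finset.mem_union_left _ hi))
    (hJ' _ fun i hi => hψ i (Finset.mem_union_right _ hi))
  have h2 : ∀ M : Module.Dual 𝕂 (VSpace 𝕂 E o) →ₗ[𝕂] Op 𝕂 E Θ,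
      M φ f = M (φ - ψ) f + M ψ f := fun M => by
    rw [← LinearMap.add_apply, ← map_add, sub_add_cancel]
  rwa [h2 M, h2 M', e, add_sub_add_right_eq_sub]

/-- The continuous linear map with given values on the dual basis. -/
def airyOp (T : E ⊕ {t : Θ // t ≠ o} → Op 𝕂 E Θ) (hT : FamilyFinite T) :
    Module.Dual 𝕂 (VSpace 𝕂 E o) →ₗ[𝕂] Op 𝕂 E Θ :=
  have hs : ∀ φ : Module.Dual 𝕂 (VSpace 𝕂 E o), FamilyFinite fun j => dualCoeff φ j • T j :=
    fun φ f n => (hT f n).subset fun _ hj h => hj (Submodule.smul_mem _ _ h)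
  { toFun φ := familySum (fun j => dualCoeff φ j • T j) (hs φ)
    map_add' φ ψ := by
      refine op_ext fun f M => ?_
      refine Eq.trans (finsum_congr fun j => ?_)
        (finsum_add_distrib ((hs φ).support f M) ((hs ψ).support f M))
      simp only [dualCoeff, LinearMap.add_apply, add_smul]
      rfl
    map_smul' c φ := by
      refine op_ext fun f M => ?_
      refine Eq.trans (finsum_congr fun j => ?_) (mul_finsum' _ _ ((hs φ).support f M)).symm
      simp only [dualCoeff, LinearMap.smul_apply, smul_assoc]
      rfl }

variable {T : E ⊕ {t : Θ // t ≠ o} → Op 𝕂 E Θ} (hT : FamilyFinite T)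

lemma airyOp_apply (φ : Module.Dual 𝕂 (VSpace 𝕂 E o)) :
    ∃ h, airyOp T hT φ = familySum (fun j => dualCoeff φ j • T j) h :=
  ⟨fun f n => (hT f n).subset fun _ hj h => hj (Submodule.smul_mem _ _ h), rfl⟩

lemma airyOp_dualVec (i : E ⊕ {t : Θ // t ≠ o}) : airyOp T hT (dualVec i) = T i := by
  classical
  obtain ⟨h, e⟩ := airyOp_apply hT (dualVec i)
  rw [e]
  refine op_ext fun f M => ?_
  refine (finsum_eq_single _ i fun j hj => ?_).trans ?_
  · beta_reduce
    rw [dualCoeff_dualVec, if_neg hj, zero_smul]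
    rfl
  · beta_reduce
    rw [dualCoeff_dualVec, if_pos rfl, one_smul]

lemma isContinuousOp_airyOp : IsContinuousOp (airyOp T hT) := by
  intro f n
  refine ⟨(hT f n).toFinset, fun φ hφ => ?_⟩
  obtain ⟨h, e⟩ := airyOp_apply hT φ
  rw [e]
  refine familySum_apply_mem h fun j => ?_
  by_cases hj : T j f ∈ degGE 𝕂 E Θ n
  · exact Submodule.smul_mem _ _ hj
  · rw [hφ j ((hT f n).mem_toFinset.2 hj), zero_smul]
    exact zero_mem _

lemma isHomog_airyOp {p : Bool} (φ : Module.Dual 𝕂 (VSpace 𝕂 E o))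
    (h : ∀ j, dualCoeff φ j = 0 ∨ IsHomog p (T j)) : IsHomog p (airyOp T hT φ) := by
  obtain ⟨h', e⟩ := airyOp_apply hT φ
  rw [e]
  refine isHomog_familySum h' fun j => ?_
  rcases h j with h | h
  · rw [h, zero_smul]
    exact IsHomog.zero
  · exact h.smul _

/-- Left multiplication by `ħ`. -/
def hbarLeft : Op 𝕂 E Θ →ₗ[𝕂] Op 𝕂 E Θ where
  toFun A := hbar * A
  map_add' := mul_add _
  map_smul' c A := mul_smul_comm c _ A

/-- The super-commutator with a fixed operator on the right. -/
def superCommRight (B : Op 𝕂 E Θ) : Op 𝕂 E Θ →ₗ[𝕂] Op 𝕂 E Θ where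
  toFun A := superComm A B
  map_add' A A' := superComm_add_left A A' B
  map_smul' c A := superComm_smul_left c A B

/-- The super-commutator with a fixed operator on the left. -/
def superCommLeft (A : Op 𝕂 E Θ) : Op 𝕂 E Θ →ₗ[𝕂] Op 𝕂 E Θ where
  toFun B := superComm A B
  map_add' B B' := superComm_add_right A B B'
  map_smul' c B := superComm_smul_right c A B

lemma hbarLeft_apply (A : Op 𝕂 E Θ) : hbarLeft A = hbar * A := rfl

lemma superCommRight_apply (A B : Op 𝕂 E Θ) : superCommRight B A = superComm A B := rfl

lemma superCommLeft_apply (A B : Op 𝕂 E Θ) : superCommLeft A B = superComm A B := rfl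

variable {M : Module.Dual 𝕂 (VSpace 𝕂 E o) →ₗ[𝕂] Op 𝕂 E Θ}

lemma IsContinuousOp.superCommRight (h : IsContinuousOp M) {B : Op 𝕂 E Θ}
    (hB : RaisesDegree 0 B) : IsContinuousOp (superCommRight B ∘ₗ M) := by
  classical
  intro f n
  obtain ⟨J, hJ⟩ := h.exists_finset {B f, f, parity f} n
  refine ⟨J, fun φ hφ => ?_⟩
  have h1 := hJ φ hφ
  exact superComm_apply_mem_left hB (h1 _ (by simp)) (h1 _ (by simp)) (h1 _ (by simp))

lemma IsContinuousOp.superCommLeft (h : IsContinuousOp M) {A : Op 𝕂 E Θ}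
    (hA : RaisesDegree 0 A) : IsContinuousOp (superCommLeft A ∘ₗ M) := by
  classical
  intro f n
  obtain ⟨J, hJ⟩ := h.exists_finset
    {f, A f, parity (A f), parity (A (parity f)), A (parity f)} n
  refine ⟨J, fun φ hφ => ?_⟩
  have h1 := hJ φ hφ
  exact superComm_apply_mem_right hA (h1 _ (by simp)) (h1 _ (by simp)) (h1 _ (by simp))
    (h1 _ (by simp)) (h1 _ (by simp))

/-! ### Bracket relations for functionals with infinitely many coefficients. -/

section Bracket

variable (c : E ⊕ {t : Θ // t ≠ o} → E ⊕ {t : Θ // t ≠ o} → 𝕂)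
  (l : E ⊕ {t : Θ // t ≠ o} → E ⊕ {t : Θ // t ≠ o} → E ⊕ {t : Θ // t ≠ o})
  (hl : ∀ k, {p : (E ⊕ {t : Θ // t ≠ o}) × (E ⊕ {t : Θ // t ≠ o}) | l p.1 p.2 = k}.Finite)

/-- The bilinear operation on functionals with structure constants `c i j` at `l i j`. -/
def dualBracket : Module.Dual 𝕂 (VSpace 𝕂 E o) →ₗ[𝕂] Module.Dual 𝕂 (VSpace 𝕂 E o) →ₗ[𝕂]
    Module.Dual 𝕂 (VSpace 𝕂 E o) :=
  LinearMap.mk₂ 𝕂 (fun φ ψ => dualOfCoeff fun k =>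
      ∑ p ∈ (hl k).toFinset, c p.1 p.2 * (dualCoeff φ p.1 * dualCoeff ψ p.2))
    (fun φ φ' ψ => dual_ext fun k => by
      simp only [dualCoeff_add, dualCoeff_dualOfCoeff]
      simp [add_mul, mul_add, Finset.sum_add_distrib])
    (fun r φ ψ => dual_ext fun k => by
      simp only [dualCoeff_smul, dualCoeff_dualOfCoeff]
      simp [mul_assoc, mul_left_comm, Finset.mul_sum])
    (fun φ ψ ψ' => dual_ext fun k => by
      simp only [dualCoeff_add, dualCoeff_dualOfCoeff]
      simp [mul_add, Finset.sum_add_distrib])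
    (fun r φ ψ => dual_ext fun k => by
      simp only [dualCoeff_smul, dualCoeff_dualOfCoeff]
      simp [mul_left_comm, Finset.mul_sum])

lemma dualCoeff_dualBracket (φ ψ : Module.Dual 𝕂 (VSpace 𝕂 E o)) (k) :
    dualCoeff (dualBracket c l hl φ ψ) k =
      ∑ p ∈ (hl k).toFinset, c p.1 p.2 * (dualCoeff φ p.1 * dualCoeff ψ p.2) :=
  dualCoeff_dualOfCoeff _ k

lemma dualBracket_dualVec (i j : E ⊕ {t : Θ // t ≠ o}) :
    dualBracket c l hl (dualVec i) (dualVec j) = c i j • dualVec (l i j) := by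
  classical
  refine dual_ext fun k => ?_
  rw [dualCoeff_dualBracket, dualCoeff_smul, dualCoeff_dualVec]
  have h : ∀ p ∈ (hl k).toFinset, c p.1 p.2 * (dualCoeff (dualVec i) p.1 *
      dualCoeff (dualVec j) p.2) = if p = (i, j) then c i j else 0 := by
    rintro ⟨p, q⟩ _
    simp only [dualCoeff_dualVec, Prod.mk.injEq]
    by_cases h1 : p = i
    · by_cases h2 : q = j
      · simp [h1, h2]
      · simp [h2]
    · simp [h1]
  rw [Finset.sum_congr rfl h, Finset.sum_ite_eq']
  simp [eq_comm]

variable {l}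

/-- By finiteness of the fibres of `l`, each coefficient of the bracket involves only finitely many
coefficients of `ψ`. -/
lemma IsContinuousOp.dualBracket_left (h : IsContinuousOp M) (φ : Module.Dual 𝕂 (VSpace 𝕂 E o)) :
    IsContinuousOp (hbarLeft ∘ₗ M ∘ₗ dualBracket c l hl φ) := by
  classical
  intro f n
  obtain ⟨J, hJ⟩ := h f n
  refine ⟨J.biUnion fun k => (hl k).toFinset.image Prod.snd, fun ψ hψ => ?_⟩
  refine (raisesDegree_hbar.mono (Nat.zero_le 2)).apply (hJ _ fun k hk => ?_)
  rw [dualCoeff_dualBracket]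
  refine Finset.sum_eq_zero fun p hp => ?_
  rw [hψ p.2 (Finset.mem_biUnion.2 ⟨k, hk, Finset.mem_image_of_mem _ hp⟩), mul_zero, mul_zero]

lemma IsContinuousOp.dualBracket_right (h : IsContinuousOp M)
    (ψ : Module.Dual 𝕂 (VSpace 𝕂 E o)) :
    IsContinuousOp (hbarLeft ∘ₗ M ∘ₗ (dualBracket c l hl).flip ψ) := by
  classical
  intro f n
  obtain ⟨J, hJ⟩ := h f n
  refine ⟨J.biUnion fun k => (hl k).toFinset.image Prod.fst, fun φ hφ => ?_⟩
  refine (raisesDegree_hbar.mono (Nat.zero_le 2)).apply (hJ _ fun k hk => ?_)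
  rw [LinearMap.flip_apply, dualCoeff_dualBracket]
  refine Finset.sum_eq_zero fun p hp => ?_
  rw [hφ p.1 (Finset.mem_biUnion.2 ⟨k, hk, Finset.mem_image_of_mem _ hp⟩), zero_mul, mul_zero]

/-- Bracket relations of the values on the dual basis extend to all functionals. -/
lemma superComm_airyOp (hT0 : ∀ φ, RaisesDegree 0 (airyOp T hT φ))
    (hbr : ∀ i j, superComm (T i) (T j) = c i j • (hbar * T (l i j)))
    (φ ψ : Module.Dual 𝕂 (VSpace 𝕂 E o)) :
    superComm (airyOp T hT φ) (airyOp T hT ψ) =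
      hbar * airyOp T hT (dualBracket c l hl φ ψ) := by
  have hM := isContinuousOp_airyOp hT
  -- The extension from the dual basis is made one argument at a time, since continuity is available
  -- only separately.
  have h1 : ∀ (φ : Module.Dual 𝕂 (VSpace 𝕂 E o)) j, superComm (airyOp T hT φ) (T j) =
      hbar * airyOp T hT (dualBracket c l hl φ (dualVec j)) := by
    intro φ j
    have hj : RaisesDegree 0 (T j) := by
      rw [← airyOp_dualVec hT j]
      exact hT0 _
    have := (hM.superCommRight hj).eq_of_dualVec (hM.dualBracket_right c hl (dualVec j))
      (fun i => ?_) φ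
    · simpa only [LinearMap.comp_apply, superCommRight_apply, hbarLeft_apply,
        LinearMap.flip_apply] using this
    · simp only [LinearMap.comp_apply, superCommRight_apply, hbarLeft_apply,
        LinearMap.flip_apply]
      rw [dualBracket_dualVec, map_smul, airyOp_dualVec, airyOp_dualVec, hbr, mul_smul_comm]
  have := (hM.superCommLeft (hT0 φ)).eq_of_dualVec (hM.dualBracket_left c hl φ) (fun j => ?_) ψ
  · simpa only [LinearMap.comp_apply, superCommLeft_apply, hbarLeft_apply] using this
  · simp only [LinearMap.comp_apply, superCommLeft_apply, hbarLeft_apply]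
    rw [airyOp_dualVec, h1]

end Bracket

end AiryMap

/-! ### From structure constants to a super quantum Airy structure. -/

section AiryStructure

variable {𝕂 : Type} [RCLike 𝕂] {E Θ : Type} [LinearOrder Θ] {o : Θ}
  {T : E ⊕ {t : Θ // t ≠ o} → Op 𝕂 E Θ} (hT : FamilyFinite T)

lemma airyOp_mem_weylHat {U : Set (E ⊕ Θ)} (hW : ∀ j, T j ∈ weylHat 𝕂 U)
    (φ : Module.Dual 𝕂 (VSpace 𝕂 E o)) : airyOp T hT φ ∈ weylHat 𝕂 U := by
  obtain ⟨h, e⟩ := airyOp_apply hT φ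
  rw [e]
  exact familySum_mem_weylHat h fun j => Subalgebra.smul_mem _ (hW j) _

/-- The continuous linear map with given values on the dual basis, as a map to the completed Weyl
algebra. -/
def airyMap (hW : ∀ j, T j ∈ weylHat 𝕂 (Set.univ : Set (E ⊕ Θ))) :
    Module.Dual 𝕂 (VSpace 𝕂 E o) →ₗ[𝕂] weylHat 𝕂 (Set.univ : Set (E ⊕ Θ)) where
  toFun φ := ⟨airyOp T hT φ, airyOp_mem_weylHat hT hW φ⟩
  map_add' φ ψ := Subtype.ext (map_add _ φ ψ)
  map_smul' c φ := Subtype.ext (map_smul _ c φ)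

lemma eq_of_isContinuous
    {L L' : Module.Dual 𝕂 (VSpace 𝕂 E o) →ₗ[𝕂] weylHat 𝕂 (Set.univ : Set (E ⊕ Θ))}
    (h : IsContinuous L) (h' : IsContinuous L') (e : ∀ i, L' (dualVec i) = L (dualVec i)) :
    L' = L := by
  let v := (weylHat 𝕂 (Set.univ : Set (E ⊕ Θ))).val.toLinearMap
  have h1 : IsContinuousOp (v ∘ₗ L) := h
  have h2 : IsContinuousOp (v ∘ₗ L') := h'
  refine LinearMap.ext fun φ => Subtype.ext ?_
  refine h2.eq_of_dualVec h1 (fun j => ?_) φ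
  rw [LinearMap.comp_apply, LinearMap.comp_apply, e]

/-- A family of homogeneous elements of the completed Weyl algebra that tends to zero and is
closed under brackets up to `ħ` defines a super quantum Airy structure. -/
theorem isSuperQuantumAiry_airyMap (hW : ∀ j, T j ∈ weylHat 𝕂 (Set.univ : Set (E ⊕ Θ)))
    (hp : ∀ j, IsHomog j.isRight (T j))
    (c : E ⊕ {t : Θ // t ≠ o} → E ⊕ {t : Θ // t ≠ o} → 𝕂)
    (l : E ⊕ {t : Θ // t ≠ o} → E ⊕ {t : Θ // t ≠ o} → E ⊕ {t : Θ // t ≠ o})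
    (hl : ∀ k, {p : (E ⊕ {t : Θ // t ≠ o}) × (E ⊕ {t : Θ // t ≠ o}) | l p.1 p.2 = k}.Finite)
    (hbr : ∀ i j, superComm (T i) (T j) = c i j • (hbar * T (l i j)))
    (hlin : ∀ i, RaisesDegree 2 (T i - hbarD (toTilde i))) :
    IsSuperQuantumAiry (airyMap hT hW) := by
  have heven : ∀ φ : Module.Dual 𝕂 (VSpace 𝕂 E o), (∀ t, dualCoeff φ (Sum.inr t) = 0) →
      IsHomog false (airyOp T hT φ) := fun φ hφ => isHomog_airyOp hT φ fun j => by
    rcases j with e | t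
    · exact Or.inr (hp _)
    · exact Or.inl (hφ t)
  have hodd : ∀ φ : Module.Dual 𝕂 (VSpace 𝕂 E o), (∀ e, dualCoeff φ (Sum.inl e) = 0) →
      IsHomog true (airyOp T hT φ) := fun φ hφ => isHomog_airyOp hT φ fun j => by
    rcases j with e | t
    · exact Or.inl (hφ e)
    · exact Or.inr (hp (Sum.inr t))
  refine ⟨isContinuousOp_airyOp hT, fun φ hφ => isHomog_false_iff.1 (heven φ hφ),
    fun φ hφ => isHomog_true_iff.1 (hodd φ hφ), ?_, fun i => ?_⟩
  -- The value at a functional of mixed parity is not homogeneous. It is the sum of the values at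
  -- the even and odd parts of the functional, so the homogeneous values generate the same ideal.
  · let G := {g | g ∈ Set.range (airyMap hT hW) ∧ ∃ p, IsHomog p (g : Op 𝕂 E Θ)}
    have hspan : Ideal.span (Set.range (airyMap hT hW)) = Ideal.span G := by
      refine le_antisymm (Ideal.span_le.2 ?_) (Ideal.span_mono fun g hg => hg.1)
      rintro _ ⟨φ, rfl⟩
      let φ₀ : Module.Dual 𝕂 (VSpace 𝕂 E o) :=
        dualOfCoeff (Sum.elim (fun e => dualCoeff φ (Sum.inl e)) fun _ => 0)
      let φ₁ : Module.Dual 𝕂 (VSpace 𝕂 E o) :=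
        dualOfCoeff (Sum.elim (fun _ => 0) fun t => dualCoeff φ (Sum.inr t))
      have hφ : φ = φ₀ + φ₁ := dual_ext fun j => by
        change _ = dualCoeff φ₀ j + dualCoeff φ₁ j
        rw [dualCoeff_dualOfCoeff, dualCoeff_dualOfCoeff]
        rcases j with e | t <;> simp
      rw [hφ, map_add]
      refine add_mem (Ideal.subset_span ⟨⟨φ₀, rfl⟩, false, heven _ fun t => ?_⟩)
        (Ideal.subset_span ⟨⟨φ₁, rfl⟩, true, hodd _ fun e => ?_⟩)
      · exact dualCoeff_dualOfCoeff _ _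
      · exact dualCoeff_dualOfCoeff _ _
    rw [hspan]
    intro A hA B hB
    refine superComm_mem_hbarIdeal_span (fun g hg => hg.2) ?_ hA hB
    rintro _ ⟨⟨φ, rfl⟩, -⟩ _ ⟨⟨ψ, rfl⟩, -⟩
    refine ⟨airyMap hT hW (dualBracket c l hl φ ψ), ?_, ?_⟩
    · rw [← hspan]
      exact Ideal.subset_span ⟨_, rfl⟩
    · exact superComm_airyOp hT c hl
        (fun φ => raisesDegree_of_mem_weylHat (airyOp_mem_weylHat hT hW φ)) hbr φ ψ
  · change RaisesDegree 2 (airyOp T hT (dualVec i) - hbarD (toTilde i))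
    rw [airyOp_dualVec]
    exact hlin i

end AiryStructure

/-! ### The Virasoro operators as a family tending to zero -/

section Estimates

attribute [local instance] opRing

variable {𝕂 : Type} [RCLike 𝕂]

lemma op_sub_eq_neg_smul {E Θ : Type} {A B C : Op 𝕂 E Θ} {r : 𝕂} (h : A - B = r • C) :
    B - A = (-r) • C := by
  rw [neg_smul, ← h, neg_sub]

lemma op_sub_neg_mul {E Θ : Type} (A B C : Op 𝕂 E Θ) : A - -B * C = A + B * C := by
  rw [neg_mul, sub_neg_eq_add]

lemma raisesDegree_mulCoord {E Θ : Type} [LinearOrder Θ] (a : E ⊕ Θ) :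
    RaisesDegree 1 (mulCoord a : Op 𝕂 E Θ) := by
  rintro n f hf ⟨m, S, k⟩ hM
  rcases a with a | a
  · change (mulX a f).1 _ = 0
    rw [mulX_apply]
    by_cases h : m a = 0
    · simp [h]
    · have h1 : Finsupp.single a 1 ≤ m := by
        rw [Finsupp.single_le_iff]; omega
      have h2 : (m - Finsupp.single a 1).degree + 1 = m.degree := by
        conv_rhs => rw [← tsub_add_cancel_of_le h1]
        rw [map_add, Finsupp.degree_single]
      rw [hf _ (by simp only [deg] at hM ⊢; omega), mul_zero]
  · change (mulTheta a f).1 _ = 0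
    rw [mulTheta_apply]
    by_cases h : a ∈ S
    · have h2 := Finset.card_erase_add_one h
      rw [hf _ (by simp only [deg] at hM ⊢; omega), mul_zero]
    · simp [h]

lemma raisesDegree_hbarD {E Θ : Type} [LinearOrder Θ] (a : E ⊕ Θ) :
    RaisesDegree 1 (hbarD a : Op 𝕂 E Θ) := by
  rintro n f hf ⟨m, S, k⟩ hM
  rcases k with _ | k
  · rw [hbarD, Module.End.mul_apply, hbar_apply]
    simp
  rcases a with a | a
  · rw [hbarD, Sum.elim_inl, Module.End.mul_apply, hbar_apply, dX_apply, hf, mul_zero, mul_zero]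
    simp only [deg, map_add, Finsupp.degree_single] at hM ⊢
    omega
  · have h2 := Finset.card_insert_le a S
    rw [hbarD, Sum.elim_inr, Module.End.mul_apply, hbar_apply, dTheta_apply, hf, mul_zero, mul_zero]
    simp only [deg] at hM ⊢
    omega

variable {Θ : Type} [LinearOrder Θ] (ι : ℕ+ ↪ Θ) (N : ℕ)

lemma raisesDegree_one_bMode (k : ℤ) : RaisesDegree 1 (bMode k : Op 𝕂 ℕ+ Θ) := by
  rcases k with j | j
  · exact raisesDegree_hbarD _
  · exact (raisesDegree_mulCoord _).smul _

lemma raisesDegree_one_psiMode (k : ℤ) : RaisesDegree 1 (psiMode ι k : Op 𝕂 ℕ+ Θ) := by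
  rcases k with j | j
  · exact raisesDegree_hbarD _
  · exact raisesDegree_mulCoord _

lemma raisesDegree_opHD_sub (R : ℕ) (D : ℕ+ → 𝕂) (i : ℕ+) :
    RaisesDegree 2 (opHD N ι R D i - hbarD (Sum.inl i) : Op 𝕂 ℕ+ Θ) := by
  rw [opHD, opH, opSum_eq_familySum, opSum_eq_familySum, add_assoc, add_assoc, add_sub_cancel_left]
  refine RaisesDegree.add (RaisesDegree.smul _ (raisesDegree_familySum _ fun k => ?_))
    (RaisesDegree.add (RaisesDegree.smul _ (raisesDegree_familySum _ fun k => ?_)) ?_)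
  · rw [normalB]
    split_ifs
    · exact (raisesDegree_one_bMode _).mul (raisesDegree_one_bMode _)
    · exact (raisesDegree_one_bMode _).mul (raisesDegree_one_bMode _)
  · refine RaisesDegree.smul _ ?_
    rw [normalPsi]
    split_ifs
    · exact (raisesDegree_one_psiMode ι _).mul (raisesDegree_one_psiMode ι _)
    · exact ((raisesDegree_one_psiMode ι _).mul (raisesDegree_one_psiMode ι _)).neg
  · split_ifs
    · exact raisesDegree_hbar.smul _
    · exact RaisesDegree.zero

lemma raisesDegree_opF_sub (i : ℕ+) :
    RaisesDegree 2 (opF N ι i - hbarD (Sum.inr (ι i)) : Op 𝕂 ℕ+ Θ) := by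
  rw [opF, opSum_eq_familySum, add_sub_cancel_left]
  exact raisesDegree_familySum _ fun k =>
    (raisesDegree_one_bMode _).mul (raisesDegree_one_psiMode ι _)

lemma exists_mode_bound (f : Series 𝕂 ℕ+ Θ) (n : ℕ) : ∃ K : ℕ, ∀ k : ℤ, K ≤ k →
    (bMode k : Op 𝕂 ℕ+ Θ) f ∈ degGE 𝕂 ℕ+ Θ n ∧ (psiMode ι k : Op 𝕂 ℕ+ Θ) f ∈ degGE 𝕂 ℕ+ Θ n := by
  obtain ⟨b, hb⟩ := (finite_bMode f n).bddAbove
  obtain ⟨b', hb'⟩ := (finite_psiMode ι f n).bddAbove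
  refine ⟨(max b b').toNat + 1, fun k hk => ⟨?_, ?_⟩⟩
  · by_contra h
    have := hb ⟨by omega, h⟩
    omega
  · by_contra h
    have := hb' ⟨by omega, h⟩
    omega

/-- In each summand the indices add up to `i + N - 2`, so for large `i` one of them is at least `K`.
That mode is negligible at `f`, and it stands on the right or can be commuted there. -/
lemma exists_opHD_opF_bound (R : ℕ) (D : ℕ+ → 𝕂) (f : Series 𝕂 ℕ+ Θ) (n : ℕ) :
    ∃ K : ℕ, ∀ i : ℕ+, K ≤ (i : ℕ) →
      (opHD N ι R D i : Op 𝕂 ℕ+ Θ) f ∈ degGE 𝕂 ℕ+ Θ n ∧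
      (opF N ι i : Op 𝕂 ℕ+ Θ) f ∈ degGE 𝕂 ℕ+ Θ n := by
  obtain ⟨K, hK⟩ := exists_mode_bound ι f n
  have hB : ∀ k l : ℤ, 0 ≤ k → 0 ≤ l →
      (bMode k * bMode l : Op 𝕂 ℕ+ Θ) = bMode l * bMode k := fun k l hk hl => by
    have := bMode_bMode (𝕂 := 𝕂) (Θ := Θ) k l
    rwa [if_neg (by omega), sub_eq_zero] at this
  -- The `R` removes the constant `D_i`, and the `2` offsets the `-2` in the index sum, which is
  -- therefore at least `2 * K`.
  refine ⟨2 * K + R + 2, fun i hi => ⟨?_, ?_⟩⟩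
  · rw [opHD, if_neg (by omega), add_zero, opH, opSum_eq_familySum, opSum_eq_familySum]
    refine add_mem (add_mem ?_ (Submodule.smul_mem _ _ (familySum_apply_mem _ fun k => ?_)))
      (Submodule.smul_mem _ _ (familySum_apply_mem _ fun k => Submodule.smul_mem _ _ ?_))
    · rw [← bMode_sub_one]
      exact (hK _ (by omega)).1
    · rw [normalB]
      split_ifs with h
      · exact bMode_mem_degGE _ (hK _ (by omega)).1
      · by_cases hl : K ≤ ((i : ℤ) + N - 1) - 1 - k
        · exact bMode_mem_degGE _ (hK _ hl).1
        · rw [hB _ _ (by omega) (by omega)]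
          exact bMode_mem_degGE _ (hK _ (by omega)).1
    · rw [normalPsi]
      split_ifs with h
      · exact psiMode_mem_degGE ι _ (hK _ (by omega)).2
      · exact neg_mem (psiMode_mem_degGE ι _ (hK _ (by omega)).2)
  · rw [opF, opSum_eq_familySum]
    refine add_mem ?_ (familySum_apply_mem _ fun k => ?_)
    · rw [← psiMode_sub_one]
      exact (hK _ (by omega)).2
    · by_cases hl : (K : ℤ) ≤ k
      · exact bMode_mem_degGE _ (hK _ hl).2
      · rw [bMode_psiMode]
        exact psiMode_mem_degGE ι _ (hK _ (by omega)).1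

end Estimates

/-! ### The two classes of super quantum Airy structures -/

section Classes

section Index

variable {Θ : Type} {ι : ℕ+ ↪ Θ} {o : Θ} {idx : {t : Θ // t ≠ o} → ℕ+}

/-- The index of an even or odd coordinate. -/
def coordIndex (idx : {t : Θ // t ≠ o} → ℕ+) : ℕ+ ⊕ {t : Θ // t ≠ o} → ℕ+ := Sum.elim id idx

lemma finite_coordIndex_le (hidx : ∀ t, ι (idx t) = t.1) (b : ℕ) :
    {j : ℕ+ ⊕ {t : Θ // t ≠ o} | (coordIndex idx j : ℕ) ≤ b}.Finite := by
  have hinj : Function.Injective idx := fun s t h => Subtype.ext (by rw [← hidx, ← hidx, h])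
  have hfin : {i : ℕ+ | (i : ℕ) ≤ b}.Finite :=
    (Set.finite_Iic b).preimage PNat.coe_injective.injOn
  refine ((hfin.image Sum.inl).union ((hfin.preimage hinj.injOn).image Sum.inr)).subset ?_
  rintro (i | t) h
  · exact Or.inl ⟨i, h, rfl⟩
  · exact Or.inr ⟨t, h, rfl⟩

end Index

variable {𝕂 : Type} [RCLike 𝕂] {Θ : Type} [LinearOrder Θ] (ι : ℕ+ ↪ Θ) (N : ℕ) {o : Θ}

/-- The operators `H_i + ħ D_i δ_{i ≤ R}` and `F_j`, where `idx` numbers the odd coordinates. -/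
def virasoroFamily (idx : {t : Θ // t ≠ o} → ℕ+) (R : ℕ) (D : ℕ+ → 𝕂) :
    ℕ+ ⊕ {t : Θ // t ≠ o} → Op 𝕂 ℕ+ Θ :=
  Sum.elim (opHD N ι R D) fun t => opF N ι (idx t)

variable {ι N} {idx : {t : Θ // t ≠ o} → ℕ+} {R : ℕ} {D : ℕ+ → 𝕂}

lemma isHomog_opHD (i : ℕ+) : IsHomog false (opHD N ι R D i : Op 𝕂 ℕ+ Θ) := by
  refine (isHomog_opH ι N i).add ?_
  split_ifs
  · exact isHomog_hbar.smul _
  · exact IsHomog.zero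

lemma isHomog_virasoroFamily (j : ℕ+ ⊕ {t : Θ // t ≠ o}) :
    IsHomog j.isRight (virasoroFamily ι N idx R D j) := by
  rcases j with i | t
  · exact isHomog_opHD i
  · exact isHomog_opF ι N (idx t)

lemma virasoroFamily_mem {U : Set (ℕ+ ⊕ Θ)} (hU : ∀ a, Sum.inl a ∈ U)
    (hU' : ∀ j, Sum.inr (ι j) ∈ U) (j : ℕ+ ⊕ {t : Θ // t ≠ o}) :
    virasoroFamily ι N idx R D j ∈ weylHat 𝕂 U := by
  rcases j with i | t
  · refine add_mem (opH_mem_weylHat ι N hU hU' i) ?_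
    split_ifs
    · exact Subalgebra.smul_mem _ hbar_mem_weylHat _
    · exact zero_mem _
  · exact opF_mem_weylHat ι N hU hU' (idx t)

lemma familyFinite_virasoroFamily (hidx : ∀ t, ι (idx t) = t.1) :
    FamilyFinite (virasoroFamily ι N idx R D) := by
  intro f n
  obtain ⟨K, hK⟩ := exists_opHD_opF_bound ι N R D f n
  refine (finite_coordIndex_le hidx K).subset ?_
  intro j hj
  by_contra h
  have h' : K ≤ (coordIndex idx j : ℕ) := (not_le.1 h).le
  rcases j with i | t
  · exact hj (hK i h').1
  · exact hj (hK (idx t) h').2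

lemma raisesDegree_virasoroFamily_sub (hidx : ∀ t, ι (idx t) = t.1) (j : ℕ+ ⊕ {t : Θ // t ≠ o}) :
    RaisesDegree 2 (virasoroFamily ι N idx R D j - hbarD (toTilde j)) := by
  rcases j with i | t
  · exact raisesDegree_opHD_sub ι N R D i
  · have := raisesDegree_opF_sub (𝕂 := 𝕂) ι N (idx t)
    rwa [hidx] at this

/-- The index of the right hand sides of the Ramond relations. -/
def indexSum (N : ℕ) (m n : ℕ+) : ℕ+ :=
  ⟨m + n + N - 1, by have := m.pos; have := n.pos; omega⟩

lemma indexSum_coe (m n : ℕ+) : ((indexSum N m n : ℕ+) : ℤ) = m + n + N - 1 := by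
  have := m.pos
  change ((m + n + N - 1 : ℕ) : ℤ) = _
  omega

/-- The operators `H_i + ħ D_i δ_{i ≤ R}` and `F_j`, `j ≥ j₀`, form a super quantum Airy structure
as soon as they satisfy the Ramond relations. -/
theorem isSuperQuantumAiry_virasoro (hidx : ∀ t, ι (idx t) = t.1) {j₀ : ℕ+}
    (hj₀ : ∀ j, j₀ ≤ j ↔ ι j ≠ o)
    (hR : RamondRelations N j₀ (opHD N ι R D) (opF (𝕂 := 𝕂) N ι)) :
    IsSuperQuantumAiry (airyMap (familyFinite_virasoroFamily (N := N) (R := R) (D := D) hidx)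
      (virasoroFamily_mem (fun _ => Set.mem_univ _) (fun _ => Set.mem_univ _))) := by
  have hle : ∀ t, j₀ ≤ idx t := fun t => (hj₀ _).2 (by rw [hidx]; exact t.2)
  -- Since `m + N - 1 ≥ 0`, the index does not drop below `j₀`, so a bracket of even with odd never
  -- produces the extra coordinate.
  have hne : ∀ m t, ι (indexSum N m (idx t)) ≠ o := fun m t => by
    refine (hj₀ _).1 ((hle t).trans ?_)
    have h1 := indexSum_coe (N := N) m (idx t)
    have := m.pos
    rw [← PNat.coe_le_coe]
    omega
  have hidx' : ∀ j (h : ι j ≠ o), idx ⟨ι j, h⟩ = j := fun j h => ι.injective (hidx ⟨ι j, h⟩)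
  let l : ℕ+ ⊕ {t : Θ // t ≠ o} → ℕ+ ⊕ {t : Θ // t ≠ o} → ℕ+ ⊕ {t : Θ // t ≠ o} :=
    fun i j => match i, j with
    | Sum.inl m, Sum.inl n => Sum.inl (indexSum N m n)
    | Sum.inl m, Sum.inr t => Sum.inr ⟨_, hne m t⟩
    | Sum.inr t, Sum.inl m => Sum.inr ⟨_, hne m t⟩
    | Sum.inr s, Sum.inr t => Sum.inl (indexSum N (idx s) (idx t))
  let c : ℕ+ ⊕ {t : Θ // t ≠ o} → ℕ+ ⊕ {t : Θ // t ≠ o} → 𝕂 :=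
    fun i j => match i, j with
    | Sum.inl m, Sum.inl n => (m : 𝕂) - n
    | Sum.inl m, Sum.inr t => ((m : 𝕂) - N + 1) / 2 - idx t
    | Sum.inr t, Sum.inl m => -(((m : 𝕂) - N + 1) / 2 - idx t)
    | Sum.inr _, Sum.inr _ => 2
  have hw : ∀ i j, ((coordIndex idx (l i j) : ℕ+) : ℤ) =
      coordIndex idx i + coordIndex idx j + N - 1 := by
    rintro (m | s) (n | t)
    · exact indexSum_coe m n
    · change ((idx ⟨_, hne m t⟩ : ℕ+) : ℤ) = _
      rw [hidx']
      exact indexSum_coe m (idx t)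
    · change ((idx ⟨_, hne n s⟩ : ℕ+) : ℤ) = (idx s : ℤ) + n + N - 1
      rw [hidx', indexSum_coe]
      ring
    · exact indexSum_coe (idx s) (idx t)
  refine isSuperQuantumAiry_airyMap _ _ isHomog_virasoroFamily c l (fun k => ?_) ?_
    (raisesDegree_virasoroFamily_sub hidx)
  -- Indices are at least 1, so neither argument of a bracket has a larger index than the result;
  -- this bounds the fibres.
  · refine ((finite_coordIndex_le hidx (coordIndex idx k)).prod
      (finite_coordIndex_le hidx (coordIndex idx k))).subset ?_
    rintro ⟨i, j⟩ rfl
    have h := hw i j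
    have h1 := (coordIndex idx i).pos
    have h2 := (coordIndex idx j).pos
    constructor
    · change (coordIndex idx i : ℕ) ≤ coordIndex idx (l i j)
      omega
    · change (coordIndex idx j : ℕ) ≤ coordIndex idx (l i j)
      omega
  · intro i j
    rw [superComm_of_isHomog (isHomog_virasoroFamily i),
      (isHomog_virasoroFamily j).twist_eq]
    rcases i with m | s <;> rcases j with n | t
    · exact hR.even_even m n _ (indexSum_coe m n)
    · change opHD N ι R D m * opF N ι (idx t) - opF N ι (idx t) * opHD N ι R D m =
        (((m : 𝕂) - N + 1) / 2 - idx t) • (hbar * opF N ι (idx ⟨_, hne m t⟩))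
      rw [hidx']
      exact hR.even_odd m _ _ (hle t) (indexSum_coe m (idx t))
    · change opF N ι (idx s) * opHD N ι R D n - opHD N ι R D n * opF N ι (idx s) =
        -(((n : 𝕂) - N + 1) / 2 - idx s) • (hbar * opF N ι (idx ⟨_, hne n s⟩))
      rw [hidx']
      exact op_sub_eq_neg_smul (hR.even_odd n _ _ (hle s) (indexSum_coe n (idx s)))
    · change opF N ι (idx s) * opF N ι (idx t) - (-opF N ι (idx t)) * opF N ι (idx s) =
        (2 : 𝕂) • (hbar * opHD N ι R D (indexSum N (idx s) (idx t)))
      rw [← hR.odd_odd _ _ _ (hle s) (hle t) (indexSum_coe (idx s) (idx t))]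
      exact op_sub_neg_mul _ _ _

end Classes

end SuperAiry

end

/-! ### The two classes of structures. -/

theorem mainTheorem10 (𝕂 : Type) [RCLike 𝕂] (N : ℕ) :
    -- the modes represent the super Heisenberg algebra, and `H_i`, `F_i` are elements of the
    -- completed Weyl algebra of `V` that represent the Ramond super Virasoro subalgebra
    SuperAiry.HeisenbergRelations (𝕂 := 𝕂) (Θ := ℕ+) SuperAiry.bMode
      (SuperAiry.psiMode (Function.Embedding.refl ℕ+)) ∧
    (∀ i : ℕ+,
      SuperAiry.opH N (Function.Embedding.refl ℕ+) i ∈ SuperAiry.weylHat 𝕂 Set.univ ∧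
      SuperAiry.opF N (Function.Embedding.refl ℕ+) i ∈ SuperAiry.weylHat 𝕂 Set.univ) ∧
    SuperAiry.RamondRelations (𝕂 := 𝕂) N 1 (SuperAiry.opH N (Function.Embedding.refl ℕ+))
      (SuperAiry.opF N (Function.Embedding.refl ℕ+)) ∧
    -- first class: `V` has the odd coordinates `θ^1, θ^2, …`, and `θ^0` is extra but does not occur
    (∀ D : ℕ+ → 𝕂,
      ∃ L : Module.Dual 𝕂 (SuperAiry.VSpace 𝕂 ℕ+ (0 : ℕ)) →ₗ[𝕂]
          SuperAiry.weylHat 𝕂 (Set.univ : Set (ℕ+ ⊕ ℕ)),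
        (∀ i : ℕ+, (L (SuperAiry.dualVec (Sum.inl i)) : SuperAiry.Op 𝕂 ℕ+ ℕ) =
          SuperAiry.opHD N SuperAiry.oddEmb N D i) ∧
        (∀ j : ℕ+, (L (SuperAiry.dualVec (Sum.inr ⟨j, j.ne_zero⟩)) : SuperAiry.Op 𝕂 ℕ+ ℕ) =
          SuperAiry.opF N SuperAiry.oddEmb j) ∧
        SuperAiry.IsSuperQuantumAiry L ∧
        (∀ φ, (L φ : SuperAiry.Op 𝕂 ℕ+ ℕ) ∈
          SuperAiry.weylHat 𝕂 ({a | a ≠ Sum.inr 0} : Set (ℕ+ ⊕ ℕ))) ∧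
        SuperAiry.RamondRelations N 1 (SuperAiry.opHD N SuperAiry.oddEmb N D)
          (SuperAiry.opF N SuperAiry.oddEmb) ∧
        ∀ L' : Module.Dual 𝕂 (SuperAiry.VSpace 𝕂 ℕ+ (0 : ℕ)) →ₗ[𝕂]
            SuperAiry.weylHat 𝕂 (Set.univ : Set (ℕ+ ⊕ ℕ)),
          SuperAiry.IsContinuous L' →
          (∀ i, L' (SuperAiry.dualVec i) = L (SuperAiry.dualVec i)) → L' = L) ∧
    -- second class: `V_red` has the odd coordinates `θ^2, θ^3, …`, and `θ^1` is the extra one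
    (∀ D : ℕ+ → 𝕂,
      ∃ L : Module.Dual 𝕂 (SuperAiry.VSpace 𝕂 ℕ+ (1 : ℕ+)) →ₗ[𝕂]
          SuperAiry.weylHat 𝕂 (Set.univ : Set (ℕ+ ⊕ ℕ+)),
        (∀ i : ℕ+, (L (SuperAiry.dualVec (Sum.inl i)) : SuperAiry.Op 𝕂 ℕ+ ℕ+) =
          SuperAiry.opHD N (Function.Embedding.refl ℕ+) (N + 1) D i) ∧
        (∀ (j : ℕ+) (hj : j ≠ 1),
          (L (SuperAiry.dualVec (Sum.inr ⟨j, hj⟩)) : SuperAiry.Op 𝕂 ℕ+ ℕ+) =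
            SuperAiry.opF N (Function.Embedding.refl ℕ+) j) ∧
        SuperAiry.IsSuperQuantumAiry L ∧
        SuperAiry.RamondRelations N 2
          (SuperAiry.opHD N (Function.Embedding.refl ℕ+) (N + 1) D)
          (SuperAiry.opF N (Function.Embedding.refl ℕ+)) ∧
        ∀ L' : Module.Dual 𝕂 (SuperAiry.VSpace 𝕂 ℕ+ (1 : ℕ+)) →ₗ[𝕂]
            SuperAiry.weylHat 𝕂 (Set.univ : Set (ℕ+ ⊕ ℕ+)),
          SuperAiry.IsContinuous L' →
          (∀ i, L' (SuperAiry.dualVec i) = L (SuperAiry.dualVec i)) → L' = L) := by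
  have hU : ∀ a : ℕ+, (Sum.inl a : ℕ+ ⊕ ℕ) ∈ ({a | a ≠ Sum.inr 0} : Set (ℕ+ ⊕ ℕ)) :=
    fun a => Sum.inl_ne_inr
  have hU' : ∀ j : ℕ+, (Sum.inr (SuperAiry.oddEmb j) : ℕ+ ⊕ ℕ) ∈
      ({a | a ≠ Sum.inr 0} : Set (ℕ+ ⊕ ℕ)) := fun j h => j.ne_zero (Sum.inr_injective h)
  refine ⟨SuperAiry.heisenbergRelations _,
    fun i => ⟨SuperAiry.opH_mem_weylHat _ N (fun _ => Set.mem_univ _) (fun _ => Set.mem_univ _) i,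
      SuperAiry.opF_mem_weylHat _ N (fun _ => Set.mem_univ _) (fun _ => Set.mem_univ _) i⟩,
    SuperAiry.ramondRelations_opH, fun D => ?_, fun D => ?_⟩
  · have hR : SuperAiry.RamondRelations N 1 (SuperAiry.opHD N SuperAiry.oddEmb N D)
        (SuperAiry.opF N SuperAiry.oddEmb) := by
      -- From `m, n ≥ 1` follows `l ≥ N + 1`, beyond the constants `D_1, …, D_N`.
      refine SuperAiry.ramondRelations_opHD D (fun m n l h _ => ?_) fun m n l _ _ h => ?_
      all_goals
        have := m.pos
        have := n.pos
        omega
    let idx : {t : ℕ // t ≠ 0} → ℕ+ := fun t => ⟨t.1, Nat.pos_of_ne_zero t.2⟩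
    have hidx : ∀ t, SuperAiry.oddEmb (idx t) = t.1 := fun _ => rfl
    have hA := SuperAiry.isSuperQuantumAiry_virasoro (o := (0 : ℕ)) hidx
      (fun j => ⟨fun _ => j.ne_zero, fun _ => one_le⟩) hR
    refine ⟨_, fun i => ?_, fun j => ?_, hA, fun φ => ?_, hR,
      fun L' hL' e => SuperAiry.eq_of_isContinuous hA.continuous hL' e⟩
    · exact SuperAiry.airyOp_dualVec _ _
    · exact SuperAiry.airyOp_dualVec _ _
    · exact SuperAiry.airyOp_mem_weylHat _ (SuperAiry.virasoroFamily_mem hU hU') φ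
  · have hR : SuperAiry.RamondRelations N 2
        (SuperAiry.opHD N (Function.Embedding.refl ℕ+) (N + 1) D)
        (SuperAiry.opF N (Function.Embedding.refl ℕ+)) := by
      -- Distinct even indices give `l ≥ N + 2`, and odd indices `≥ 2` give `l ≥ N + 3`. Only `{F_1,
      -- F_1} = 2 ħ H_{N+1}` would meet `D_{N+1}`, which is why `θ^1` is made the extra coordinate.
      refine SuperAiry.ramondRelations_opHD D (fun m n l h hmn => ?_) fun m n l hm hn h => ?_
      · have := m.pos
        have := n.pos
        have : (m : ℕ) ≠ n := fun h => hmn (PNat.eq h)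
        omega
      · have hm' : 2 ≤ (m : ℕ) := hm
        have hn' : 2 ≤ (n : ℕ) := hn
        omega
    let idx : {t : ℕ+ // t ≠ 1} → ℕ+ := fun t => t.1
    have hidx : ∀ t, Function.Embedding.refl ℕ+ (idx t) = t.1 := fun _ => rfl
    have hj : ∀ j : ℕ+, 2 ≤ j ↔ Function.Embedding.refl ℕ+ j ≠ 1 := fun j => by
      rw [Function.Embedding.refl_apply, Ne, ← PNat.coe_eq_one_iff, ← PNat.coe_le_coe]
      have := j.pos
      change 2 ≤ (j : ℕ) ↔ _
      omega
    have hA := SuperAiry.isSuperQuantumAiry_virasoro (o := (1 : ℕ+)) hidx hj hR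
    refine ⟨_, fun i => ?_, fun j hj => ?_, hA, hR,
      fun L' hL' e => SuperAiry.eq_of_isContinuous hA.continuous hL' e⟩
    · exact SuperAiry.airyOp_dualVec _ _
    · exact SuperAiry.airyOp_dualVec _ _
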